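/- Let $k$ be an algebraically closed field of characteristic $p>2$ and let $\mathfrak g=\mathfrak g_{\bar 0}\oplus\mathfrak g_{\bar 1}$ be a finite-dimensional restricted Lie superalgebra over $k$: $\mathfrak g_{\bar 0}$ is a restricted Lie algebra with $p$-mapping $x\mapsto x^{[p]}$, $\mathfrak g_{\bar 1}$ is a restricted $\mathfrak g_{\bar 0}$-module under the adjoint action, and $[x,[x,x]]=0$ for odd $x$ (automatic if $p>3$). Its restricted enveloping superalgebra $u(\mathfrak g)$ is the quotient of the enveloping superalgebra $U(\mathfrak g)$ by the ideal generated by the elements $x^p-x^{[p]}$, $x\in\mathfrak g_{\bar 0}$. A triangular decomposition of a restricted Lie superalgebra $\mathfrak a$ relative to a maximal torus $\mathfrak h$ of $\mathfrak a_{\bar 0}$ is a vector space decomposition $$\mathfrak a=\mathfrak a_{\bar 1}^-\oplus\mathfrak n^-_{\mathfrak a}\oplus\mathfrak h\oplus\mathfrak n^+_{\mathfrak a}\oplus\mathfrak a_{\bar 1}^+,\qquad \mathfrak a_{\bar 0}=\mathfrak n^-_{\mathfrak a}\oplus\mathfrak h\oplus\mathfrak n^+_{\mathfrak a},\qquad \mathfrak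 a_{\bar 1}=\mathfrak a_{\bar 1}^-\oplus\mathfrak a_{\bar 1}^+,$$ in which, for each sign, $\mathfrak n^\pm_{\mathfrak a}$ is a restricted subalgebra all of whose elements are $p$-nilpotent, $\mathfrak b^\pm_{\mathfrak a}=\mathfrak a_{\bar 1}^\pm\oplus\mathfrak n^\pm_{\mathfrak a}\oplus\mathfrak h$ is a restricted subalgebra, and $\mathfrak a_{\bar 1}^\pm\oplus\mathfrak n^\pm_{\mathfrak a}$ is an ideal of $\mathfrak b^\pm_{\mathfrak a}$. It is long if $\dim\mathfrak n^-_{\mathfrak a}<\dim\mathfrak n^+_{\mathfrak a}$ and $\dim\mathfrak a_{\bar 1}^-<\dim\mathfrak a_{\bar 1}^+$. A $\mathbb Z_2$-graded ideal is called $p$-nilpotent if all its even elements are $p$-nilpotent. Let $\mathfrak g=\mathfrak g_{\bar 1}^-\oplus\mathfrak n^-\oplus\mathfrak h\oplus\mathfrak n^+\oplus\mathfrak g_{\bar 1}^+$ be a long triangular decomposition, and let $\Lambda=\{\lambda\in\mathfrak h^*\mid\lambda(h^{[p]})=\lambda(h)^p\ \forall h\in\mathfrak h\}$, a finite set. For $\lambda\in\Lambda$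 let $k_\lambda$ be the one-dimensional $u(\mathfrak b^\pm_{\mathfrak g})$-module on which $\mathfrak h$ acts through $\lambda$ and $\mathfrak g_{\bar 1}^\pm\oplus\mathfrak n^\pm$ acts by zero, and put $V^\pm(\lambda)=u(\mathfrak g)\otimes_{u(\mathfrak b^\pm_{\mathfrak g})}k_\lambda$. Let $[M]$ denote the class of $M$ in the Grothendieck group of finite-dimensional $u(\mathfrak g)$-supermodules, where both even and odd homomorphisms are allowed, so that $[M]=[\Pi M]$ for the parity shift $\Pi M$ of $M$. Assume: 1. $\mathfrak g$ has a restricted subalgebra $\mathfrak L$ with a triangular decomposition $\mathfrak L=\mathfrak L_{\bar 1}^-\oplus\mathfrak n^-_{\mathfrak L}\oplus\mathfrak h\oplus\mathfrak n^+_{\mathfrak L}\oplus\mathfrak L_{\bar 1}^+$ relative to the same $\mathfrak h$, such that $\mathfrak L_{\bar 1}^-\oplus\mathfrak n^-_{\mathfrak L}\oplus\mathfrak n^+_{\mathfrak L}\oplus\mathfrak L_{\bar 1}^+$ is a $p$-nilpotent $\mathbb Z_2$-graded ideal of $\mathfrak L$, and $\mathfrak n^+_{\mathfrak L}$ contains $\dim\mathfrak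 h$ linearly independent weight vectors for $\mathfrak h$ with linearly independent weights in $\Lambda$; 2. $\mathfrak b^-_{\mathfrak L}=\mathfrak b^-_{\mathfrak g}$; 3. $\mathfrak n^-$ contains $\dim\mathfrak h$ linearly independent weight vectors for $\mathfrak h$ with linearly independent weights in $\Lambda$. Then for each $\lambda\in\Lambda$, $$[V^-(\lambda)]=\sum_{\mu\in\Lambda}p^s2^t\,[V^+(\mu)],$$ where $s=\dim\mathfrak n^+-\dim\mathfrak n^--\dim\mathfrak h$ and $t=\dim\mathfrak g_{\bar 1}^+-\dim\mathfrak g_{\bar 1}^-$. (If $s<0$, the equation means $p^{-s}[V^-(\lambda)]=\sum_{\mu\in\Lambda}2^t[V^+(\mu)]$.) -/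

import Mathlib

open scoped TensorProduct

universe u v

/-- The sign `(-1)^{ij}` attached to two parities. -/
def superSign (i j : ZMod 2) : ℤ := if i = 1 ∧ j = 1 then -1 else 1

/-- For a bilinear operation `β`, `jacobsonCoeff β x y m j` is the coefficient of `T^j` in
`(ad (T x + y))^m (x)`, where `ad z = β z`. -/
def jacobsonCoeff {k : Type u} {g : Type v} [Field k] [AddCommGroup g] [Module k g]
    (β : g →ₗ[k] g →ₗ[k] g) (x y : g) : ℕ → ℕ → g
  | 0, 0 => x
  | 0, _ + 1 => 0
  | m + 1, 0 => β y (jacobsonCoeff β x y m 0)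
  | m + 1, j + 1 => β x (jacobsonCoeff β x y m j) + β y (jacobsonCoeff β x y m (j + 1))

/-- A restricted Lie superalgebra structure on `g`, over a field `k` of characteristic `p ≠ 2`:
a `ℤ/2`-graded space with a superbracket `br` and a `p`-mapping `pmap` on the even part, such that
the even part is a restricted Lie algebra and the odd part is a restricted module over it
(both conditions on `ad` are contained in `pmap_ad`). The axiom `br_odd_self` follows from `jacobi`
unless the characteristic is `3`, where it is part of the usual definition. -/
structure RestrictedLieSuperalgebra (k : Type u) (p : ℕ) (g : Type v) [Field k] [AddCommGroup g]
    [Module k g] where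
  two_ne_zero : (2 : k) ≠ 0
  gr : ZMod 2 → Submodule k g
  isCompl : IsCompl (gr 0) (gr 1)
  br : g →ₗ[k] g →ₗ[k] g
  br_mem : ∀ {i j : ZMod 2} {x y : g}, x ∈ gr i → y ∈ gr j → br x y ∈ gr (i + j)
  br_skew : ∀ {i j : ZMod 2} {x y : g}, x ∈ gr i → y ∈ gr j → br x y = -(superSign i j • br y x)
  jacobi : ∀ {i j : ZMod 2} {x y : g} (z : g), x ∈ gr i → y ∈ gr j →
    br x (br y z) = br (br x y) z + superSign i j • br y (br x z)
  br_odd_self : ∀ {x : g}, x ∈ gr 1 → br x (br x x) = 0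
  pmap : gr 0 → gr 0
  pmap_smul : ∀ (a : k) (x : gr 0), pmap (a • x) = a ^ p • pmap x
  pmap_ad : ∀ (x : gr 0) (y : g), br (pmap x : g) y = (br (x : g) ^ p) y
  pmap_add : ∀ x y : gr 0, (pmap (x + y) : g) = (pmap x : g) + (pmap y : g) +
    ∑ i ∈ Finset.range (p - 1), ((i + 1 : ℕ) : k)⁻¹ • jacobsonCoeff br (x : g) (y : g) (p - 1) i

namespace RestrictedLieSuperalgebra

variable {k : Type u} {p : ℕ} {g : Type v} [Field k] [AddCommGroup g] [Module k g]

section Subalgebra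

/-- A restricted (`ℤ/2`-graded) subalgebra. -/
structure RestrictedSubalgebra (G : RestrictedLieSuperalgebra k p g) where
  carrier : Submodule k g
  graded : carrier ≤ (carrier ⊓ G.gr 0) ⊔ (carrier ⊓ G.gr 1)
  br_mem : ∀ {x y : g}, x ∈ carrier → y ∈ carrier → G.br x y ∈ carrier
  pmap_mem : ∀ x : G.gr 0, (x : g) ∈ carrier → (G.pmap x : g) ∈ carrier

/-- `g` as a restricted subalgebra of itself. -/
def RestrictedSubalgebra.whole (G : RestrictedLieSuperalgebra k p g) : RestrictedSubalgebra G where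
  carrier := ⊤
  graded := by simpa using G.isCompl.sup_eq_top.ge
  br_mem _ _ := trivial
  pmap_mem _ _ := trivial

variable {G : RestrictedLieSuperalgebra k p g}

/-- The bracket of a restricted subalgebra. -/
def RestrictedSubalgebra.br (S : RestrictedSubalgebra G) :
    S.carrier →ₗ[k] S.carrier →ₗ[k] S.carrier :=
  LinearMap.mk₂ k (fun x y => ⟨G.br x y, S.br_mem x.2 y.2⟩)
    (fun _ _ _ => Subtype.ext (by simp)) (fun _ _ _ => Subtype.ext (by simp))
    (fun _ _ _ => Subtype.ext (by simp)) (fun _ _ _ => Subtype.ext (by simp))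

theorem RestrictedSubalgebra.coe_br (S : RestrictedSubalgebra G) (x y : S.carrier) :
    (S.br x y : g) = G.br x y := rfl

theorem RestrictedSubalgebra.coe_br_pow (S : RestrictedSubalgebra G) (x y : S.carrier) (n : ℕ) :
    (((S.br x) ^ n) y : g) = ((G.br (x : g)) ^ n) (y : g) := by
  induction n with
  | zero => rfl
  | succ n ih => rw [pow_succ', pow_succ', Module.End.mul_apply, Module.End.mul_apply,
      coe_br, ih]

theorem RestrictedSubalgebra.coe_jacobsonCoeff (S : RestrictedSubalgebra G) (x y : S.carrier)
    (m j : ℕ) : ((jacobsonCoeff S.br x y m j : S.carrier) : g) = jacobsonCoeff G.br (x : g) (y : g) m j := by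
  induction m generalizing j with
  | zero => cases j <;> rfl
  | succ m ih =>
    cases j with
    | zero => simp only [jacobsonCoeff, coe_br, ih]
    | succ j => simp only [jacobsonCoeff, Submodule.coe_add, coe_br, ih]

/-- A restricted subalgebra is a restricted Lie superalgebra. -/
def RestrictedSubalgebra.toRestricted (S : RestrictedSubalgebra G) :
    RestrictedLieSuperalgebra k p S.carrier where
  two_ne_zero := G.two_ne_zero
  gr i := (G.gr i).comap S.carrier.subtype
  isCompl := by
    constructor
    · rw [Submodule.disjoint_def]
      intro x h0 h1
      exact Subtype.ext (Submodule.disjoint_def.1 G.isCompl.disjoint x h0 h1)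
    · rw [codisjoint_iff, eq_top_iff]
      rintro ⟨x, hx⟩ -
      obtain ⟨y, hy, z, hz, rfl⟩ := Submodule.mem_sup.1 (S.graded hx)
      exact Submodule.mem_sup.2 ⟨⟨y, hy.1⟩, hy.2, ⟨z, hz.1⟩, hz.2, rfl⟩
  br := S.br
  br_mem hx hy := G.br_mem hx hy
  br_skew hx hy := Subtype.ext (by simpa [coe_br] using G.br_skew hx hy)
  jacobi z hx hy := Subtype.ext (by simpa [coe_br] using G.jacobi (z : g) hx hy)
  br_odd_self hx := Subtype.ext (by simpa [coe_br] using G.br_odd_self hx)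
  pmap x := ⟨⟨G.pmap ⟨x.1, x.2⟩, S.pmap_mem ⟨x.1, x.2⟩ x.1.2⟩, (G.pmap ⟨x.1, x.2⟩).2⟩
  pmap_smul a x := Subtype.ext (Subtype.ext (by
    have := congrArg Subtype.val (G.pmap_smul a ⟨x.1, x.2⟩)
    exact this))
  pmap_ad x y := Subtype.ext (by
    rw [coe_br_pow]; exact G.pmap_ad ⟨x.1, x.2⟩ (y : g))
  pmap_add x y := Subtype.ext (by
    have := G.pmap_add ⟨x.1, x.2⟩ ⟨y.1, y.2⟩
    simp only [Submodule.coe_add, Submodule.coe_sum, Submodule.coe_smul, coe_jacobsonCoeff]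
    exact this)

end Subalgebra

section Enveloping

/-- The defining relations of the restricted enveloping superalgebra: `x y - (-1)^{|x||y|} y x =
[x, y]` for homogeneous `x, y`, and `x ^ p = x^{[p]}` for even `x`. -/
inductive EnvRel (G : RestrictedLieSuperalgebra k p g) :
    TensorAlgebra k g → TensorAlgebra k g → Prop
  | br {i j : ZMod 2} {x y : g} (hx : x ∈ G.gr i) (hy : y ∈ G.gr j) :
      EnvRel G (TensorAlgebra.ι k x * TensorAlgebra.ι k y)
        (superSign i j • (TensorAlgebra.ι k y * TensorAlgebra.ι k x) +
          TensorAlgebra.ι k (G.br x y))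
  | pow (x : G.gr 0) : EnvRel G (TensorAlgebra.ι k (x : g) ^ p) (TensorAlgebra.ι k (G.pmap x : g))

/-- The restricted enveloping superalgebra `u(g)`. -/
def Env (G : RestrictedLieSuperalgebra k p g) : Type (max u v) := RingQuot (EnvRel G)

noncomputable instance (G : RestrictedLieSuperalgebra k p g) : Ring G.Env :=
  inferInstanceAs (Ring (RingQuot (EnvRel G)))

noncomputable instance (G : RestrictedLieSuperalgebra k p g) : Algebra k G.Env :=
  inferInstanceAs (Algebra k (RingQuot (EnvRel G)))

/-- The quotient map from the tensor algebra onto `u(g)`. -/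
noncomputable def envMk (G : RestrictedLieSuperalgebra k p g) : TensorAlgebra k g →ₐ[k] G.Env :=
  RingQuot.mkAlgHom k (EnvRel G)

/-- The canonical map `g → u(g)`. -/
noncomputable def ι (G : RestrictedLieSuperalgebra k p g) : g →ₗ[k] G.Env :=
  G.envMk.toLinearMap ∘ₗ TensorAlgebra.ι k

theorem ι_br (G : RestrictedLieSuperalgebra k p g) {i j : ZMod 2} {x y : g}
    (hx : x ∈ G.gr i) (hy : y ∈ G.gr j) :
    G.ι x * G.ι y = superSign i j • (G.ι y * G.ι x) + G.ι (G.br x y) := by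
  have h : G.envMk _ = G.envMk _ := RingQuot.mkAlgHom_rel k (EnvRel.br hx hy)
  rw [map_mul, map_add, map_zsmul, map_mul] at h
  exact h

theorem ι_pow (G : RestrictedLieSuperalgebra k p g) (x : G.gr 0) :
    G.ι (x : g) ^ p = G.ι (G.pmap x : g) := by
  have h : G.envMk _ = G.envMk _ := RingQuot.mkAlgHom_rel k (EnvRel.pow x)
  rw [map_pow] at h
  exact h

/-- A linear map `f : g → A` that respects the defining relations of `u(g)`. -/
structure EnvCompat (G : RestrictedLieSuperalgebra k p g) {A : Type*} [Ring A] [Algebra k A]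
    (f : g →ₗ[k] A) : Prop where
  br : ∀ {i j : ZMod 2} {x y : g}, x ∈ G.gr i → y ∈ G.gr j →
    f x * f y = superSign i j • (f y * f x) + f (G.br x y)
  pow : ∀ x : G.gr 0, f (x : g) ^ p = f (G.pmap x : g)

/-- The universal property of `u(g)`. -/
noncomputable def envLift (G : RestrictedLieSuperalgebra k p g) {A : Type*} [Ring A] [Algebra k A]
    (f : g →ₗ[k] A) (hf : G.EnvCompat f) : G.Env →ₐ[k] A :=
  RingQuot.liftAlgHom k ⟨TensorAlgebra.lift k f, by
    intro a b h
    induction h with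
    | br hx hy => simpa using hf.br hx hy
    | pow x => simpa using hf.pow x⟩

theorem envLift_ι (G : RestrictedLieSuperalgebra k p g) {A : Type*} [Ring A] [Algebra k A]
    (f : g →ₗ[k] A) (hf : G.EnvCompat f) (x : g) : G.envLift f hf (G.ι x) = f x := by
  unfold envLift ι envMk
  simp only [LinearMap.comp_apply]
  erw [RingQuot.liftAlgHom_mkAlgHom_apply]
  simp

theorem env_hom_ext (G : RestrictedLieSuperalgebra k p g) {A : Type*} [Ring A] [Algebra k A]
    {f f' : G.Env →ₐ[k] A} (h : ∀ x, f (G.ι x) = f' (G.ι x)) : f = f' := by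
  refine RingQuot.ringQuot_ext' (S := k) (s := EnvRel G) f f' ?_
  ext x
  exact h x

/-- The parity operator `x ↦ (-1)^{|x|} x` of `g`. -/
noncomputable def parity (G : RestrictedLieSuperalgebra k p g) : g →ₗ[k] g :=
  LinearMap.ofIsCompl G.isCompl (G.gr 0).subtype (-(G.gr 1).subtype)

theorem parity_even (G : RestrictedLieSuperalgebra k p g) {x : g} (hx : x ∈ G.gr 0) :
    G.parity x = x :=
  LinearMap.ofIsCompl_apply_left G.isCompl ⟨x, hx⟩

theorem parity_odd (G : RestrictedLieSuperalgebra k p g) {x : g} (hx : x ∈ G.gr 1) :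
    G.parity x = -x :=
  LinearMap.ofIsCompl_apply_right G.isCompl ⟨x, hx⟩

theorem parity_of_mem (G : RestrictedLieSuperalgebra k p g) {i : ZMod 2} {x : g}
    (hx : x ∈ G.gr i) : G.parity x = (-1 : k) ^ i.val • x := by
  obtain rfl | rfl : i = 0 ∨ i = 1 := by clear hx; revert i; decide
  · simpa using G.parity_even hx
  · simpa [ZMod.val_one] using G.parity_odd hx

theorem neg_one_pow_val_add (i j : ZMod 2) :
    (-1 : k) ^ (i + j).val = (-1) ^ i.val * (-1) ^ j.val := by
  have h2 : (1 + 1 : ZMod 2) = 0 := by decide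
  obtain rfl | rfl : i = 0 ∨ i = 1 := by revert i; decide
  all_goals obtain rfl | rfl : j = 0 ∨ j = 1 := by revert j; decide
  all_goals simp [ZMod.val_one, h2]

theorem parity_compat (G : RestrictedLieSuperalgebra k p g) :
    G.EnvCompat (G.ι ∘ₗ G.parity) where
  br {i j x y} hx hy := by
    simp only [LinearMap.comp_apply, G.parity_of_mem hx, G.parity_of_mem hy,
      G.parity_of_mem (G.br_mem hx hy), map_smul, smul_mul_smul_comm, G.ι_br hx hy, neg_one_pow_val_add,
      smul_add, mul_comm ((-1 : k) ^ j.val)]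
    rw [smul_comm]
  pow x := by
    simp only [LinearMap.comp_apply, G.parity_even x.2, G.parity_even (G.pmap x).2, G.ι_pow]

/-- The parity automorphism `a ↦ (-1)^{|a|} a` of `u(g)`. -/
noncomputable def envParity (G : RestrictedLieSuperalgebra k p g) : G.Env →ₐ[k] G.Env :=
  G.envLift _ G.parity_compat

theorem envParity_ι (G : RestrictedLieSuperalgebra k p g) (x : g) :
    G.envParity (G.ι x) = G.ι (G.parity x) :=
  G.envLift_ι _ G.parity_compat x

theorem parity_parity (G : RestrictedLieSuperalgebra k p g) (x : g) :
    G.parity (G.parity x) = x := by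
  obtain ⟨y, hy, z, hz, rfl⟩ :=
    Submodule.mem_sup.1 (G.isCompl.sup_eq_top.ge (Submodule.mem_top (x := x)))
  simp [G.parity_even hy, G.parity_odd hz]

theorem envParity_envParity (G : RestrictedLieSuperalgebra k p g) (a : G.Env) :
    G.envParity (G.envParity a) = a := by
  have : G.envParity.comp G.envParity = AlgHom.id k _ :=
    G.env_hom_ext fun x => by simp [envParity_ι, parity_parity]
  exact DFunLike.congr_fun this a

/-- The `ℤ/2`-grading of `u(g)`, as eigenspaces of the parity automorphism. -/
noncomputable def envGr (G : RestrictedLieSuperalgebra k p g) (i : ZMod 2) : Submodule k G.Env :=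
  LinearMap.ker (G.envParity.toLinearMap - (-1 : k) ^ i.val • LinearMap.id)

theorem mem_envGr (G : RestrictedLieSuperalgebra k p g) {i : ZMod 2} {a : G.Env} :
    a ∈ G.envGr i ↔ G.envParity a = (-1 : k) ^ i.val • a := by
  simp [envGr, sub_eq_zero]

/-- The canonical map `u(s) → u(g)` for a restricted subalgebra `s` of `g`. -/
noncomputable def RestrictedSubalgebra.envMap {G : RestrictedLieSuperalgebra k p g}
    (S : RestrictedSubalgebra G) : S.toRestricted.Env →ₐ[k] G.Env :=
  S.toRestricted.envLift (G.ι ∘ₗ S.carrier.subtype)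
    { br := fun hx hy => G.ι_br hx hy
      pow := fun x => G.ι_pow ⟨x.1, x.2⟩ }

theorem RestrictedSubalgebra.envMap_ι {G : RestrictedLieSuperalgebra k p g}
    (S : RestrictedSubalgebra G) (x : S.carrier) :
    S.envMap (S.toRestricted.ι x) = G.ι (x : g) :=
  S.toRestricted.envLift_ι _ _ x

theorem RestrictedSubalgebra.coe_parity {G : RestrictedLieSuperalgebra k p g}
    (S : RestrictedSubalgebra G) (x : S.carrier) :
    (S.toRestricted.parity x : g) = G.parity (x : g) := by
  obtain ⟨y, hy, z, hz, rfl⟩ := Submodule.mem_sup.1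
    (S.toRestricted.isCompl.sup_eq_top.ge (Submodule.mem_top (x := x)))
  have hy' : G.parity (y : g) = y := G.parity_even hy
  have hz' : G.parity (z : g) = -z := G.parity_odd hz
  rw [map_add, S.toRestricted.parity_even hy, S.toRestricted.parity_odd hz, Submodule.coe_add,
    Submodule.coe_add, map_add, hy', hz', Submodule.coe_neg]

theorem RestrictedSubalgebra.envMap_parity {G : RestrictedLieSuperalgebra k p g}
    (S : RestrictedSubalgebra G) (a : S.toRestricted.Env) :
    S.envMap (S.toRestricted.envParity a) = G.envParity (S.envMap a) := by
  have : S.envMap.comp S.toRestricted.envParity = G.envParity.comp S.envMap :=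
    S.toRestricted.env_hom_ext fun x => by
      simp [envParity_ι, RestrictedSubalgebra.envMap_ι, RestrictedSubalgebra.coe_parity]
  exact DFunLike.congr_fun this a

end Enveloping

section Triangular

/-- A torus: an abelian restricted subalgebra `h` of the even part all of whose elements `x` are
semisimple, that is, `x` lies in the span of the `x^{[p]^i}`, `i ≥ 1`. -/
structure IsTorus (G : RestrictedLieSuperalgebra k p g) (h : Submodule k g) : Prop where
  le : h ≤ G.gr 0
  abelian : ∀ {x y : g}, x ∈ h → y ∈ h → G.br x y = 0
  pmap_mem : ∀ x : G.gr 0, (x : g) ∈ h → (G.pmap x : g) ∈ h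
  semisimple : ∀ x : G.gr 0, (x : g) ∈ h →
    (x : g) ∈ Submodule.span k {y : g | ∃ i : ℕ, 1 ≤ i ∧ y = (G.pmap^[i] x : G.gr 0)}

/-- `h` is a maximal torus of the even part of the restricted subalgebra `L`. -/
structure IsMaximalTorus (G : RestrictedLieSuperalgebra k p g) (L : RestrictedSubalgebra G)
    (h : Submodule k g) : Prop where
  isTorus : G.IsTorus h
  le : h ≤ L.carrier
  maximal : ∀ T : Submodule k g, G.IsTorus T → T ≤ L.carrier → h ≤ T → T = h

/-- All even elements of the subspace `J` are `p`-nilpotent. -/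
def IsPNilpotent (G : RestrictedLieSuperalgebra k p g) (J : Submodule k g) : Prop :=
  ∀ x : G.gr 0, (x : g) ∈ J → ∃ r : ℕ, G.pmap^[r] x = 0

/-- One half `(n^±, g_1^±)` of a triangular decomposition relative to a torus `h`: `n` is an even
`p`-nilpotent restricted subalgebra, `o` is an odd subspace, and `n ⊕ o` is an ideal of the
restricted subalgebra `b = o ⊕ n ⊕ h`. -/
structure Half (G : RestrictedLieSuperalgebra k p g) (h : Submodule k g) where
  isTorus : G.IsTorus h
  n : Submodule k g
  o : Submodule k g
  n_le : n ≤ G.gr 0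
  o_le : o ≤ G.gr 1
  disjoint : Disjoint n h
  br_nn : ∀ {x y : g}, x ∈ n → y ∈ n → G.br x y ∈ n
  br_no : ∀ {x y : g}, x ∈ n → y ∈ o → G.br x y ∈ o
  br_oo : ∀ {x y : g}, x ∈ o → y ∈ o → G.br x y ∈ n
  br_hn : ∀ {x y : g}, x ∈ h → y ∈ n → G.br x y ∈ n
  br_ho : ∀ {x y : g}, x ∈ h → y ∈ o → G.br x y ∈ o
  pmap_n : ∀ x : G.gr 0, (x : g) ∈ n → (G.pmap x : g) ∈ n
  pNilpotent : G.IsPNilpotent n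

variable {G : RestrictedLieSuperalgebra k p g} {h : Submodule k g}

theorem br_anti (G : RestrictedLieSuperalgebra k p g) {j : ZMod 2} {x y : g} (hx : x ∈ G.gr 0)
    (hy : y ∈ G.gr j) : G.br y x = -G.br x y := by
  simpa [superSign] using G.br_skew hy hx

/-- For `x ∈ n` and `y ∈ h`, all the coefficients of `(ad (T x + y))^m (x)` lie in `n`. -/
theorem Half.jacobsonCoeff_mem (B : Half G h) {x y : g} (hx : x ∈ B.n) (hy : y ∈ h) (m j : ℕ) :
    jacobsonCoeff G.br x y m j ∈ B.n := by
  induction m generalizing j with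
  | zero => cases j with
    | zero => exact hx
    | succ j => exact B.n.zero_mem
  | succ m ih => cases j with
    | zero => exact B.br_hn hy (ih 0)
    | succ j => exact B.n.add_mem (B.br_nn hx (ih j)) (B.br_hn hy (ih (j + 1)))

/-- Bracketing two elements of `o + n + h` gives an element of `n + o`. -/
theorem Half.br_mem_ideal (B : Half G h) {x y : g} (hx : x ∈ B.o ⊔ B.n ⊔ h)
    (hy : y ∈ B.o ⊔ B.n ⊔ h) : G.br x y ∈ B.n ⊔ B.o := by
  obtain ⟨x', hx', c, hc, rfl⟩ := Submodule.mem_sup.1 hx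
  obtain ⟨a, ha, b, hb, rfl⟩ := Submodule.mem_sup.1 hx'
  obtain ⟨y', hy', c', hc', rfl⟩ := Submodule.mem_sup.1 hy
  obtain ⟨a', ha', b', hb', rfl⟩ := Submodule.mem_sup.1 hy'
  have hn : ∀ {z}, z ∈ B.n → z ∈ B.n ⊔ B.o := fun hz => Submodule.mem_sup_left hz
  have ho : ∀ {z}, z ∈ B.o → z ∈ B.n ⊔ B.o := fun hz => Submodule.mem_sup_right hz
  have e1 : G.br a b' ∈ B.n ⊔ B.o := by
    rw [G.br_anti (B.n_le hb') (B.o_le ha)]; exact neg_mem (ho (B.br_no hb' ha))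
  have e2 : G.br a c' ∈ B.n ⊔ B.o := by
    rw [G.br_anti (B.isTorus.le hc') (B.o_le ha)]; exact neg_mem (ho (B.br_ho hc' ha))
  have e3 : G.br b c' ∈ B.n ⊔ B.o := by
    rw [G.br_anti (B.isTorus.le hc') (B.n_le hb)]; exact neg_mem (hn (B.br_hn hc' hb))
  have e4 : G.br c c' ∈ B.n ⊔ B.o := by
    rw [B.isTorus.abelian hc hc']; exact zero_mem _
  simp only [map_add, LinearMap.add_apply]
  have f1 := hn (B.br_oo ha ha')
  have f2 := ho (B.br_no hb ha')
  have f3 := ho (B.br_ho hc ha')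
  have f4 := hn (B.br_nn hb hb')
  have f5 := hn (B.br_hn hc hb')
  exact add_mem (add_mem (add_mem (add_mem f1 f2) f3) (add_mem (add_mem e1 f4) f5))
    (add_mem (add_mem e2 e3) e4)

/-- An even element of `o + n + h` lies in `n + h`. -/
theorem Half.even_mem (B : Half G h) {x : g} (hx : x ∈ B.o ⊔ B.n ⊔ h) (h0 : x ∈ G.gr 0) :
    ∃ y ∈ B.n, ∃ z ∈ h, y + z = x := by
  obtain ⟨x', hx', c, hc, rfl⟩ := Submodule.mem_sup.1 hx
  obtain ⟨a, ha, b, hb, rfl⟩ := Submodule.mem_sup.1 hx'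
  have hbc : b + c ∈ G.gr 0 := add_mem (B.n_le hb) (B.isTorus.le hc)
  have ha0 : a ∈ G.gr 0 := by
    have := sub_mem h0 hbc
    rwa [show a + b + c - (b + c) = a by abel] at this
  have : a = 0 := Submodule.disjoint_def.1 G.isCompl.disjoint a ha0 (B.o_le ha)
  exact ⟨b, hb, c, hc, by rw [this, zero_add]⟩

/-- An odd element of `o + n + h` lies in `o`. -/
theorem Half.odd_mem (B : Half G h) {x : g} (hx : x ∈ B.o ⊔ B.n ⊔ h) (h1 : x ∈ G.gr 1) :
    x ∈ B.o := by
  obtain ⟨x', hx', c, hc, rfl⟩ := Submodule.mem_sup.1 hx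
  obtain ⟨a, ha, b, hb, rfl⟩ := Submodule.mem_sup.1 hx'
  have hbc : b + c ∈ G.gr 0 := add_mem (B.n_le hb) (B.isTorus.le hc)
  have hbc1 : b + c ∈ G.gr 1 := by
    have := sub_mem h1 (B.o_le ha)
    rwa [show a + b + c - a = b + c by abel] at this
  have : b + c = 0 := Submodule.disjoint_def.1 G.isCompl.disjoint _ hbc hbc1
  rw [add_assoc, this, add_zero]
  exact ha

/-- `(y + z)^{[p]} - z^{[p]}` lies in `n` for `y ∈ n` and `z ∈ h`. -/
theorem Half.pmap_add_mem (B : Half G h) (y z : G.gr 0) (hy : (y : g) ∈ B.n) (hz : (z : g) ∈ h) :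
    (G.pmap (y + z) : g) - (G.pmap z : g) ∈ B.n := by
  rw [G.pmap_add]
  rw [show ∀ a b c : g, a + b + c - b = a + c by intros; abel]
  exact add_mem (B.pmap_n y hy)
    (Submodule.sum_mem _ fun i _ => B.n.smul_mem _ (B.jacobsonCoeff_mem hy hz _ _))

/-- The restricted subalgebra `b = o ⊕ n ⊕ h`. -/
def Half.borel (B : Half G h) : RestrictedSubalgebra G where
  carrier := B.o ⊔ B.n ⊔ h
  graded := by
    refine sup_le (sup_le ?_ ?_) ?_
    · exact le_sup_of_le_right (le_inf (le_sup_of_le_left le_sup_left) B.o_le)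
    · exact le_sup_of_le_left (le_inf (le_sup_of_le_left le_sup_right) B.n_le)
    · exact le_sup_of_le_left (le_inf le_sup_right B.isTorus.le)
  br_mem hx hy :=
    (sup_le (le_sup_of_le_left le_sup_right) (le_sup_of_le_left le_sup_left) :
      B.n ⊔ B.o ≤ B.o ⊔ B.n ⊔ h) (B.br_mem_ideal hx hy)
  pmap_mem x hx := by
    obtain ⟨y, hy, z, hz, hyz⟩ := B.even_mem hx x.2
    have hx' : x = ⟨y, B.n_le hy⟩ + ⟨z, B.isTorus.le hz⟩ := Subtype.ext hyz.symm
    have h1 := B.pmap_add_mem ⟨y, B.n_le hy⟩ ⟨z, B.isTorus.le hz⟩ hy hz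
    rw [← hx'] at h1
    have h2 := B.isTorus.pmap_mem ⟨z, B.isTorus.le hz⟩ hz
    rw [← sub_add_cancel (G.pmap x : g) (G.pmap ⟨z, B.isTorus.le hz⟩ : g)]
    exact add_mem (Submodule.mem_sup_left (Submodule.mem_sup_right h1))
      (Submodule.mem_sup_right h2)

/-- The set `Λ` of restricted weights: the linear functionals `wt` on `h` with
`wt (x^{[p]}) = (wt x)^p`. -/
def IsRestrictedWeight (G : RestrictedLieSuperalgebra k p g) (h : Submodule k g)
    (wt : Module.Dual k h) : Prop :=
  ∀ (x : G.gr 0) (hx : (x : g) ∈ h) (hx' : (G.pmap x : g) ∈ h),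
    wt ⟨G.pmap x, hx'⟩ = wt ⟨x, hx⟩ ^ p

/-- The set `Λ` of restricted weights, as a type. -/
abbrev Weight (G : RestrictedLieSuperalgebra k p g) (h : Submodule k g) : Type (max u v) :=
  {wt : Module.Dual k h // G.IsRestrictedWeight h wt}

open Polynomial in
/-- A torus has only finitely many restricted weights. -/
theorem IsTorus.finite_weight [FiniteDimensional k g] [Fact p.Prime] (hT : G.IsTorus h) :
    Finite (G.Weight h) := by
  have hp : 2 ≤ p := (Fact.out : p.Prime).two_le
  have iter : ∀ (x : G.gr 0) (hx : (x : g) ∈ h) (i : ℕ),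
      ∃ hi : ((G.pmap^[i] x : G.gr 0) : g) ∈ h, ∀ wt : G.Weight h,
        wt.1 ⟨_, hi⟩ = wt.1 ⟨x, hx⟩ ^ p ^ i := by
    intro x hx i
    induction i with
    | zero => exact ⟨hx, fun wt => by simp⟩
    | succ i ih =>
      obtain ⟨hi, hw⟩ := ih
      rw [Function.iterate_succ_apply']
      refine ⟨hT.pmap_mem _ hi, fun wt => ?_⟩
      rw [wt.2 _ hi _, hw, pow_succ, pow_mul]
  have root : ∀ x : h, ∃ q : k[X], q ≠ 0 ∧ ∀ wt : G.Weight h, q.eval (wt.1 x) = 0 := by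
    rintro ⟨x, hx⟩
    let x' : G.gr 0 := ⟨x, hT.le hx⟩
    have key : ∀ y ∈ Submodule.span k {y : g | ∃ i : ℕ, 1 ≤ i ∧ y = (G.pmap^[i] x' : G.gr 0)},
        ∃ hy : y ∈ h, ∃ q : k[X], q.coeff 1 = 0 ∧
          ∀ wt : G.Weight h, wt.1 ⟨y, hy⟩ = q.eval (wt.1 ⟨x, hx⟩) := by
      intro y hy
      induction hy using Submodule.span_induction with
      | mem y hy =>
        obtain ⟨i, hi, rfl⟩ := hy
        obtain ⟨hm, hw⟩ := iter x' hx i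
        refine ⟨hm, X ^ p ^ i, ?_, fun wt => by rw [hw]; simp [x']⟩
        rw [coeff_X_pow, if_neg]
        exact (Nat.one_lt_pow (by omega) hp).ne
      | zero => exact ⟨h.zero_mem, 0, by simp, fun wt => by
          rw [eval_zero]; exact map_zero wt.1⟩
      | add y z _ _ hy hz =>
        obtain ⟨hy, q, hq, e⟩ := hy
        obtain ⟨hz, q', hq', e'⟩ := hz
        refine ⟨h.add_mem hy hz, q + q', by simp [hq, hq'], fun wt => ?_⟩
        rw [eval_add, ← e, ← e', ← map_add]; rfl
      | smul a y _ hy =>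
        obtain ⟨hy, q, hq, e⟩ := hy
        refine ⟨h.smul_mem a hy, C a * q, by simp [hq], fun wt => ?_⟩
        rw [eval_mul, eval_C, ← e, ← smul_eq_mul, ← map_smul]; rfl
    obtain ⟨_, q, hq, e⟩ := key x (hT.semisimple x' hx)
    refine ⟨q - X, fun h0 => ?_, fun wt => by rw [eval_sub, eval_X, ← e, sub_self]⟩
    have := congrArg (fun r : k[X] => r.coeff 1) h0
    simp [hq] at this
  choose q hq hroot using root
  let b := Module.finBasis k h
  have hfin : (Set.univ.pi fun i => {a : k | (q (b i)).IsRoot a}).Finite :=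
    Set.Finite.pi fun i => Polynomial.finite_setOfPred_isRoot (hq (b i))
  have := hfin.to_subtype
  refine Finite.of_injective
    (fun wt : G.Weight h => (⟨fun i => wt.1 (b i), fun i _ => hroot (b i) wt⟩ :
      ↥(Set.univ.pi fun i => {a : k | (q (b i)).IsRoot a}))) ?_
  intro w w' e
  exact Subtype.ext (b.ext fun i => congrFun (congrArg Subtype.val e) i)

theorem Half.disjoint_ideal (B : Half G h) : Disjoint (B.n ⊔ B.o) h := by
  rw [Submodule.disjoint_def]
  intro x hx hxh
  obtain ⟨a, ha, b, hb, rfl⟩ := Submodule.mem_sup.1 hx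
  have hb0 : b ∈ G.gr 0 := by
    have := sub_mem (B.isTorus.le hxh) (B.n_le ha)
    rwa [add_sub_cancel_left] at this
  have : b = 0 := Submodule.disjoint_def.1 G.isCompl.disjoint b hb0 (B.o_le hb)
  subst this
  rw [add_zero] at hxh ⊢
  exact Submodule.disjoint_def.1 B.disjoint a ha hxh

theorem Half.isCompl_ideal (B : Half G h) :
    IsCompl ((B.n ⊔ B.o).comap B.borel.carrier.subtype) (h.comap B.borel.carrier.subtype) := by
  constructor
  · rw [Submodule.disjoint_def]
    intro x h0 h1
    exact Subtype.ext (Submodule.disjoint_def.1 B.disjoint_ideal x h0 h1)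
  · rw [codisjoint_iff, eq_top_iff]
    rintro ⟨x, hx⟩ -
    obtain ⟨y, hy, z, hz, rfl⟩ := Submodule.mem_sup.1 hx
    rw [sup_comm] at hy
    refine Submodule.mem_sup.2 ⟨⟨y, ?_⟩, hy, ⟨z, Submodule.mem_sup_right hz⟩, hz, rfl⟩
    rw [sup_comm] at hy
    exact Submodule.mem_sup_left hy

/-- The linear functional on `b` that is `wt` on `h` and zero on `n ⊕ o`. -/
noncomputable def Half.charFun (B : Half G h) (wt : Module.Dual k h) : B.borel.carrier →ₗ[k] k :=
  LinearMap.ofIsCompl B.isCompl_ideal 0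
    (wt ∘ₗ (B.borel.carrier.subtype ∘ₗ
      (h.comap B.borel.carrier.subtype).subtype).codRestrict h fun x => x.2)

theorem Half.charFun_ideal (B : Half G h) (wt : Module.Dual k h) (x : B.borel.carrier)
    (hx : (x : g) ∈ B.n ⊔ B.o) : B.charFun wt x = 0 :=
  LinearMap.ofIsCompl_apply_left B.isCompl_ideal ⟨x, hx⟩

theorem Half.charFun_torus (B : Half G h) (wt : Module.Dual k h) (x : B.borel.carrier)
    (hx : (x : g) ∈ h) : B.charFun wt x = wt ⟨x, hx⟩ :=
  LinearMap.ofIsCompl_apply_right B.isCompl_ideal ⟨x, hx⟩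

theorem Half.charFun_compat (B : Half G h) (wt : G.Weight h) :
    B.borel.toRestricted.EnvCompat (B.charFun wt.1) where
  br {i j x y} hx hy := by
    have h0 : B.charFun wt.1 (B.borel.toRestricted.br x y) = 0 :=
      B.charFun_ideal _ _ (B.br_mem_ideal x.2 y.2)
    rw [h0, add_zero]
    by_cases hij : i = 1 ∧ j = 1
    · obtain ⟨rfl, rfl⟩ := hij
      have hxo : B.charFun wt.1 x = 0 :=
        B.charFun_ideal _ _ (Submodule.mem_sup_right (B.odd_mem x.2 hx))
      simp [hxo]
    · simp [superSign, hij, mul_comm]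
  pow x := by
    obtain ⟨y, hy, z, hz, hyz⟩ := B.even_mem x.1.2 x.2
    have hyb : y ∈ B.borel.carrier := Submodule.mem_sup_left (Submodule.mem_sup_right hy)
    have hzb : z ∈ B.borel.carrier := Submodule.mem_sup_right hz
    let z' : G.gr 0 := ⟨z, B.isTorus.le hz⟩
    have hpz : (G.pmap z' : g) ∈ h := B.isTorus.pmap_mem z' hz
    have hx1 : (x : B.borel.carrier) = ⟨y, hyb⟩ + ⟨z, hzb⟩ := Subtype.ext hyz.symm
    have hx2 : (⟨x.1, x.2⟩ : G.gr 0) = ⟨y, B.n_le hy⟩ + z' := Subtype.ext hyz.symm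
    have h1 := B.pmap_add_mem ⟨y, B.n_le hy⟩ z' hy hz
    rw [← hx2] at h1
    obtain ⟨w, hw, hwx⟩ : ∃ w ∈ B.n, w + (G.pmap z' : g) =
        ((B.borel.toRestricted.pmap x : B.borel.carrier) : g) :=
      ⟨_, h1, sub_add_cancel _ _⟩
    have hwb : w ∈ B.borel.carrier := Submodule.mem_sup_left (Submodule.mem_sup_right hw)
    have hpb : (G.pmap z' : g) ∈ B.borel.carrier := Submodule.mem_sup_right hpz
    have h2 : (B.borel.toRestricted.pmap x : B.borel.carrier) = ⟨w, hwb⟩ + ⟨_, hpb⟩ :=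
      Subtype.ext hwx.symm
    have e1 : B.charFun wt.1 (x : B.borel.carrier) = wt.1 ⟨z, hz⟩ := by
      rw [hx1, map_add, B.charFun_ideal _ ⟨y, hyb⟩ (Submodule.mem_sup_left hy), zero_add,
        B.charFun_torus _ _ hz]
    have e2 : B.charFun wt.1 (B.borel.toRestricted.pmap x : B.borel.carrier) =
        wt.1 ⟨_, hpz⟩ := by
      rw [h2, map_add, B.charFun_ideal _ ⟨w, hwb⟩ (Submodule.mem_sup_left hw), zero_add,
        B.charFun_torus _ _ hpz]
    rw [e1, e2]
    exact (wt.2 z' hz hpz).symm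

/-- The action of `u(b)` on the one-dimensional module `k_wt`: `h` acts through `wt` and `n ⊕ o`
acts by zero. -/
noncomputable def Half.char (B : Half G h) (wt : G.Weight h) : B.borel.toRestricted.Env →ₐ[k] k :=
  B.borel.toRestricted.envLift (B.charFun wt.1) (B.charFun_compat wt)

theorem Half.char_ι (B : Half G h) (wt : G.Weight h) (x : B.borel.carrier) :
    B.char wt (B.borel.toRestricted.ι x) = B.charFun wt.1 x :=
  B.borel.toRestricted.envLift_ι _ _ x

theorem Half.char_parity (B : Half G h) (wt : G.Weight h) (b : B.borel.toRestricted.Env) :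
    B.char wt (B.borel.toRestricted.envParity b) = B.char wt b := by
  have : (B.char wt).comp B.borel.toRestricted.envParity = B.char wt := by
    refine B.borel.toRestricted.env_hom_ext fun x => ?_
    obtain ⟨y, hy, z, hz, rfl⟩ := Submodule.mem_sup.1
      (B.borel.toRestricted.isCompl.sup_eq_top.ge (Submodule.mem_top (x := x)))
    have hz0 : B.charFun wt.1 z = 0 :=
      B.charFun_ideal _ _ (Submodule.mem_sup_right (B.odd_mem z.2 hz))
    simp [envParity_ι, parity_even _ hy, parity_odd _ hz, Half.char_ι, hz0]
  exact DFunLike.congr_fun this b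

end Triangular

section BabyVerma

variable {G : RestrictedLieSuperalgebra k p g} {h : Submodule k g}

/-- The relations `a b ⊗ c = a ⊗ b c` (`a ∈ u(g)`, `b ∈ u(b)`, `c ∈ k_wt`) that define the tensor
product over `u(b)` as a quotient of the tensor product over `k`. -/
noncomputable def Half.vermaRel (B : Half G h) (wt : G.Weight h) :
    Submodule G.Env (G.Env ⊗[k] k) :=
  Submodule.span G.Env {t | ∃ (a : G.Env) (b : B.borel.toRestricted.Env) (c : k),
    t = (a * B.borel.envMap b) ⊗ₜ[k] c - a ⊗ₜ[k] (B.char wt b * c)}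

/-- The underlying space of the baby Verma module `u(g) ⊗_{u(b)} k_wt`. -/
abbrev Half.Verma (B : Half G h) (wt : G.Weight h) : Type (max u v) :=
  (G.Env ⊗[k] k) ⧸ B.vermaRel wt

/-- The grading of the baby Verma module: the parity of `a ⊗ c` is that of `a`. -/
noncomputable def Half.vermaGr (B : Half G h) (wt : G.Weight h) (i : ZMod 2) :
    Submodule k (B.Verma wt) :=
  Submodule.span k {m | ∃ a ∈ G.envGr i, ∃ c : k, m = (B.vermaRel wt).mkQ (a ⊗ₜ[k] c)}

/-- The parity operator on `u(g) ⊗_k k_wt`. -/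
noncomputable def tensorParity (G : RestrictedLieSuperalgebra k p g) :
    (G.Env ⊗[k] k) →ₗ[k] (G.Env ⊗[k] k) :=
  TensorProduct.map G.envParity.toLinearMap LinearMap.id

theorem tensorParity_smul (G : RestrictedLieSuperalgebra k p g) (a : G.Env) (t : G.Env ⊗[k] k) :
    G.tensorParity (a • t) = G.envParity a • G.tensorParity t := by
  induction t with
  | zero => simp
  | add x y hx hy => simp only [smul_add, map_add, hx, hy]
  | tmul x y => simp [tensorParity, TensorProduct.smul_tmul']

theorem Half.tensorParity_mem (B : Half G h) (wt : G.Weight h) {t : G.Env ⊗[k] k}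
    (ht : t ∈ B.vermaRel wt) : G.tensorParity t ∈ B.vermaRel wt := by
  induction ht using Submodule.span_induction with
  | mem t ht =>
    obtain ⟨a, b, c, rfl⟩ := ht
    refine Submodule.subset_span ⟨G.envParity a, B.borel.toRestricted.envParity b, c, ?_⟩
    simp [tensorParity, RestrictedSubalgebra.envMap_parity, Half.char_parity]
  | zero => simp
  | add x y _ _ hx hy => rw [map_add]; exact add_mem hx hy
  | smul a x _ hx => rw [tensorParity_smul]; exact Submodule.smul_mem _ _ hx

/-- The parity operator on the baby Verma module. -/
noncomputable def Half.vermaParity (B : Half G h) (wt : G.Weight h) :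
    B.Verma wt →ₗ[k] B.Verma wt :=
  Submodule.liftQ ((B.vermaRel wt).restrictScalars k)
    (((B.vermaRel wt).mkQ.restrictScalars k) ∘ₗ G.tensorParity) (by
      intro t ht
      simpa using B.tensorParity_mem wt ht)

theorem Half.vermaParity_mk (B : Half G h) (wt : G.Weight h) (t : G.Env ⊗[k] k) :
    B.vermaParity wt ((B.vermaRel wt).mkQ t) = (B.vermaRel wt).mkQ (G.tensorParity t) := rfl

theorem Half.vermaParity_of_mem (B : Half G h) (wt : G.Weight h) {i : ZMod 2} {m : B.Verma wt}
    (hm : m ∈ B.vermaGr wt i) : B.vermaParity wt m = (-1 : k) ^ i.val • m := by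
  induction hm using Submodule.span_induction with
  | mem m hm =>
    obtain ⟨a, ha, c, rfl⟩ := hm
    rw [vermaParity_mk, tensorParity, TensorProduct.map_tmul, AlgHom.toLinearMap_apply,
      G.mem_envGr.1 ha, ← TensorProduct.smul_tmul']
    rfl
  | zero => simp
  | add x y _ _ hx hy => rw [map_add, hx, hy, smul_add]
  | smul a x _ hx => rw [map_smul, hx, smul_comm]

theorem Half.verma_isCompl (B : Half G h) (wt : G.Weight h) :
    IsCompl (B.vermaGr wt 0) (B.vermaGr wt 1) := by
  have h2 := G.two_ne_zero
  constructor
  · rw [Submodule.disjoint_def]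
    intro m h0 h1
    have e0 := B.vermaParity_of_mem wt h0
    have e1 := B.vermaParity_of_mem wt h1
    rw [e0] at e1
    simp only [ZMod.val_zero, pow_zero, one_smul, ZMod.val_one, pow_one, neg_smul] at e1
    have : (2 : k) • m = 0 := by rw [two_smul]; nth_rewrite 1 [e1]; simp
    exact (smul_eq_zero.1 this).resolve_left h2
  · rw [codisjoint_iff, eq_top_iff]
    rintro m -
    obtain ⟨t, rfl⟩ := (B.vermaRel wt).mkQ_surjective m
    induction t with
    | zero => simp
    | add x y hx hy => rw [map_add]; exact add_mem hx hy
    | tmul a c =>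
      have ha : a = (2 : k)⁻¹ • (a + G.envParity a) + (2 : k)⁻¹ • (a - G.envParity a) := by
        rw [← smul_add, show a + G.envParity a + (a - G.envParity a) = (2 : k) • a by
          rw [two_smul]; abel, smul_smul, inv_mul_cancel₀ h2, one_smul]
      have h0 : (2 : k)⁻¹ • (a + G.envParity a) ∈ G.envGr 0 := by
        refine Submodule.smul_mem _ _ (G.mem_envGr.2 ?_)
        simp [envParity_envParity, add_comm]
      have h1 : (2 : k)⁻¹ • (a - G.envParity a) ∈ G.envGr 1 := by
        refine Submodule.smul_mem _ _ (G.mem_envGr.2 ?_)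
        simp [envParity_envParity, ZMod.val_one]
      rw [ha, TensorProduct.add_tmul, map_add]
      exact add_mem (Submodule.mem_sup_left (Submodule.subset_span ⟨_, h0, c, rfl⟩))
        (Submodule.mem_sup_right (Submodule.subset_span ⟨_, h1, c, rfl⟩))

theorem ι_mul_mem (G : RestrictedLieSuperalgebra k p g) {i j : ZMod 2} {x : g} {a : G.Env}
    (hx : x ∈ G.gr i) (ha : a ∈ G.envGr j) : G.ι x * a ∈ G.envGr (i + j) := by
  rw [mem_envGr, map_mul, envParity_ι, G.parity_of_mem hx, G.mem_envGr.1 ha, map_smul,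
    smul_mul_smul_comm, neg_one_pow_val_add]

theorem Half.verma_smul_mem (B : Half G h) (wt : G.Weight h) {i j : ZMod 2} {x : g}
    {m : B.Verma wt} (hx : x ∈ G.gr i) (hm : m ∈ B.vermaGr wt j) :
    G.ι x • m ∈ B.vermaGr wt (i + j) := by
  induction hm using Submodule.span_induction with
  | mem m hm =>
    obtain ⟨a, ha, c, rfl⟩ := hm
    exact Submodule.subset_span ⟨_, G.ι_mul_mem hx ha, c, rfl⟩
  | zero => simp
  | add x y _ _ hx hy => rw [smul_add]; exact add_mem hx hy
  | smul a x _ hx => rw [smul_comm]; exact Submodule.smul_mem _ _ hx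

theorem Half.verma_finite (B : Half G h) (wt : G.Weight h) : Module.Finite G.Env (B.Verma wt) := by
  refine ⟨⟨{(B.vermaRel wt).mkQ ((1 : G.Env) ⊗ₜ[k] (1 : k))}, ?_⟩⟩
  rw [eq_top_iff]
  rintro m -
  obtain ⟨t, rfl⟩ := (B.vermaRel wt).mkQ_surjective m
  induction t with
  | zero => simp
  | add x y hx hy => rw [map_add]; exact add_mem hx hy
  | tmul a c =>
    have : a ⊗ₜ[k] c = (c • a) • ((1 : G.Env) ⊗ₜ[k] (1 : k)) := by
      rw [TensorProduct.smul_tmul', smul_eq_mul, mul_one, TensorProduct.smul_tmul, smul_eq_mul,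
        mul_one]
    rw [this, map_smul]
    exact Submodule.smul_mem _ _ (Submodule.subset_span (by simp))

end BabyVerma

section Grothendieck

/-- A finitely generated `u(g)`-supermodule: a `u(g)`-module with a `ℤ/2`-grading compatible with
that of `g` (which generates `u(g)`). When `g` is finite-dimensional, so is `u(g)`, and then these
are the finite-dimensional restricted `g`-supermodules. -/
structure SuperMod (G : RestrictedLieSuperalgebra k p g) where
  carrier : Type (max u v)
  [addCommGroup : AddCommGroup carrier]
  [moduleBase : Module k carrier]
  [module : Module G.Env carrier]
  [isScalarTower : IsScalarTower k G.Env carrier]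
  gr : ZMod 2 → Submodule k carrier
  isCompl : IsCompl (gr 0) (gr 1)
  smul_mem : ∀ {i j : ZMod 2} {x : g} {m : carrier}, x ∈ G.gr i → m ∈ gr j →
    G.ι x • m ∈ gr (i + j)
  finite : Module.Finite G.Env carrier

attribute [instance] SuperMod.addCommGroup SuperMod.moduleBase SuperMod.module
  SuperMod.isScalarTower

/-- A `u(g)`-linear map that is homogeneous of parity `d`. (For `d = 1`, composing with
`m ↦ (-1)^{|m|} m` turns such a map into an odd homomorphism in the sign convention
`f (x m) = (-1)^{|x|} x f(m)`, and conversely.) -/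
def IsHomogeneousMap {G : RestrictedLieSuperalgebra k p g} {M N : G.SuperMod} (d : ZMod 2)
    (f : M.carrier →ₗ[G.Env] N.carrier) : Prop :=
  ∀ (i : ZMod 2) (m : M.carrier), m ∈ M.gr i → f m ∈ N.gr (i + d)

/-- The relations `[M] = [M'] + [M'']`, one for each short exact sequence
`0 → M' → M → M'' → 0` of supermodules and homogeneous (even or odd) homomorphisms. In
particular `[M] = [N]` if `M` and `N` are isomorphic up to a change of parity. -/
def grothendieckRel (G : RestrictedLieSuperalgebra k p g) :
    AddSubgroup (FreeAbelianGroup G.SuperMod) :=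
  AddSubgroup.closure {r | ∃ (M' M M'' : G.SuperMod) (d e : ZMod 2)
    (f : M'.carrier →ₗ[G.Env] M.carrier) (q : M.carrier →ₗ[G.Env] M''.carrier),
    IsHomogeneousMap d f ∧ IsHomogeneousMap e q ∧ Function.Injective f ∧ Function.Exact f q ∧
    Function.Surjective q ∧
    r = FreeAbelianGroup.of M - (FreeAbelianGroup.of M' + FreeAbelianGroup.of M'')}

/-- The Grothendieck group of the category of `u(g)`-supermodules. -/
abbrev GrothendieckGroup (G : RestrictedLieSuperalgebra k p g) : Type (max u v + 1) :=
  FreeAbelianGroup G.SuperMod ⧸ G.grothendieckRel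

/-- The class `[M]` in the Grothendieck group. -/
def SuperMod.cls {G : RestrictedLieSuperalgebra k p g} (M : G.SuperMod) : G.GrothendieckGroup :=
  QuotientAddGroup.mk (FreeAbelianGroup.of M)

/-- The baby Verma module `u(g) ⊗_{u(b)} k_wt`, as a `u(g)`-supermodule. -/
noncomputable def Half.verma {G : RestrictedLieSuperalgebra k p g} {h : Submodule k g}
    (B : Half G h) (wt : G.Weight h) : G.SuperMod where
  carrier := B.Verma wt
  gr := B.vermaGr wt
  isCompl := B.verma_isCompl wt
  smul_mem := B.verma_smul_mem wt
  finite := B.verma_finite wt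

end Grothendieck

section Hypotheses

/-- A triangular decomposition `L = L_1^- ⊕ n^- ⊕ h ⊕ n^+ ⊕ L_1^+` of the restricted subalgebra `L`
of `g` relative to the maximal torus `h` of the even part of `L`. As `n^-`, `h`, `n^+` are even and
`L_1^-`, `L_1^+` are odd, the even part of `L` is `n^- ⊕ h ⊕ n^+`. -/
structure TriangularDecomposition (G : RestrictedLieSuperalgebra k p g)
    (L : RestrictedSubalgebra G) (h : Submodule k g) where
  isMaximalTorus : G.IsMaximalTorus L h
  neg : Half G h
  pos : Half G h
  indep : iSupIndep ![neg.o, neg.n, h, pos.n, pos.o]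
  sup_eq : neg.o ⊔ neg.n ⊔ h ⊔ pos.n ⊔ pos.o = L.carrier

variable {G : RestrictedLieSuperalgebra k p g} {L : RestrictedSubalgebra G} {h : Submodule k g}

/-- The decomposition is long. -/
def TriangularDecomposition.IsLong (D : TriangularDecomposition G L h) : Prop :=
  Module.finrank k D.neg.n < Module.finrank k D.pos.n ∧
    Module.finrank k D.neg.o < Module.finrank k D.pos.o

/-- The subspace `L_1^- ⊕ n^- ⊕ n^+ ⊕ L_1^+`. -/
def TriangularDecomposition.nil (D : TriangularDecomposition G L h) : Submodule k g :=
  D.neg.o ⊔ D.neg.n ⊔ D.pos.n ⊔ D.pos.o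

/-- `L_1^- ⊕ n^- ⊕ n^+ ⊕ L_1^+` is a `p`-nilpotent ideal of `L`. -/
structure TriangularDecomposition.HasNilIdeal (D : TriangularDecomposition G L h) : Prop where
  br_mem : ∀ {x y : g}, x ∈ L.carrier → y ∈ D.nil → G.br x y ∈ D.nil
  pNilpotent : G.IsPNilpotent D.nil

/-- `W` contains `dim h` linearly independent weight vectors for `h` whose weights are linearly
independent restricted weights. -/
def HasIndependentWeights (G : RestrictedLieSuperalgebra k p g) (h W : Submodule k g) : Prop :=
  ∃ (v : Fin (Module.finrank k h) → g) (wt : Fin (Module.finrank k h) → Module.Dual k h),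
    (∀ i, v i ∈ W) ∧ LinearIndependent k v ∧
    (∀ i, G.IsRestrictedWeight h (wt i)) ∧ LinearIndependent k wt ∧
    ∀ i (x : h), G.br (x : g) (v i) = wt i x • v i

end Hypotheses

end RestrictedLieSuperalgebra

/-!
The identity is a comparison of filtrations, made exact by counting dimensions, followed by a
division in the Grothendieck group.

*Division is allowed.* Multiplicities of simple supermodules are additive, so the Grothendieck group
is free on the classes of the simple supermodules (`SuperMod.free_grothendieckGroup`).

*Filtrations.* Let `N = n ⊕ o` be a graded `p`-nilpotent subalgebra normalized by `h`, and let the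
induced module of weight `μ` be `u(g)` modulo the left ideal generated by `N` and the `x - μ x`,
`x ∈ h`. For `N = n^± ⊕ g_1^±` these are the baby Verma modules (`Half.exists_bijective_verma`).
Suppose that a supermodule `M` is generated by a graded subspace that is stable under `N` and
spanned by weight vectors of weights `ν_j`. By Engel's theorem, extended to odd elements, and
semisimplicity of `h`, this subspace contains a homogeneous weight vector killed by `N`. It
generates a quotient of an induced module, and it replaces one of the given vectors. So `M` has a
filtration whose factors are quotients of the modules induced from the `ν_j`
(`NilSubalgebra.finrank_le_and_cls_eq`). Hence `dim M` is at most the sum of the dimensions of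
these induced modules, and if the dimensions agree, so do the classes.

*Dimensions.* The Poincaré-Birkhoff-Witt theorem bounds `dim u(g)` from below by
`p^{dim g_0} 2^{dim g_1}` (`le_finrank_env`), and straightening bounds the induced modules from
above (`NilSubalgebra.finrank_induced_le`). The lower bound is proved by the diamond lemma: the
overlaps of the straightening rules resolve by the super Jacobi identity, the axioms of the
`p`-mapping and Jacobson's formula for `(x + y)^p`.

*The three filtrations.* The components of `1 ∈ u(g)` of the various weights generate `u(g)`, which
gives `[u(g)] = p^{dim n^±} 2^{dim g_1^±} ∑_μ [V^±(μ)]` for both signs, and the exact dimensions of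
the `V^±(μ)`. Next, `V^-(λ)` is generated by the monomials in weight vectors of `n_L^+` and `L_1^+`
applied to its highest weight vector, since `b_L^- = b_g^-` acts on that vector by scalars. As the
`dim h` independent weights in `n_L^+` generate the group of restricted weights over `𝔽_p`, the
weights of these monomials are equidistributed. Hence `[V^-(λ)]` is a multiple of the sum over all
`μ` of the classes of the modules induced from the `p`-nilpotent ideal of `L`, and does not depend
on `λ`. As there are `p^{dim h}` restricted weights, the two expressions for `[u(g)]` give
`p^{dim n^- + dim h} 2^{dim g_1^-} [V^-(λ)] = p^{dim n^+} 2^{dim g_1^+} ∑_μ [V^+(μ)]`,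
and it remains to divide.
-/

/-! ### Jacobson's formula for `p`-th powers -/

section Jacobson

variable {k : Type u} [Field k] {p : ℕ} [Fact p.Prime]

/-- The commutator `(a, b) ↦ a b - b a` as a bilinear map. -/
def commutatorBilin (k : Type u) (A : Type*) [Field k] [Ring A] [Algebra k A] :
    A →ₗ[k] A →ₗ[k] A :=
  LinearMap.mul k A - (LinearMap.mul k A).flip

theorem commutatorBilin_apply {A : Type*} [Ring A] [Algebra k A] (a b : A) :
    commutatorBilin k A a b = a * b - b * a := rfl

theorem cast_choose_prime_sub_one {R : Type*} [Ring R] [CharP R p] {i : ℕ} (hi : i < p) :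
    ((p - 1).choose i : R) = (-1) ^ i := by
  have hp : p.Prime := Fact.out
  induction i with
  | zero => simp
  | succ i ih =>
    have h1 : p.choose (i + 1) = (p - 1).choose i + (p - 1).choose (i + 1) := by
      conv_lhs => rw [← Nat.sub_add_cancel hp.one_le]
      exact Nat.choose_succ_succ _ _
    have h2 : ((p.choose (i + 1) : ℕ) : R) = 0 :=
      (CharP.cast_eq_zero_iff R p _).2 (hp.dvd_choose_self (Nat.succ_ne_zero i) hi)
    rw [h1, Nat.cast_add, ih (by omega)] at h2
    rw [pow_succ, mul_neg_one]
    exact (neg_eq_of_add_eq_zero_right h2).symm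

theorem neg_one_pow_prime_sub_one {R : Type*} [Ring R] [CharP R p] :
    (-1 : R) ^ (p - 1) = 1 := by
  have hp : p.Prime := Fact.out
  have := cast_choose_prime_sub_one (R := R) (p := p) (i := p - 1) (by have := hp.pos; omega)
  simpa using this.symm

/-- In characteristic `p`, `(a - b)^{p-1} = ∑ a^i b^{p-1-i}` for commuting `a` and `b`. -/
theorem Commute.sub_pow_prime_sub_one {R : Type*} [Ring R] [CharP R p] {a b : R}
    (h : Commute a b) :
    (a - b) ^ (p - 1) = ∑ i ∈ Finset.range p, a ^ i * b ^ (p - 1 - i) := by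
  have hp : p.Prime := Fact.out
  rw [sub_eq_add_neg, (h.neg_right).add_pow, Nat.sub_add_cancel hp.one_le]
  refine Finset.sum_congr rfl fun i hi => ?_
  rw [Finset.mem_range] at hi
  rw [cast_choose_prime_sub_one hi, neg_pow b, mul_assoc, mul_assoc,
    (((Commute.neg_one_left b).pow_left i).pow_right (p - 1 - i)).symm.eq,
    ← mul_assoc ((-1) ^ (p - 1 - i)), ← pow_add, Nat.sub_add_cancel (by omega),
    neg_one_pow_prime_sub_one, one_mul]

/-- In characteristic `p`, `(ad a)^{p-1} c = ∑ a^i c a^{p-1-i}`. -/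
theorem sum_pow_mul_mul_pow {A : Type*} [Ring A] [Algebra k A] [CharP k p] (a c : A) :
    ((commutatorBilin k A a) ^ (p - 1)) c =
      ∑ i ∈ Finset.range p, a ^ i * c * a ^ (p - 1 - i) := by
  nontriviality A
  have : Nontrivial (Module.End k A) := inferInstance
  have : CharP (Module.End k A) p := charP_of_injective_algebraMap
    (FaithfulSMul.algebraMap_injective k (Module.End k A)) p
  have h : commutatorBilin k A a = LinearMap.mulLeft k a - LinearMap.mulRight k a := by
    ext; simp [commutatorBilin_apply]
  rw [h, (LinearMap.commute_mulLeft_right a a).sub_pow_prime_sub_one]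
  simp [LinearMap.sum_apply, LinearMap.pow_mulLeft, LinearMap.pow_mulRight, mul_assoc]

open Polynomial in
theorem derivative_linear_pow {A : Type*} [Ring A] (x y : A) (n : ℕ) :
    derivative ((C x * X + C y) ^ n) =
      ∑ i ∈ Finset.range n, (C x * X + C y) ^ i * C x * (C x * X + C y) ^ (n - 1 - i) := by
  induction n with
  | zero => simp
  | succ n ih =>
    rw [pow_succ, derivative_mul, ih, Finset.sum_range_succ, Finset.sum_mul]
    simp only [derivative_add, derivative_mul, derivative_C, derivative_X, zero_mul, mul_one,
      zero_add, add_zero, Nat.add_sub_cancel, Nat.sub_self, pow_zero]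
    refine congrArg (· + _) (Finset.sum_congr rfl fun i hi => ?_)
    rw [Finset.mem_range] at hi
    rw [mul_assoc _ _ (C x * X + C y), ← pow_succ]
    congr 2
    omega

open Polynomial in
/-- `jacobsonCoeff` does compute the coefficients of `(ad (T x + y))^m (x)`. -/
theorem coeff_commutator_pow {A : Type*} [Ring A] [Algebra k A] (x y : A) (m j : ℕ) :
    (((commutatorBilin k A[X] (C x * X + C y)) ^ m) (C x)).coeff j =
      jacobsonCoeff (commutatorBilin k A) x y m j := by
  induction m generalizing j with
  | zero => cases j <;> simp [jacobsonCoeff]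
  | succ m ih =>
    rw [pow_succ', Module.End.mul_apply]
    set q := ((commutatorBilin k A[X] (C x * X + C y)) ^ m) (C x) with hq
    have e : commutatorBilin k A[X] (C x * X + C y) q =
        (C x * q - q * C x) * X + (C y * q - q * C y) := by
      rw [commutatorBilin_apply, add_mul, mul_add, ← mul_assoc, mul_assoc (C x), X_mul, sub_mul,
        ← mul_assoc]
      abel
    rw [e]
    cases j with
    | zero => simp [jacobsonCoeff, commutatorBilin_apply, ih]
    | succ j => simp [jacobsonCoeff, commutatorBilin_apply, ih, coeff_mul_X]

open Polynomial in
/-- Jacobson's formula in an associative algebra: both sides are found by evaluating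
`(T x + y)^p` at `T = 1`, whose coefficients are known from its derivative
`(ad (T x + y))^{p-1} (x)`. -/
theorem add_pow_prime_eq_jacobson {A : Type*} [Ring A] [Algebra k A] [CharP k p] (x y : A) :
    (x + y) ^ p = x ^ p + y ^ p + ∑ i ∈ Finset.range (p - 1),
      ((i + 1 : ℕ) : k)⁻¹ • jacobsonCoeff (commutatorBilin k A) x y (p - 1) i := by
  have hp : p.Prime := Fact.out
  set z : A[X] := C x * X + C y with hz
  let ev : A[X] →+* A := eval₂RingHom' (RingHom.id A) 1 fun a => Commute.one_right a
  have hev : ∀ q : A[X], ev q = q.sum fun _ a => a := by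
    intro q
    change eval₂ _ _ q = _
    simp [eval₂_eq_sum]
  have hdeg : (z ^ p).natDegree < p + 1 := by
    refine Nat.lt_succ_of_le (natDegree_pow_le_of_le p (?_ : z.natDegree ≤ 1) |>.trans (by simp))
    rw [hz]
    compute_degree
  have hcoef : ∀ j, (z ^ p).coeff (j + 1) * ((j + 1 : ℕ) : A) =
      jacobsonCoeff (commutatorBilin k A) x y (p - 1) j := by
    intro j
    rw [← coeff_commutator_pow, sum_pow_mul_mul_pow, ← derivative_linear_pow, coeff_derivative]
    push_cast
    rfl
  have h0 : (z ^ p).coeff 0 = y ^ p := by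
    rw [← constantCoeff_apply, map_pow]; simp [hz]
  have htop : (z ^ p).coeff p = x ^ p := by
    have := coeff_pow_of_natDegree_le (p := z) (n := 1) (m := p) (by rw [hz]; compute_degree)
    rw [mul_one] at this
    rw [this]; simp [hz]
  have h1 : ev (z ^ p) = (x + y) ^ p := by
    rw [map_pow]
    congr 1
    change eval₂ _ _ z = _
    rw [hz, eval₂_add, eval₂_mul_X]
    simp
  rw [← h1, hev, sum_over_range' _ (fun _ => rfl) (p + 1) hdeg, Finset.sum_range_succ, htop]
  obtain ⟨q, rfl⟩ : ∃ q, p = q + 1 := ⟨p - 1, by have := hp.pos; omega⟩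
  rw [Finset.sum_range_succ', h0, Nat.add_sub_cancel]
  rw [add_comm, add_comm (Finset.sum _ _), ← add_assoc]
  refine congrArg _ (Finset.sum_congr rfl fun i hi => ?_)
  rw [Finset.mem_range] at hi
  have hne : ((i + 1 : ℕ) : k) ≠ 0 := by
    intro h
    exact absurd (Nat.le_of_dvd (Nat.succ_pos i) ((CharP.cast_eq_zero_iff k (q + 1) _).1 h))
      (by omega)
  have hc := hcoef i
  rw [Nat.add_sub_cancel] at hc
  rw [← hc, ← nsmul_eq_mul', ← Nat.cast_smul_eq_nsmul k, smul_smul, inv_mul_cancel₀ hne, one_smul]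

end Jacobson

/-! ### Rewriting of words in a free associative algebra -/

namespace Rewriting

variable {k : Type*} [Field k] {ι : Type*}

/-- The free associative algebra on `ι`, with basis the words in `ι`. -/
abbrev FreeAlg (k ι : Type*) [Field k] := MonoidAlgebra k (FreeMonoid ι)

/-- A word, as an element of the free algebra. -/
noncomputable def word (k : Type*) [Field k] (w : List ι) : FreeAlg k ι :=
  MonoidAlgebra.single (FreeMonoid.ofList w) 1

theorem word_append (a b : List ι) : word k (a ++ b) = word k a * word k b := by
  simp [word, MonoidAlgebra.single_mul_single]

theorem word_nil : word k ([] : List ι) = 1 := rfl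

theorem word_replicate (n : ℕ) (i : ι) : word k (List.replicate n i) = word k [i] ^ n := by
  induction n with
  | zero => rfl
  | succ n ih => rw [pow_succ', ← ih, ← word_append]; rfl

/-- The coefficient of a word. -/
noncomputable def coeffAt (w : List ι) : FreeAlg k ι →ₗ[k] k where
  toFun x := x.coeff (FreeMonoid.ofList w)
  map_add' _ _ := rfl
  map_smul' _ _ := rfl

theorem coeffAt_word_self (w : List ι) : coeffAt w (word k w) = 1 := by
  change (MonoidAlgebra.single _ (1 : k)).coeff _ = 1
  rw [MonoidAlgebra.coeff_single, Finsupp.single_eq_same]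

theorem coeffAt_word_of_ne {w v : List ι} (h : v ≠ w) : coeffAt w (word k v) = 0 := by
  change (MonoidAlgebra.single _ (1 : k)).coeff _ = 0
  rw [MonoidAlgebra.coeff_single,
    Finsupp.single_eq_of_ne fun e => h (FreeMonoid.ofList.injective e).symm]

theorem linearIndependent_word : LinearIndependent k (fun w : List ι => word k w) := by
  rw [linearIndependent_iff']
  intro s c hc w hw
  have := congrArg (coeffAt w) hc
  rw [map_sum, map_zero, Finset.sum_eq_single w] at this
  · simpa [coeffAt_word_self] using this
  · intro v _ hv
    rw [map_smul, coeffAt_word_of_ne hv, smul_zero]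
  · exact fun h => absurd hw h

/-- The span of the words with property `P`. -/
noncomputable def wordSpan (k : Type*) [Field k] (P : List ι → Prop) : Submodule k (FreeAlg k ι) :=
  Submodule.span k {z | ∃ w, P w ∧ z = word k w}

theorem word_mem_wordSpan {P : List ι → Prop} {w : List ι} (h : P w) :
    word k w ∈ wordSpan k P := Submodule.subset_span ⟨w, h, rfl⟩

theorem wordSpan_mono {P Q : List ι → Prop} (h : ∀ w, P w → Q w) :
    wordSpan k P ≤ wordSpan k Q :=
  Submodule.span_mono fun _ ⟨w, hw, e⟩ => ⟨w, h w hw, e⟩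

theorem coeffAt_wordSpan {P : List ι → Prop} {w : List ι} (hw : ¬ P w) {x : FreeAlg k ι}
    (hx : x ∈ wordSpan k P) : coeffAt w x = 0 := by
  induction hx using Submodule.span_induction with
  | mem x hx =>
    obtain ⟨v, hv, rfl⟩ := hx
    exact coeffAt_word_of_ne (by rintro rfl; exact hw hv)
  | zero => simp
  | add x y _ _ hx hy => rw [map_add, hx, hy, add_zero]
  | smul c x _ hx => rw [map_smul, hx, smul_zero]

theorem mem_wordSpan_top (x : FreeAlg k ι) : x ∈ wordSpan k (fun _ : List ι => True) := by
  induction x using MonoidAlgebra.induction_linear with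
  | zero => exact zero_mem _
  | add x y hx hy => exact add_mem hx hy
  | single w c =>
    have : MonoidAlgebra.single w c = c • word k (FreeMonoid.toList w) := by
      simp [word]
    rw [this]
    exact Submodule.smul_mem _ _ (word_mem_wordSpan trivial)

theorem word_mul_mem {P Q : List ι → Prop} {a b : List ι} (h : ∀ w, P w → Q (a ++ w ++ b))
    {x : FreeAlg k ι} (hx : x ∈ wordSpan k P) : word k a * x * word k b ∈ wordSpan k Q := by
  induction hx using Submodule.span_induction with
  | mem x hx =>
    obtain ⟨w, hw, rfl⟩ := hx
    rw [← word_append, ← word_append]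
    exact word_mem_wordSpan (h w hw)
  | zero => simp
  | add x y _ _ hx hy => rw [mul_add, add_mul]; exact add_mem hx hy
  | smul c x _ hx =>
    rw [mul_smul_comm, smul_mul_assoc]; exact Submodule.smul_mem _ _ hx

/-- For a set `R` of rewriting rules `u → f`, the span of the elements `a (u - f) b` for which the
word `a u b` has property `P`. -/
noncomputable def multiples (R : List ι → FreeAlg k ι → Prop) (P : List ι → Prop) :
    Submodule k (FreeAlg k ι) :=
  Submodule.span k {z | ∃ a u b f, R u f ∧ P (a ++ u ++ b) ∧
    z = word k a * (word k u - f) * word k b}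

variable {R : List ι → FreeAlg k ι → Prop}

theorem mem_multiples {P : List ι → Prop} {a u b : List ι} {f : FreeAlg k ι} (hR : R u f)
    (hP : P (a ++ u ++ b)) : word k a * (word k u - f) * word k b ∈ multiples R P :=
  Submodule.subset_span ⟨a, u, b, f, hR, hP, rfl⟩

theorem multiples_mono {P Q : List ι → Prop} (h : ∀ w, P w → Q w) :
    multiples R P ≤ multiples R Q :=
  Submodule.span_mono fun _ ⟨a, u, b, f, hR, hw, e⟩ => ⟨a, u, b, f, hR, h _ hw, e⟩

theorem word_mul_multiples {P Q : List ι → Prop} {a b : List ι}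
    (h : ∀ w, P w → Q (a ++ w ++ b)) {x : FreeAlg k ι} (hx : x ∈ multiples R P) :
    word k a * x * word k b ∈ multiples R Q := by
  induction hx using Submodule.span_induction with
  | mem x hx =>
    obtain ⟨c, u, d, f, hR, hP, rfl⟩ := hx
    have := mem_multiples (P := Q) (a := a ++ c) (b := d ++ b) hR
      (by simpa [List.append_assoc] using h _ hP)
    simpa [word_append, mul_assoc] using this
  | zero => simp
  | add x y _ _ hx hy => rw [mul_add, add_mul]; exact add_mem hx hy
  | smul c x _ hx =>
    rw [mul_smul_comm, smul_mul_assoc]; exact Submodule.smul_mem _ _ hx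

theorem lex_append_right {r : ι → ι → Prop} {v w : List ι} (h : List.Lex r v w)
    (hl : v.length = w.length) (b : List ι) : List.Lex r (v ++ b) (w ++ b) := by
  induction h with
  | nil => simp at hl
  | cons _ ih => exact List.Lex.cons (ih (by simpa using hl))
  | rel h => exact List.Lex.rel h

variable [LinearOrder ι]

/-- Words are compared first by length, then lexicographically. -/
abbrev Lt (v w : List ι) : Prop := List.Shortlex (· < ·) v w

theorem Lt.append {v w : List ι} (h : Lt v w) (a b : List ι) :
    Lt (a ++ v ++ b) (a ++ w ++ b) := by
  rw [List.append_assoc, List.append_assoc]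
  refine List.Shortlex.append_left ?_ a
  rcases List.shortlex_def.1 h with h | ⟨hl, h⟩
  · exact List.Shortlex.of_length_lt (by simpa using h)
  · exact List.Shortlex.of_lex (by simpa using hl) (lex_append_right h hl b)

theorem Lt.trans {u v w : List ι} (h : Lt u v) (h' : Lt v w) : Lt u w := by
  rcases List.shortlex_def.1 h with h | ⟨hl, h⟩ <;>
  rcases List.shortlex_def.1 h' with h' | ⟨hl', h'⟩
  · exact List.Shortlex.of_length_lt (h.trans h')
  · exact List.Shortlex.of_length_lt (h.trans_eq hl')
  · exact List.Shortlex.of_length_lt (hl.trans_lt h')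
  · exact List.Shortlex.of_lex (hl.trans hl')
      (List.lt_trans (show u < v from h) (show v < w from h'))

theorem Lt.irrefl (w : List ι) : ¬ Lt w w := fun h => asymm h h

theorem lt_or_eq_or_gt (v w : List ι) : Lt v w ∨ v = w ∨ Lt w v := trichotomous v w

theorem mem_multiples_le {P : List ι → Prop} {x : FreeAlg k ι} (hx : x ∈ multiples R P) :
    x = 0 ∨ ∃ w, P w ∧ x ∈ multiples R (fun v => v = w ∨ Lt v w) := by
  induction hx using Submodule.span_induction with
  | mem x hx =>
    obtain ⟨a, u, b, f, hR, hP, rfl⟩ := hx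
    exact Or.inr ⟨_, hP, mem_multiples hR (Or.inl rfl)⟩
  | zero => exact Or.inl rfl
  | add x y _ _ hx hy =>
    rcases hx with rfl | ⟨w, hw, hx⟩
    · simpa using hy
    rcases hy with rfl | ⟨w', hw', hy⟩
    · rw [add_zero]; exact Or.inr ⟨w, hw, hx⟩
    rcases lt_or_eq_or_gt w w' with h | rfl | h
    · refine Or.inr ⟨w', hw', add_mem (multiples_mono ?_ hx) hy⟩
      rintro v (rfl | hv)
      exacts [Or.inr h, Or.inr (hv.trans h)]
    · exact Or.inr ⟨w, hw, add_mem hx hy⟩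
    · refine Or.inr ⟨w, hw, add_mem hx (multiples_mono ?_ hy)⟩
      rintro v (rfl | hv)
      exacts [Or.inr h, Or.inr (hv.trans h)]
  | smul c x _ hx =>
    rcases hx with rfl | ⟨w, hw, hx⟩
    · exact Or.inl (smul_zero c)
    · exact Or.inr ⟨w, hw, Submodule.smul_mem _ _ hx⟩

/-- A word is reducible if it contains the left-hand side of a rule. -/
def Reducible (R : List ι → FreeAlg k ι → Prop) (w : List ι) : Prop :=
  ∃ a u b f, R u f ∧ w = a ++ u ++ b

theorem coeffAt_eq_zero_of_mem_multiples
    (hlow : ∀ {u f}, R u f → f ∈ wordSpan k (fun v => Lt v u)) {w : List ι} {z : FreeAlg k ι}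
    (hz : z ∈ multiples R (fun v => Lt v w)) : coeffAt w z = 0 := by
  refine coeffAt_wordSpan (P := fun v => Lt v w) (Lt.irrefl w) ?_
  have hle : multiples R (fun v => Lt v w) ≤ wordSpan k (fun v => Lt v w) := by
    unfold multiples
    rw [Submodule.span_le]
    rintro _ ⟨a, u, b, f, hR, hP, rfl⟩
    rw [SetLike.mem_coe, mul_sub, sub_mul, ← word_append, ← word_append]
    refine sub_mem (word_mem_wordSpan hP) (word_mul_mem ?_ (hlow hR))
    exact fun v hv => (hv.append a b).trans hP
  exact hle hz

/-- All consequences of rules at one word `w` agree up to a scalar and smaller words. -/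
theorem mem_multiples_or_exists_sub_mem
    (hres : ∀ {a u b f a' u' b' f'}, R u f → R u' f' → a ++ u ++ b = a' ++ u' ++ b' →
      word k a * (word k u - f) * word k b - word k a' * (word k u' - f') * word k b' ∈
        multiples R (fun v => Lt v (a ++ u ++ b))) {w : List ι} {z : FreeAlg k ι}
    (hz : z ∈ multiples R (fun v => v = w ∨ Lt v w)) :
    z ∈ multiples R (fun v => Lt v w) ∨ ∃ (c : k) (a u b : List ι) (f : FreeAlg k ι), R u f ∧
      a ++ u ++ b = w ∧ z - c • (word k a * (word k u - f) * word k b) ∈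
        multiples R (fun v => Lt v w) := by
  induction hz using Submodule.span_induction with
  | mem z hz =>
    obtain ⟨a, u, b, f, hR, hP | hP, rfl⟩ := hz
    · refine Or.inr ⟨1, a, u, b, f, hR, hP, ?_⟩
      rw [one_smul, sub_self]
      exact zero_mem _
    · exact Or.inl (mem_multiples hR hP)
  | zero => exact Or.inl (zero_mem _)
  | add y z _ _ hy hz =>
    rcases hy with hy | ⟨c, a, u, b, f, hR, hP, hy⟩
    · rcases hz with hz | ⟨c, a, u, b, f, hR, hP, hz⟩
      · exact Or.inl (add_mem hy hz)
      · exact Or.inr ⟨c, a, u, b, f, hR, hP, by rw [add_sub_assoc]; exact add_mem hy hz⟩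
    · rcases hz with hz | ⟨c', a', u', b', f', hR', hP', hz⟩
      · exact Or.inr ⟨c, a, u, b, f, hR, hP, by
          rw [add_sub_right_comm]; exact add_mem hy hz⟩
      · refine Or.inr ⟨c + c', a, u, b, f, hR, hP, ?_⟩
        have h1 := hres hR' hR (hP'.trans hP.symm)
        rw [hP'] at h1
        have h2 := add_mem (add_mem hy hz) (Submodule.smul_mem _ c' h1)
        have e : ∀ X Y : FreeAlg k ι, y + z - (c + c') • X = y - c • X + (z - c' • Y) + c' • (Y - X) := by
          intro X Y
          rw [add_smul, smul_sub]
          abel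
        rw [e]
        exact h2
  | smul c y _ hy =>
    rcases hy with hy | ⟨c', a, u, b, f, hR, hP, hy⟩
    · exact Or.inl (Submodule.smul_mem _ _ hy)
    · exact Or.inr ⟨c * c', a, u, b, f, hR, hP, by
        rw [mul_smul, ← smul_sub]; exact Submodule.smul_mem _ _ hy⟩

/-- The diamond lemma: if every rule decreases words, and any two ways to apply rules to a word `w`
agree modulo the consequences of rules at words smaller than `w`, then irreducible words
are linearly independent modulo the ideal generated by the rules. -/
theorem eq_zero_of_mem_multiples [WellFoundedLT ι]
    (hlow : ∀ {u f}, R u f → f ∈ wordSpan k (fun v => Lt v u))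
    (hres : ∀ {a u b f a' u' b' f'}, R u f → R u' f' → a ++ u ++ b = a' ++ u' ++ b' →
      word k a * (word k u - f) * word k b - word k a' * (word k u' - f') * word k b' ∈
        multiples R (fun v => Lt v (a ++ u ++ b)))
    {P : List ι → Prop} {x : FreeAlg k ι} (hx : x ∈ multiples R P)
    (hn : x ∈ wordSpan k (fun w => ¬ Reducible R w)) : x = 0 := by
  have key : ∀ w, x ∈ multiples R (fun v => v = w ∨ Lt v w) → x = 0 := by
    intro w
    induction w using WellFounded.induction (List.Shortlex.wf
      (wellFounded_lt : WellFounded ((· < ·) : ι → ι → Prop))) with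
    | _ w ih =>
    intro hw
    have hlt : x ∈ multiples R (fun v => Lt v w) := by
      rcases mem_multiples_or_exists_sub_mem hres hw with h | ⟨c, a, u, b, f, hR, hP, h⟩
      · exact h
      · have h1 := coeffAt_eq_zero_of_mem_multiples hlow h
        have h2 : coeffAt w x = 0 :=
          coeffAt_wordSpan (not_not.2 ⟨a, u, b, f, hR, hP.symm⟩) hn
        have h3 : coeffAt w (word k a * (word k u - f) * word k b) = 1 := by
          rw [mul_sub, sub_mul, ← word_append, ← word_append, hP, map_sub, coeffAt_word_self]
          rw [coeffAt_wordSpan (P := fun v => Lt v w) (Lt.irrefl w), sub_zero]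
          refine word_mul_mem ?_ (hlow hR)
          rw [← hP]
          exact fun v hv => hv.append a b
        rw [map_sub, map_smul, h2, h3, smul_eq_mul, mul_one, zero_sub, neg_eq_zero] at h1
        rwa [h1, zero_smul, sub_zero] at h
    rcases mem_multiples_le hlt with h | ⟨w', hw', h⟩
    · exact h
    · exact ih w' hw' h
  rcases mem_multiples_le hx with h | ⟨w, -, h⟩
  · exact h
  · exact key w h

end Rewriting

namespace RestrictedLieSuperalgebra

variable {k : Type u} {p : ℕ} {g : Type v} [Field k] [AddCommGroup g] [Module k g]

/-! ### The rewriting system of a restricted Lie superalgebra -/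

theorem superSign_eq (i j : ZMod 2) : superSign i j = 1 ∨ superSign i j = -1 := by
  unfold superSign; split_ifs <;> simp

theorem superSign_comm (i j : ZMod 2) : superSign i j = superSign j i := by
  unfold superSign; simp [and_comm]

theorem superSign_add_right (i j l : ZMod 2) :
    superSign i (j + l) = superSign i j * superSign i l := by
  revert i j l; decide

theorem superSign_add_left (i j l : ZMod 2) :
    superSign (i + j) l = superSign i l * superSign j l := by
  revert i j l; decide

theorem superSign_zero_left (i : ZMod 2) : superSign 0 i = 1 := by
  revert i; decide

theorem superSign_zero_right (i : ZMod 2) : superSign i 0 = 1 := by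
  revert i; decide

theorem eq_add_one_of_ne {i j : ZMod 2} (h : j ≠ i) : j = i + 1 := by
  revert i j; decide

theorem ne_add_one (i : ZMod 2) : i ≠ i + 1 := by
  revert i; decide

/-- As `2` is invertible in `k`, a vector `m` with `m + m = 0` is zero. -/
theorem eq_zero_of_add_self (G : RestrictedLieSuperalgebra k p g) {M : Type*} [AddCommGroup M]
    [Module k M] {m : M} (h : m + m = 0) : m = 0 := by
  rw [← two_smul k] at h
  exact (smul_eq_zero.1 h).resolve_left G.two_ne_zero

variable (G : RestrictedLieSuperalgebra k p g)

theorem disjoint_gr {i j : ZMod 2} (hij : i ≠ j) : Disjoint (G.gr i) (G.gr j) := by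
  have : (i = 0 ∧ j = 1) ∨ (i = 1 ∧ j = 0) := by revert i j; decide
  rcases this with ⟨rfl, rfl⟩ | ⟨rfl, rfl⟩
  · exact G.isCompl.disjoint
  · exact G.isCompl.disjoint.symm

theorem exists_even_add_odd (x : g) : ∃ y ∈ G.gr 0, ∃ z ∈ G.gr 1, y + z = x :=
  Submodule.mem_sup.1 (G.isCompl.sup_eq_top.ge (Submodule.mem_top (x := x)))

theorem br_even_self {x : g} (hx : x ∈ G.gr 0) : G.br x x = 0 := by
  refine G.eq_zero_of_add_self ?_
  nth_rewrite 1 [G.br_anti hx hx]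
  exact neg_add_cancel _

theorem br_even_left {x : g} (hx : x ∈ G.gr 0) (y : g) : G.br y x = -G.br x y := by
  obtain ⟨a, ha, b, hb, rfl⟩ := G.exists_even_add_odd y
  rw [map_add, LinearMap.add_apply, map_add, G.br_anti hx ha, G.br_anti hx hb]
  abel

/-- A basis of `g` consisting of homogeneous elements. -/
structure HomogeneousBasis (ι : Type*) where
  toBasis : Module.Basis ι k g
  deg : ι → ZMod 2
  mem (i : ι) : toBasis i ∈ G.gr (deg i)

namespace HomogeneousBasis

open Rewriting

variable {G} {ι : Type*} (b : G.HomogeneousBasis ι)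

theorem gr_le_span (i : ZMod 2) :
    G.gr i ≤ Submodule.span k {x | ∃ l, b.deg l = i ∧ x = b.toBasis l} := by
  intro x hx
  have hmem : ∀ y ∈ Submodule.span k (Set.range b.toBasis),
      ∃ y1 ∈ Submodule.span k {x | ∃ l, b.deg l = i ∧ x = b.toBasis l},
        y1 ∈ G.gr i ∧ y - y1 ∈ G.gr (i + 1) := by
    intro y hy
    induction hy using Submodule.span_induction with
    | mem y hy =>
      obtain ⟨l, rfl⟩ := hy
      by_cases hl : b.deg l = i
      · exact ⟨b.toBasis l, Submodule.subset_span ⟨l, hl, rfl⟩, hl ▸ b.mem l, by simp⟩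
      · have : b.deg l = i + 1 := eq_add_one_of_ne hl
        exact ⟨0, zero_mem _, zero_mem _, by rw [sub_zero, ← this]; exact b.mem l⟩
    | zero => exact ⟨0, zero_mem _, zero_mem _, by simp⟩
    | add y z _ _ hy hz =>
      obtain ⟨y1, h1, h2, h3⟩ := hy
      obtain ⟨z1, h4, h5, h6⟩ := hz
      refine ⟨y1 + z1, add_mem h1 h4, add_mem h2 h5, ?_⟩
      rw [add_sub_add_comm]
      exact add_mem h3 h6
    | smul c y _ hy =>
      obtain ⟨y1, h1, h2, h3⟩ := hy
      refine ⟨c • y1, Submodule.smul_mem _ _ h1, Submodule.smul_mem _ _ h2, ?_⟩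
      rw [← smul_sub]
      exact Submodule.smul_mem _ _ h3
  obtain ⟨y, h1, h2, h3⟩ := hmem x (b.toBasis.mem_span x)
  have : x - y = 0 := Submodule.disjoint_def.1
    (G.disjoint_gr (ne_add_one i)) _ (sub_mem hx h2) h3
  rwa [sub_eq_zero.1 this]

/-- The embedding of `g` into the free algebra on a basis. -/
noncomputable def lin : g →ₗ[k] FreeAlg k ι := b.toBasis.constr k fun i => word k [i]

theorem lin_basis (i : ι) : b.lin (b.toBasis i) = word k [i] :=
  b.toBasis.constr_basis k _ i

theorem lin_mem_wordSpan (x : g) : b.lin x ∈ wordSpan k (fun w : List ι => w.length = 1) := by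
  have := b.toBasis.mem_span x
  induction this using Submodule.span_induction with
  | mem x hx => obtain ⟨i, rfl⟩ := hx; rw [lin_basis]; exact word_mem_wordSpan rfl
  | zero => simp
  | add x y _ _ hx hy => rw [map_add]; exact add_mem hx hy
  | smul c x _ hx => rw [map_smul]; exact Submodule.smul_mem _ _ hx

/-- The difference of the two sides of the commutation relation of two letters. -/
noncomputable def comm (i j : ι) : FreeAlg k ι :=
  word k [i] * word k [j] - superSign (b.deg i) (b.deg j) • (word k [j] * word k [i]) -
    b.lin (G.br (b.toBasis i) (b.toBasis j))

theorem comm_swap (i j : ι) : b.comm i j = -(superSign (b.deg i) (b.deg j) • b.comm j i) := by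
  unfold comm
  rw [G.br_skew (b.mem i) (b.mem j), superSign_comm (b.deg j) (b.deg i)]
  rcases superSign_eq (b.deg i) (b.deg j) with h | h <;> rw [h] <;> simp <;> abel

theorem comm_self_even {i : ι} (h : b.deg i = 0) : b.comm i i = 0 := by
  have : b.toBasis i ∈ G.gr 0 := h ▸ b.mem i
  simp [comm, h, superSign_zero_left, G.br_even_self this]

theorem comm_self_odd {i : ι} (h : b.deg i = 1) : b.comm i i =
    (2 : k) • (word k [i, i] - (2 : k)⁻¹ • b.lin (G.br (b.toBasis i) (b.toBasis i))) := by
  have h2 : superSign 1 1 = -1 := by decide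
  rw [comm, h, h2, smul_sub, smul_smul, mul_inv_cancel₀ G.two_ne_zero, one_smul, two_smul,
    neg_one_smul, sub_neg_eq_add, ← word_append]
  rfl

theorem comm_eq_of_lt (i j : ι) : b.comm i j = word k [i, j] -
    (superSign (b.deg i) (b.deg j) • (word k [j] * word k [i]) +
        b.lin (G.br (b.toBasis i) (b.toBasis j))) := by
  rw [comm, ← word_append, sub_sub]
  rfl

variable [LinearOrder ι]

/-- The rewriting rules: sort letters, replace `x x` by `[x, x] / 2` for an odd letter `x`, and
`x ^ p` by `x^{[p]}` for an even letter `x`. -/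
inductive Rule : List ι → FreeAlg k ι → Prop
  | quad {i j : ι} (h : j < i) : Rule [i, j]
      (superSign (b.deg i) (b.deg j) • (word k [j] * word k [i]) +
        b.lin (G.br (b.toBasis i) (b.toBasis j)))
  | sq {i : ι} (h : b.deg i = 1) :
      Rule [i, i] ((2 : k)⁻¹ • b.lin (G.br (b.toBasis i) (b.toBasis i)))
  | pow {i : ι} (h : b.deg i = 0) :
      Rule (List.replicate p i) (b.lin (G.pmap ⟨b.toBasis i, h ▸ b.mem i⟩))

/-- The consequences of the rules in words of length at most `m`. -/
noncomputable abbrev consequences (m : ℕ) : Submodule k (FreeAlg k ι) :=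
  multiples b.Rule (fun w => w.length ≤ m)

theorem comm_mem (i j : ι) (a c : List ι) {P : List ι → Prop} (h1 : P (a ++ [i, j] ++ c))
    (h2 : P (a ++ [j, i] ++ c)) : word k a * b.comm i j * word k c ∈ multiples b.Rule P := by
  rcases lt_trichotomy j i with h | rfl | h
  · rw [comm_eq_of_lt]
    exact mem_multiples (.quad h) h1
  · have : b.deg j = 0 ∨ b.deg j = 1 := by generalize b.deg j = l; revert l; decide
    rcases this with h | h
    · simp [b.comm_self_even h]
    · rw [b.comm_self_odd h, mul_smul_comm, smul_mul_assoc]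
      exact Submodule.smul_mem _ _ (mem_multiples (.sq h) h1)
  · rw [comm_swap, mul_neg, neg_mul, mul_smul_comm, smul_mul_assoc, comm_eq_of_lt]
    exact neg_mem (zsmul_mem (mem_multiples (.quad h) h2) _)

theorem lin_commute_mem {i j : ZMod 2} {x y : g} (hx : x ∈ G.gr i) (hy : y ∈ G.gr j) :
    b.lin x * b.lin y - superSign i j • (b.lin y * b.lin x) - b.lin (G.br x y) ∈
      b.consequences 2 := by
  replace hx := b.gr_le_span i hx
  replace hy := b.gr_le_span j hy
  induction hx using Submodule.span_induction with
  | mem x hx =>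
    obtain ⟨l, rfl, rfl⟩ := hx
    induction hy using Submodule.span_induction with
    | mem y hy =>
      obtain ⟨m, rfl, rfl⟩ := hy
      have := b.comm_mem l m [] [] (P := fun w => w.length ≤ 2) (by simp) (by simp)
      simpa [word_nil, comm, lin_basis] using this
    | zero => simp
    | add y z _ _ hy hz =>
      convert add_mem hy hz using 1
      simp only [map_add, mul_add, add_mul, smul_add]
      abel
    | smul c y _ hy =>
      convert Submodule.smul_mem _ c hy using 1
      simp only [map_smul, mul_smul_comm, smul_mul_assoc, smul_sub]
      rw [smul_comm c]
  | zero => simp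
  | add y z _ _ hy hz =>
    convert add_mem hy hz using 1
    simp only [map_add, mul_add, add_mul, smul_add, LinearMap.add_apply]
    abel
  | smul c y _ hy =>
    convert Submodule.smul_mem _ c hy using 1
    simp only [map_smul, mul_smul_comm, smul_mul_assoc, smul_sub, LinearMap.smul_apply]
    rw [smul_comm c]

theorem lin_mul_mem (x : g) {m : ℕ} {z : FreeAlg k ι} (hz : z ∈ b.consequences m) :
    b.lin x * z ∈ b.consequences (m + 1) := by
  have := b.toBasis.mem_span x
  induction this using Submodule.span_induction with
  | mem x hx =>
    obtain ⟨i, rfl⟩ := hx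
    have := word_mul_multiples (a := [i]) (b := []) (Q := fun w => w.length ≤ m + 1)
      (by intro w hw; simpa using hw) hz
    simpa [word_nil, lin_basis] using this
  | zero => simp
  | add x y _ _ hx hy => rw [map_add, add_mul]; exact add_mem hx hy
  | smul c x _ hx => rw [map_smul, smul_mul_assoc]; exact Submodule.smul_mem _ _ hx

theorem mul_lin_mem (x : g) {m : ℕ} {z : FreeAlg k ι} (hz : z ∈ b.consequences m) :
    z * b.lin x ∈ b.consequences (m + 1) := by
  have := b.toBasis.mem_span x
  induction this using Submodule.span_induction with
  | mem x hx =>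
    obtain ⟨i, rfl⟩ := hx
    have := word_mul_multiples (a := []) (b := [i]) (Q := fun w => w.length ≤ m + 1)
      (by intro w hw; simpa using hw) hz
    simpa [word_nil, lin_basis] using this
  | zero => simp
  | add x y _ _ hx hy => rw [map_add, mul_add]; exact add_mem hx hy
  | smul c x _ hx => rw [map_smul, mul_smul_comm]; exact Submodule.smul_mem _ _ hx

theorem lin_commutator_mem {x : g} (hx : x ∈ G.gr 0) (y : g) :
    commutatorBilin k _ (b.lin x) (b.lin y) - b.lin (G.br x y) ∈ b.consequences 2 := by
  obtain ⟨y0, h0, y1, h1, rfl⟩ := G.exists_even_add_odd y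
  have e0 := b.lin_commute_mem hx h0
  have e1 := b.lin_commute_mem hx h1
  convert add_mem e0 e1 using 1
  simp only [commutatorBilin_apply, superSign_zero_left, one_smul, map_add]
  abel

theorem lin_commutator_pow_mem {x : g} (hx : x ∈ G.gr 0) (y : g) (m : ℕ) :
    ((commutatorBilin k _ (b.lin x)) ^ m) (b.lin y) - b.lin ((G.br x ^ m) y) ∈
      b.consequences (m + 1) := by
  induction m with
  | zero => simp
  | succ m ih =>
    have h1 := sub_mem (b.lin_mul_mem x ih) (b.mul_lin_mem x ih)
    have h2 := b.lin_commutator_mem hx ((G.br x ^ m) y)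
    have h3 : b.consequences 2 ≤ b.consequences (m + 1 + 1) :=
      multiples_mono fun w hw => hw.trans (by omega)
    convert add_mem h1 (h3 h2) using 1
    rw [pow_succ' _ m, pow_succ' _ m, Module.End.mul_apply, Module.End.mul_apply]
    simp only [commutatorBilin_apply]
    noncomm_ring

end HomogeneousBasis
end RestrictedLieSuperalgebra

namespace RestrictedLieSuperalgebra

variable {k : Type u} {p : ℕ} {g : Type v} [Field k] [AddCommGroup g] [Module k g]
  {G : RestrictedLieSuperalgebra k p g}

/-! ### Resolution of the overlaps of the rewriting rules -/

theorem jacobi_expansion {A : Type*} [Ring A] (x y z X Y Z : A) {e₁ e₂ e₃ : ℤ}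
    (h₁ : e₁ = 1 ∨ e₁ = -1) (h₂ : e₂ = 1 ∨ e₂ = -1) (h₃ : e₃ = 1 ∨ e₃ = -1) :
    (x * y - e₁ • (y * x) - Z) * z - x * (y * z - e₃ • (z * y) - X) +
      e₁ • (y * (x * z - e₂ • (z * x) - Y)) - e₃ • ((x * z - e₂ • (z * x) - Y) * y) +
      (e₁ * e₂) • ((y * z - e₃ • (z * y) - X) * x) -
      (e₃ * e₂) • (z * (x * y - e₁ • (y * x) - Z)) =
    (x * X - (e₁ * e₂) • (X * x)) - (Z * z - (e₂ * e₃) • (z * Z)) -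
      e₁ • (y * Y - (e₁ * e₃) • (Y * y)) := by
  rcases h₁ with rfl | rfl <;> rcases h₂ with rfl | rfl <;> rcases h₃ with rfl | rfl <;>
  simp only [mul_one, one_smul, mul_neg, neg_smul, neg_neg] <;> noncomm_ring

theorem sum_range_eq_add_zero {M : Type*} [AddCommMonoid M] (f : ℕ → M) {n : ℕ} (hn : 0 < n) :
    ∑ a ∈ Finset.range n, f a = ∑ a ∈ Finset.range (n - 1), f (a + 1) + f 0 := by
  obtain ⟨m, rfl⟩ : ∃ m, n = m + 1 := ⟨n - 1, by omega⟩
  exact Finset.sum_range_succ' f m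

theorem sum_range_eq_add_last {M : Type*} [AddCommMonoid M] (f : ℕ → M) {n : ℕ} (hn : 0 < n) :
    ∑ a ∈ Finset.range n, f a = ∑ a ∈ Finset.range (n - 1), f a + f (n - 1) := by
  obtain ⟨m, rfl⟩ : ∃ m, n = m + 1 := ⟨n - 1, by omega⟩
  exact Finset.sum_range_succ f m

theorem sum_pow_mul_commutator_mul_pow {A : Type*} [Ring A] (x z : A) (n : ℕ) :
    ∑ a ∈ Finset.range n, z ^ a * (x * z - z * x) * z ^ (n - 1 - a) = x * z ^ n - z ^ n * x := by
  have := Finset.sum_range_sub' (fun a => z ^ a * x * z ^ (n - a)) n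
  simp only [pow_zero, one_mul, Nat.sub_zero, Nat.sub_self, mul_one] at this
  rw [← this]
  refine Finset.sum_congr rfl fun a ha => ?_
  rw [Finset.mem_range] at ha
  have e : n - a = n - 1 - a + 1 := by omega
  have e' : n - (a + 1) = n - 1 - a := by omega
  rw [e, e', pow_succ' z (n - 1 - a), pow_succ]
  noncomm_ring

namespace HomogeneousBasis

open Rewriting

variable {ι : Type*} [LinearOrder ι] (b : G.HomogeneousBasis ι)

theorem consequences_le {m : ℕ} {w : List ι} (h : m < w.length) :
    b.consequences m ≤ multiples b.Rule (fun v => Lt v w) :=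
  multiples_mono fun _ hv => List.Shortlex.of_length_lt (hv.trans_lt h)

theorem rule_decreasing [Fact p.Prime] {u : List ι} {f : FreeAlg k ι} (h : b.Rule u f) :
    f ∈ wordSpan k (fun v => Lt v u) := by
  have hlin : ∀ x (u : List ι), 1 < u.length → b.lin x ∈ wordSpan k (fun v => Lt v u) :=
    fun x u hu => wordSpan_mono (fun v hv => List.Shortlex.of_length_lt (hv.trans_lt hu))
      (b.lin_mem_wordSpan x)
  cases h with
  | quad h =>
    refine add_mem (zsmul_mem ?_ _) (hlin _ _ (by simp))
    rw [← word_append]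
    exact word_mem_wordSpan (List.Shortlex.of_lex rfl (List.Lex.rel h))
  | sq h => exact Submodule.smul_mem _ _ (hlin _ _ (by simp))
  | pow h => exact hlin _ _ (by simpa using (Fact.out : p.Prime).one_lt)

/-- The six ways to commute two letters in `x_i x_j x_l` combine, by the Jacobi identity, to a
consequence of the rules in words of length two. -/
theorem comm_jacobi_mem (i j l : ι) :
    b.comm i j * word k [l] - word k [i] * b.comm j l +
      superSign (b.deg i) (b.deg j) • (word k [j] * b.comm i l) -
      superSign (b.deg j) (b.deg l) • (b.comm i l * word k [j]) +
      (superSign (b.deg i) (b.deg j) * superSign (b.deg i) (b.deg l)) •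
        (b.comm j l * word k [i]) -
      (superSign (b.deg j) (b.deg l) * superSign (b.deg i) (b.deg l)) •
        (word k [l] * b.comm i j) ∈ b.consequences 2 := by
  unfold comm
  rw [jacobi_expansion _ _ _ _ _ _ (superSign_eq _ _) (superSign_eq _ _) (superSign_eq _ _)]
  have h1 := b.lin_commute_mem (b.mem i) (G.br_mem (b.mem j) (b.mem l))
  have h2 := b.lin_commute_mem (G.br_mem (b.mem i) (b.mem j)) (b.mem l)
  have h3 := b.lin_commute_mem (b.mem j) (G.br_mem (b.mem i) (b.mem l))
  have hj : b.lin (G.br (b.toBasis i) (G.br (b.toBasis j) (b.toBasis l))) =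
      b.lin (G.br (G.br (b.toBasis i) (b.toBasis j)) (b.toBasis l)) +
        superSign (b.deg i) (b.deg j) •
          b.lin (G.br (b.toBasis j) (G.br (b.toBasis i) (b.toBasis l))) := by
    rw [G.jacobi _ (b.mem i) (b.mem j), map_add, map_zsmul]
  rw [superSign_add_right] at h1 h3
  rw [superSign_add_left] at h2
  rw [hj] at h1
  rw [superSign_comm (b.deg j) (b.deg i)] at h3
  have := sub_mem (sub_mem h1 h2) (zsmul_mem h3 (superSign (b.deg i) (b.deg j)))
  simp only [lin_basis] at this
  convert this using 1
  simp only [smul_sub]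
  abel

theorem comm_mul_word_mem {i j l : ι} {w : List ι} (h1 : Lt [i, j, l] w) (h2 : Lt [j, i, l] w) :
    b.comm i j * word k [l] ∈ multiples b.Rule (fun v => Lt v w) := by
  simpa [word_nil] using b.comm_mem i j [] [l] (P := fun v => Lt v w) h1 h2

theorem word_mul_comm_mem {i j l : ι} {w : List ι} (h1 : Lt [l, i, j] w) (h2 : Lt [l, j, i] w) :
    word k [l] * b.comm i j ∈ multiples b.Rule (fun v => Lt v w) := by
  simpa [word_nil] using b.comm_mem i j [l] [] (P := fun v => Lt v w) h1 h2

theorem mem_of_add_self_mem (G : RestrictedLieSuperalgebra k p g) {M : Type*} [AddCommGroup M]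
    [Module k M] {N : Submodule k M} {m : M} (h : m + m ∈ N) : m ∈ N := by
  rw [← two_smul k] at h
  exact (N.smul_mem_iff G.two_ne_zero).1 h

/-- A rule for a word of two letters is the commutation relation of these letters, up to a factor
`1 / 2` if they are equal. -/
theorem rule_pair {i j : ι} {f : FreeAlg k ι} (h : b.Rule [i, j] f) (hp : 2 < p) :
    (j < i ∧ word k [i, j] - f = b.comm i j) ∨
    (j = i ∧ b.deg i = 1 ∧ word k [i, j] - f + (word k [i, j] - f) = b.comm i j) := by
  generalize hu : [i, j] = u at h
  cases h with
  | quad h => cases hu; exact Or.inl ⟨h, (b.comm_eq_of_lt _ _).symm⟩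
  | sq h =>
    cases hu
    refine Or.inr ⟨rfl, h, ?_⟩
    rw [b.comm_self_odd h, two_smul]
  | pow h =>
    have := congrArg List.length hu
    simp at this
    omega

theorem overlap_pair_pair (hp : 2 < p) {i j l : ι} {f f' : FreeAlg k ι} (h : b.Rule [i, j] f)
    (h' : b.Rule [j, l] f') :
    (word k [i, j] - f) * word k [l] - word k [i] * (word k [j, l] - f') ∈
      multiples b.Rule (fun v => Lt v [i, j, l]) := by
  have hD : b.consequences 2 ≤ multiples b.Rule (fun v => Lt v [i, j, l]) :=
    b.consequences_le (by simp)
  have lt3 : ∀ {x y : List ι}, x.length = y.length → x < y → Lt x y :=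
    fun hl h => List.Shortlex.of_lex hl h
  have hθ := hD (b.comm_jacobi_mem i j l)
  have h11 : superSign 1 1 = -1 := by decide
  rcases b.rule_pair h hp with ⟨hij, e⟩ | ⟨rfl, hi, e⟩ <;>
  rcases b.rule_pair h' hp with ⟨hjl, e'⟩ | ⟨rfl, hj, e'⟩
  · rw [e, e']
    have h1 := b.word_mul_comm_mem (i := i) (j := l) (l := j) (w := [i, j, l])
      (lt3 rfl (.rel hij)) (lt3 rfl (.rel hij))
    have h2 := b.comm_mul_word_mem (i := i) (j := l) (l := j) (w := [i, j, l])
      (lt3 rfl (.cons (.rel hjl))) (lt3 rfl (.rel (hjl.trans hij)))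
    have h3 := b.comm_mul_word_mem (i := j) (j := l) (l := i) (w := [i, j, l])
      (lt3 rfl (.rel hij)) (lt3 rfl (.rel (hjl.trans hij)))
    have h4 := b.word_mul_comm_mem (i := i) (j := j) (l := l) (w := [i, j, l])
      (lt3 rfl (.rel (hjl.trans hij))) (lt3 rfl (.rel (hjl.trans hij)))
    have := add_mem (sub_mem (add_mem (sub_mem hθ
      (zsmul_mem h1 (superSign (b.deg i) (b.deg j)))) (zsmul_mem h2 (superSign (b.deg j) (b.deg l))))
      (zsmul_mem h3 (superSign (b.deg i) (b.deg j) * superSign (b.deg i) (b.deg l))))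
      (zsmul_mem h4 (superSign (b.deg j) (b.deg l) * superSign (b.deg i) (b.deg l)))
    convert this using 1
    abel
  · refine mem_of_add_self_mem G ?_
    have h1 := b.word_mul_comm_mem (i := i) (j := l) (l := l) (w := [i, l, l])
      (lt3 rfl (.rel hij)) (lt3 rfl (.rel hij))
    have h2 := b.comm_mul_word_mem (i := l) (j := l) (l := i) (w := [i, l, l])
      (lt3 rfl (.rel hij)) (lt3 rfl (.rel hij))
    have hs := superSign_eq (b.deg i) (b.deg l)
    have := sub_mem (sub_mem hθ
      (zsmul_mem (add_mem h1 h1) (superSign (b.deg i) (b.deg l)))) h2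
    convert this using 1
    rw [e, hj, h11, ← e']
    rw [hj] at hs
    rcases hs with hs | hs <;> rw [hs] <;> noncomm_ring
  · refine mem_of_add_self_mem G ?_
    have h1 := b.comm_mul_word_mem (i := j) (j := l) (l := j) (w := [j, j, l])
      (lt3 rfl (.cons (.rel hjl))) (lt3 rfl (.rel hjl))
    have h2 := b.word_mul_comm_mem (i := j) (j := j) (l := l) (w := [j, j, l])
      (lt3 rfl (.rel hjl)) (lt3 rfl (.rel hjl))
    have hs := superSign_eq (b.deg j) (b.deg l)
    have := add_mem (add_mem hθ
      (zsmul_mem (add_mem h1 h1) (superSign (b.deg j) (b.deg l)))) h2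
    convert this using 1
    rw [e', hi, h11, ← e]
    rw [hi] at hs
    rcases hs with hs | hs <;> rw [hs] <;> noncomm_ring
  · refine mem_of_add_self_mem G ?_
    have hx : b.toBasis l ∈ G.gr 1 := hj ▸ b.mem l
    have h1 := b.lin_commute_mem (G.br_mem hx hx) hx
    have h2 : superSign (1 + 1) 1 = 1 := by decide
    have h3 : G.br (G.br (b.toBasis l) (b.toBasis l)) (b.toBasis l) = 0 := by
      have h0 : G.br (b.toBasis l) (b.toBasis l) ∈ G.gr 0 := G.br_mem hx hx
      have := G.br_anti h0 hx
      rw [G.br_odd_self hx] at this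
      exact neg_eq_zero.1 this.symm
    rw [h2, h3, map_zero, sub_zero, one_smul, lin_basis] at h1
    convert neg_mem (hD h1) using 1
    have e2 : (word k [l, l] - f) * word k [l] - word k [l] * (word k [l, l] - f') +
        ((word k [l, l] - f) * word k [l] - word k [l] * (word k [l, l] - f')) =
        b.comm l l * word k [l] - word k [l] * b.comm l l := by
      nth_rewrite 1 [← e]
      rw [← e']
      noncomm_ring
    rw [e2, comm, hj, h11]
    noncomm_ring

theorem commutator_sum_mem [Fact p.Prime] [CharP k p] {i : ι} (hi : b.deg i = 0) (y : g) :
    ∑ a ∈ Finset.range p, word k [i] ^ a * b.lin (G.br (b.toBasis i) y) *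
      word k [i] ^ (p - 1 - a) - (b.lin (G.pmap ⟨b.toBasis i, hi ▸ b.mem i⟩) * b.lin y -
        b.lin y * b.lin (G.pmap ⟨b.toBasis i, hi ▸ b.mem i⟩)) ∈ b.consequences p := by
  have hp : p.Prime := Fact.out
  have hx : b.toBasis i ∈ G.gr 0 := hi ▸ b.mem i
  rw [← b.lin_basis i, ← sum_pow_mul_mul_pow (k := k)]
  have h1 := b.lin_commutator_pow_mem hx (G.br (b.toBasis i) y) (p - 1)
  rw [Nat.sub_add_cancel hp.one_le, ← Module.End.mul_apply, ← pow_succ,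
    Nat.sub_add_cancel hp.one_le, ← G.pmap_ad ⟨b.toBasis i, hx⟩ y] at h1
  have h2 := b.lin_commutator_mem (G.pmap ⟨b.toBasis i, hx⟩).2 y
  have h3 : b.consequences 2 ≤ b.consequences p := multiples_mono fun w hw => hw.trans hp.two_le
  convert sub_mem h1 (h3 h2) using 1
  rw [sub_sub_sub_cancel_right, commutatorBilin_apply]

theorem comm_pow_mem {i j z : ι} {a n : ℕ} {w : List ι}
    (h1 : Lt (List.replicate a z ++ [i, j] ++ List.replicate n z) w)
    (h2 : Lt (List.replicate a z ++ [j, i] ++ List.replicate n z) w) :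
    word k [z] ^ a * b.comm i j * word k [z] ^ n ∈ multiples b.Rule (fun v => Lt v w) := by
  rw [← word_replicate, ← word_replicate]
  exact b.comm_mem i j _ _ h1 h2

theorem overlap_pair_pow [Fact p.Prime] [CharP k p] {i j : ι} (h : j < i) (hj : b.deg j = 0) :
    b.comm i j * word k (List.replicate (p - 1) j) - word k [i] *
      (word k (List.replicate p j) - b.lin (G.pmap ⟨b.toBasis j, hj ▸ b.mem j⟩)) ∈
      multiples b.Rule (fun v => Lt v ([i] ++ List.replicate p j)) := by
  have hp : p.Prime := Fact.out
  have hD : b.consequences p ≤ multiples b.Rule (fun v => Lt v ([i] ++ List.replicate p j)) :=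
    b.consequences_le (by simp)
  have h1 := hD (b.commutator_sum_mem hj (b.toBasis i))
  set P := b.lin (G.pmap ⟨b.toBasis j, hj ▸ b.mem j⟩ : g) with hP
  have hrule : (word k (List.replicate p j) - P) * word k [i] ∈
      multiples b.Rule (fun v => Lt v ([i] ++ List.replicate p j)) := by
    have := mem_multiples (a := []) (b := [i]) (P := fun v => Lt v ([i] ++ List.replicate p j))
      (Rule.pow (b := b) hj) (by
        refine List.Shortlex.of_lex (by simp) ?_
        obtain ⟨q, hq⟩ : ∃ q, p = q + 1 := ⟨p - 1, by have := hp.pos; omega⟩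
        rw [hq]
        exact List.Lex.rel h)
    simpa [word_nil] using this
  have htele := sum_pow_mul_commutator_mul_pow (word k [i]) (word k [j] : FreeAlg k ι) p
  have hc : word k [i] * word k [j] - word k [j] * word k [i] =
      b.comm i j - b.lin (G.br (b.toBasis j) (b.toBasis i)) := by
    rw [comm, hj, superSign_zero_right, one_smul, G.br_even_left (hj ▸ b.mem j : _ ∈ G.gr 0),
      map_neg]
    abel
  simp only [hc, mul_sub, sub_mul, Finset.sum_sub_distrib] at htele
  have hsum : ∑ a ∈ Finset.range (p - 1), word k [j] ^ (a + 1) * b.comm i j *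
      word k [j] ^ (p - 1 - (a + 1)) ∈
      multiples b.Rule (fun v => Lt v ([i] ++ List.replicate p j)) := by
    refine sum_mem fun a ha => b.comm_pow_mem ?_ ?_
    all_goals
      rw [Finset.mem_range] at ha
      refine List.Shortlex.of_lex (by simp; omega) ?_
      exact List.Lex.rel h
  have hsplit : ∑ a ∈ Finset.range p, word k [j] ^ a * b.comm i j * word k [j] ^ (p - 1 - a) =
      ∑ a ∈ Finset.range (p - 1), word k [j] ^ (a + 1) * b.comm i j *
        word k [j] ^ (p - 1 - (a + 1)) + b.comm i j * word k [j] ^ (p - 1) := by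
    rw [sum_range_eq_add_zero _ hp.pos]
    simp
  rw [hsplit] at htele
  rw [lin_basis] at h1
  convert sub_mem (sub_mem h1 hrule) hsum using 1
  rw [word_replicate, word_replicate, eq_sub_of_add_eq' (eq_add_of_sub_eq htele)]
  noncomm_ring

theorem overlap_pow_pair [Fact p.Prime] [CharP k p] {i j : ι} (h : j < i) (hi : b.deg i = 0) :
    (word k (List.replicate p i) - b.lin (G.pmap ⟨b.toBasis i, hi ▸ b.mem i⟩)) * word k [j] -
      word k (List.replicate (p - 1) i) * b.comm i j ∈
      multiples b.Rule (fun v => Lt v (List.replicate p i ++ [j])) := by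
  have hp : p.Prime := Fact.out
  have hD : b.consequences p ≤ multiples b.Rule (fun v => Lt v (List.replicate p i ++ [j])) :=
    b.consequences_le (by simp)
  have h1 := hD (b.commutator_sum_mem hi (b.toBasis j))
  set P := b.lin (G.pmap ⟨b.toBasis i, hi ▸ b.mem i⟩ : g) with hP
  obtain ⟨q, hq⟩ : ∃ q, p = q + 1 := ⟨p - 1, by have := hp.pos; omega⟩
  have hrule : word k [j] * (word k (List.replicate p i) - P) ∈
      multiples b.Rule (fun v => Lt v (List.replicate p i ++ [j])) := by
    have := mem_multiples (a := [j]) (b := []) (P := fun v => Lt v (List.replicate p i ++ [j]))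
      (Rule.pow (b := b) hi) (by
        refine List.Shortlex.of_lex (by simp) ?_
        rw [hq]
        exact List.Lex.rel h)
    simpa [word_nil] using this
  have htele := sum_pow_mul_commutator_mul_pow (word k [j]) (word k [i] : FreeAlg k ι) p
  have hc : word k [j] * word k [i] - word k [i] * word k [j] =
      -(b.comm i j + b.lin (G.br (b.toBasis i) (b.toBasis j))) := by
    rw [comm, hi, superSign_zero_left, one_smul]
    abel
  simp only [hc, mul_neg, neg_mul, mul_add, add_mul, Finset.sum_neg_distrib,
    Finset.sum_add_distrib] at htele
  have hsum : ∑ a ∈ Finset.range (p - 1), word k [i] ^ a * b.comm i j *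
      word k [i] ^ (p - 1 - a) ∈
      multiples b.Rule (fun v => Lt v (List.replicate p i ++ [j])) := by
    refine sum_mem fun a ha => b.comm_pow_mem ?_ ?_
    all_goals
      rw [Finset.mem_range] at ha
      refine List.Shortlex.of_lex (by simp; omega) ?_
      obtain ⟨c, hc⟩ : ∃ c, p - 1 - a = c + 1 := ⟨p - 1 - a - 1, by omega⟩
      have hpa : p = a + (1 + (c + 1)) := by omega
      have hr : List.replicate p i = List.replicate a i ++ i :: i :: List.replicate c i := by
        rw [hpa, List.replicate_add]
        simp [add_comm 1, List.replicate_succ]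
      rw [hr, List.append_assoc, List.append_assoc]
      refine List.Lex.append_left _ ?_ _
    · exact List.Lex.cons (List.Lex.rel h)
    · exact List.Lex.rel h
  have hsplit : ∑ a ∈ Finset.range p, word k [i] ^ a * b.comm i j * word k [i] ^ (p - 1 - a) =
      ∑ a ∈ Finset.range (p - 1), word k [i] ^ a * b.comm i j *
        word k [i] ^ (p - 1 - a) + word k [i] ^ (p - 1) * b.comm i j := by
    rw [sum_range_eq_add_last _ hp.pos]
    simp
  rw [hsplit] at htele
  rw [lin_basis] at h1
  convert add_mem (add_mem h1 hrule) hsum using 1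
  rw [word_replicate, word_replicate]
  have e : ∀ S T x y z : FreeAlg k ι, -(S + x + T) = y - z → x = z - y - S - T := by
    intro S T x y z h
    rw [← sub_eq_zero] at h ⊢
    rw [← neg_eq_zero, ← h]
    abel
  rw [e _ _ _ _ _ htele]
  noncomm_ring

theorem overlap_pow_pow [Fact p.Prime] {i : ι} (hi : b.deg i = 0) (r : ℕ) :
    word k [i] ^ r * b.lin (G.pmap ⟨b.toBasis i, hi ▸ b.mem i⟩) -
      b.lin (G.pmap ⟨b.toBasis i, hi ▸ b.mem i⟩) * word k [i] ^ r ∈ b.consequences (r + 1) := by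
  have hp : p.Prime := Fact.out
  have hx : b.toBasis i ∈ G.gr 0 := hi ▸ b.mem i
  set P := b.lin (G.pmap ⟨b.toBasis i, hi ▸ b.mem i⟩ : g) with hP
  have h2 : word k [i] * P - P * word k [i] ∈ b.consequences 2 := by
    have h1 := b.lin_commutator_mem (G.pmap ⟨b.toBasis i, hx⟩).2 (b.toBasis i)
    have h0 : (G.br (b.toBasis i) ^ p) (b.toBasis i) = 0 := by
      rw [← pow_sub_one_mul hp.ne_zero, Module.End.mul_apply, G.br_even_self hx, map_zero]
    rw [G.pmap_ad, h0, map_zero, sub_zero, commutatorBilin_apply, lin_basis] at h1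
    rw [← neg_sub]
    exact neg_mem h1
  induction r with
  | zero => simp
  | succ r ih =>
    have h3 := b.lin_mul_mem (b.toBasis i) ih
    have h4 := word_mul_multiples (a := []) (b := List.replicate r i)
      (Q := fun w => w.length ≤ r + 1 + 1) (by intro w hw; simp; omega) h2
    rw [word_nil, one_mul, word_replicate] at h4
    rw [lin_basis] at h3
    convert add_mem h3 h4 using 1
    rw [pow_succ']
    noncomm_ring

end HomogeneousBasis
end RestrictedLieSuperalgebra

namespace RestrictedLieSuperalgebra

variable {k : Type u} {p : ℕ} {g : Type v} [Field k] [AddCommGroup g] [Module k g]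
  {G : RestrictedLieSuperalgebra k p g}

namespace HomogeneousBasis

open Rewriting

variable {ι : Type*} [LinearOrder ι] (b : G.HomogeneousBasis ι)

theorem rule_cases {u : List ι} {f : FreeAlg k ι} (h : b.Rule u f) :
    (∃ i j, u = [i, j] ∧ (j < i ∨ j = i ∧ b.deg i = 1)) ∨
    ∃ (i : ι) (hi : b.deg i = 0), u = List.replicate p i ∧
      f = b.lin (G.pmap ⟨b.toBasis i, hi ▸ b.mem i⟩) := by
  cases h with
  | quad h => exact Or.inl ⟨_, _, rfl, Or.inl h⟩
  | sq h => exact Or.inl ⟨_, _, rfl, Or.inr ⟨rfl, h⟩⟩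
  | pow h => exact Or.inr ⟨_, h, rfl, rfl⟩

theorem rule_pair_ne_pow {i j l : ι} (h : j < i ∨ j = i ∧ b.deg i = 1) (hl : b.deg l = 0)
    (hi : i = l) (hj : j = l) : False := by
  subst hi hj
  rcases h with h | ⟨-, h⟩
  · exact lt_irrefl _ h
  · rw [h] at hl; exact one_ne_zero hl

/-- No left-hand side of a rule is properly contained in another one. -/
theorem rule_infix (hp : 2 < p) {u s r : List ι} {f f' : FreeAlg k ι} (h : b.Rule u f)
    (h' : b.Rule (s ++ u ++ r) f') : s = [] ∧ r = [] := by
  suffices (s ++ u ++ r).length = u.length by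
    simp only [List.length_append] at this
    exact ⟨List.eq_nil_of_length_eq_zero (by omega), List.eq_nil_of_length_eq_zero (by omega)⟩
  rcases b.rule_cases h with ⟨i, j, hu, hij⟩ | ⟨i, hi, hu, -⟩ <;>
  rcases b.rule_cases h' with ⟨i', j', hu', hij'⟩ | ⟨i', hi', hu', -⟩
  · rw [hu', hu]; rfl
  · exfalso
    have hm : ∀ x ∈ u, x = i' := fun x hx => by
      have : x ∈ s ++ u ++ r := by simp [hx]
      rw [hu'] at this
      exact List.eq_of_mem_replicate this
    exact b.rule_pair_ne_pow hij hi' (hm i (by simp [hu])) (hm j (by simp [hu]))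
  · exfalso
    have h1 := congrArg List.length hu'
    rw [hu] at h1
    simp at h1
    omega
  · rw [hu', hu]; simp

theorem rule_unique (hp : 2 < p) {u : List ι} {f f' : FreeAlg k ι} (h : b.Rule u f)
    (h' : b.Rule u f') : f = f' := by
  rcases b.rule_cases h with ⟨i, j, rfl, hij⟩ | ⟨i, hi, rfl, rfl⟩
  · rcases b.rule_pair h hp with ⟨h1, e⟩ | ⟨h1, -, e⟩ <;>
    rcases b.rule_pair h' hp with ⟨h1', e'⟩ | ⟨h1', -, e'⟩
    · rw [← e] at e'; exact (sub_right_injective e').symm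
    · exact absurd h1' h1.ne
    · exact absurd h1 h1'.ne
    · rw [← e', ← sub_eq_zero] at e
      refine sub_eq_zero.1 (neg_eq_zero.1 (G.eq_zero_of_add_self ?_))
      rw [← e]; abel
  · rcases b.rule_cases h' with ⟨i', j', hu, hij⟩ | ⟨i', hi', hu, rfl⟩
    · have := congrArg List.length hu
      simp at this
      omega
    · have : i = i' := by
        have : i ∈ List.replicate p i' := by rw [← hu]; simp; omega
        exact List.eq_of_mem_replicate this
      subst this
      rfl

theorem overlap_mem [Fact p.Prime] [CharP k p] (hp : 2 < p) {s t r : List ι}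
    {f f' : FreeAlg k ι} (h : b.Rule (s ++ t) f) (h' : b.Rule (t ++ r) f') (hs : s ≠ [])
    (ht : t ≠ []) (hr : r ≠ []) :
    (word k (s ++ t) - f) * word k r - word k s * (word k (t ++ r) - f') ∈
      multiples b.Rule (fun v => Lt v (s ++ t ++ r)) := by
  have two : ∀ {s t : List ι} {i j : ι}, s ++ t = [i, j] → s ≠ [] → t ≠ [] →
      s = [i] ∧ t = [j] := by
    intro s t i j e hs ht
    obtain ⟨x, s, rfl⟩ := List.exists_cons_of_ne_nil hs
    obtain ⟨y, t, rfl⟩ := List.exists_cons_of_ne_nil ht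
    have := congrArg List.length e
    simp at this
    have h1 : s = [] := List.eq_nil_of_length_eq_zero (by omega)
    have h2 : t = [] := List.eq_nil_of_length_eq_zero (by omega)
    subst h1 h2
    simpa using e
  rcases b.rule_cases h with ⟨i, j, hu, hij⟩ | ⟨i, hi, hu, hf⟩
  · obtain ⟨rfl, rfl⟩ := two hu hs ht
    rcases b.rule_cases h' with ⟨i', l, hu', hij'⟩ | ⟨l, hl, hu', hf'⟩
    · obtain ⟨hj, rfl⟩ := two hu' ht hr
      obtain rfl : j = i' := by simpa using hj
      exact b.overlap_pair_pair hp h h'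
    · obtain ⟨hlen, hj, hr'⟩ := List.append_eq_replicate_iff.1 hu'
      obtain rfl : j = l := by simpa using hj
      have hlt : j < i := by
        rcases hij with h | ⟨rfl, h⟩
        · exact h
        · rw [h] at hl; exact absurd hl one_ne_zero
      have e : word k [i, j] - f = b.comm i j := by
        rcases b.rule_pair h hp with ⟨-, e⟩ | ⟨h1, -⟩
        · exact e
        · exact absurd h1 hlt.ne
      have hr2 : r = List.replicate (p - 1) j := by
        rw [hr']; congr 1; simp at hlen; omega
      have hw : [i] ++ [j] ++ r = [i] ++ List.replicate p j := by rw [List.append_assoc, hu']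
      rw [hw, hu', hf', hr2]
      change (word k [i, j] - f) * _ - _ ∈ _
      rw [e]
      exact b.overlap_pair_pow hlt hl
  · obtain ⟨hlen, hs', ht'⟩ := List.append_eq_replicate_iff.1 hu
    rcases b.rule_cases h' with ⟨i', l, hu', hij'⟩ | ⟨l, hl, hu', hf'⟩
    · obtain ⟨rfl, rfl⟩ := two hu' ht hr
      obtain rfl : i' = i := by simpa using ht'
      have hlt : l < i' := by
        rcases hij' with h | ⟨rfl, h⟩
        · exact h
        · rw [h] at hi; exact absurd hi one_ne_zero
      have e : word k [i', l] - f' = b.comm i' l := by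
        rcases b.rule_pair h' hp with ⟨-, e⟩ | ⟨h1, -⟩
        · exact e
        · exact absurd h1 hlt.ne
      have hs2 : s = List.replicate (p - 1) i' := by
        rw [hs']; congr 1; simp at hlen; omega
      rw [hu, hs2, hf]
      change _ - _ * (word k [i', l] - f') ∈ _
      rw [e]
      exact b.overlap_pow_pair hlt hi
    · obtain ⟨hlen', ht2, hr'⟩ := List.append_eq_replicate_iff.1 hu'
      obtain ⟨y, t', rfl⟩ := List.exists_cons_of_ne_nil ht
      have h1 : y = i := by simpa [List.replicate_succ] using (List.cons.inj ht').1
      have h2 : y = l := by simpa [List.replicate_succ] using (List.cons.inj ht2).1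
      subst h1 h2
      have hlr : r.length = s.length := by omega
      have hpos : 0 < s.length := List.length_pos_of_ne_nil hs
      have hsr : s = r := by rw [hs', hr', hlr]
      subst hsr
      have hlt : s.length + 1 < (s ++ (y :: t') ++ s).length := by simp; omega
      have := b.consequences_le hlt (b.overlap_pow_pow hi s.length)
      rw [hu, hu', hf, hf', word_replicate, show word k s = word k [y] ^ s.length by
        rw [← word_replicate, ← hs']]
      rw [hu] at this
      convert this using 1
      rw [sub_mul, mul_sub, ← pow_add, ← pow_add, add_comm p]
      abel

theorem disjoint_mem [Fact p.Prime] {u u' c : List ι} {f f' : FreeAlg k ι} (h : b.Rule u f)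
    (h' : b.Rule u' f') :
    (word k u - f) * word k (c ++ u') - word k (u ++ c) * (word k u' - f') ∈
      multiples b.Rule (fun v => Lt v (u ++ c ++ u')) := by
  have hleft : ∀ x ∈ wordSpan k (fun v => Lt v u), x * word k c * (word k u' - f') ∈
      multiples b.Rule (fun v => Lt v (u ++ c ++ u')) := by
    intro x hx
    induction hx using Submodule.span_induction with
    | mem x hx =>
      obtain ⟨v, hv, rfl⟩ := hx
      have := mem_multiples (a := v ++ c) (b := []) (P := fun v => Lt v (u ++ c ++ u')) h'
        (by simpa using hv.append [] (c ++ u'))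
      simpa [word_nil, word_append] using this
    | zero => simp
    | add x y _ _ hx hy => rw [add_mul, add_mul]; exact add_mem hx hy
    | smul a x _ hx => rw [smul_mul_assoc, smul_mul_assoc]; exact Submodule.smul_mem _ _ hx
  have hright : ∀ x ∈ wordSpan k (fun v => Lt v u'), (word k u - f) * word k c * x ∈
      multiples b.Rule (fun v => Lt v (u ++ c ++ u')) := by
    intro x hx
    induction hx using Submodule.span_induction with
    | mem x hx =>
      obtain ⟨v, hv, rfl⟩ := hx
      have := mem_multiples (a := []) (b := c ++ v) (P := fun v => Lt v (u ++ c ++ u')) h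
        (by simpa using hv.append (u ++ c) [])
      simpa [word_nil, word_append, mul_assoc] using this
    | zero => simp
    | add x y _ _ hx hy => rw [mul_add]; exact add_mem hx hy
    | smul a x _ hx => rw [mul_smul_comm]; exact Submodule.smul_mem _ _ hx
  convert sub_mem (hright f' (b.rule_decreasing h')) (hleft f (b.rule_decreasing h)) using 1
  rw [word_append, word_append]
  noncomm_ring

theorem resolve_of_prefix [Fact p.Prime] [CharP k p] (hp : 2 < p) {u b₁ c u' b₂ : List ι}
    {f f' : FreeAlg k ι} (h : b.Rule u f) (h' : b.Rule u' f') (e : u ++ b₁ = c ++ (u' ++ b₂)) :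
    (word k u - f) * word k b₁ - word k c * (word k u' - f') * word k b₂ ∈
      multiples b.Rule (fun v => Lt v (u ++ b₁)) := by
  have tail : ∀ {w x z}, x ∈ multiples b.Rule (fun v => Lt v w) → w ++ b₂ = u ++ b₁ →
      x * word k b₂ = z → z ∈ multiples b.Rule (fun v => Lt v (u ++ b₁)) := by
    intro w x z hx hw hz
    have := word_mul_multiples (a := []) (b := b₂) (Q := fun v => Lt v (u ++ b₁))
      (fun v hv => by rw [← hw]; simpa using hv.append [] b₂) hx
    rwa [word_nil, one_mul, hz] at this
  rcases List.append_eq_append_iff.1 e with ⟨d, rfl, rfl⟩ | ⟨d, hu, e'⟩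
  · refine tail (b.disjoint_mem (c := d) h h') (by simp) ?_
    rw [sub_mul, mul_assoc, ← word_append, List.append_assoc]
  · rcases List.append_eq_append_iff.1 e' with ⟨r, rfl, rfl⟩ | ⟨r, rfl, rfl⟩
    · rw [← List.append_assoc] at hu
      rw [hu] at h
      obtain ⟨rfl, rfl⟩ := b.rule_infix hp h' h
      rw [List.nil_append, List.append_nil] at h hu
      rw [hu, b.rule_unique hp h h', word_nil, one_mul, List.nil_append, sub_self]
      exact zero_mem _
    · by_cases hd : d = []
      · subst hd
        rw [List.append_nil] at hu
        subst hu
        rw [List.nil_append] at h' ⊢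
        refine tail (b.disjoint_mem (c := []) h h') (by simp) ?_
        rw [sub_mul, mul_assoc, ← word_append]
        simp
      by_cases hc : c = []
      · subst hc
        obtain rfl : u = d := hu
        obtain ⟨-, rfl⟩ := b.rule_infix hp (s := []) (r := r) h (by simpa using h')
        rw [List.append_nil] at h'
        rw [b.rule_unique hp h h', word_nil, one_mul, List.append_nil, List.nil_append, sub_self]
        exact zero_mem _
      by_cases hr : r = []
      · subst hr
        rw [List.append_nil] at h'
        exact absurd (b.rule_infix hp (s := c) (r := []) h' (by rw [List.append_nil, ← hu]; exact h)).1
          hc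
      rw [hu] at h
      refine tail (b.overlap_mem hp h h' hc hd hr) (by rw [hu]; simp) ?_
      rw [hu, word_append r, sub_mul, mul_assoc]

theorem resolve [Fact p.Prime] [CharP k p] (hp : 2 < p) {a u c a' u' c' : List ι}
    {f f' : FreeAlg k ι} (h : b.Rule u f) (h' : b.Rule u' f')
    (e : a ++ u ++ c = a' ++ u' ++ c') :
    word k a * (word k u - f) * word k c - word k a' * (word k u' - f') * word k c' ∈
      multiples b.Rule (fun v => Lt v (a ++ u ++ c)) := by
  have key : ∀ {a u c d u' c' : List ι} {f f' : FreeAlg k ι}, b.Rule u f → b.Rule u' f' →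
      u ++ c = d ++ (u' ++ c') →
      word k a * (word k u - f) * word k c -
        word k (a ++ d) * (word k u' - f') * word k c' ∈
      multiples b.Rule (fun v => Lt v (a ++ u ++ c)) := by
    intro a u c d u' c' f f' h h' e
    have := word_mul_multiples (a := a) (b := []) (Q := fun v => Lt v (a ++ u ++ c))
      (fun v hv => by simpa using hv.append a []) (b.resolve_of_prefix hp h h' e)
    simpa [word_nil, word_append, mul_sub, sub_mul, mul_assoc] using this
  rw [List.append_assoc, List.append_assoc] at e
  rcases List.append_eq_append_iff.1 e with ⟨d, rfl, e'⟩ | ⟨d, rfl, e'⟩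
  · exact key h h' e'
  · have := key (a := a') h' h e'
    rw [← neg_sub, List.append_assoc, e, ← List.append_assoc]
    exact neg_mem this

/-! ### Linear independence of the ordered monomials -/

/-- The two-sided ideal of the free algebra generated by the rules. -/
noncomputable def ruleIdeal : Ideal (FreeAlg k ι) where
  carrier := multiples b.Rule (fun _ => True)
  add_mem' := add_mem
  zero_mem' := zero_mem _
  smul_mem' c x hx := by
    have hc := mem_wordSpan_top c
    rw [smul_eq_mul]
    change c * x ∈ multiples b.Rule (fun _ => True)
    induction hc using Submodule.span_induction with
    | mem c hc =>
      obtain ⟨w, -, rfl⟩ := hc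
      simpa [word_nil] using word_mul_multiples (a := w) (b := []) (Q := fun _ => True)
        (fun _ _ => trivial) hx
    | zero => simp
    | add c d _ _ hc hd => rw [add_mul]; exact add_mem hc hd
    | smul a c _ hc => rw [smul_mul_assoc]; exact Submodule.smul_mem _ _ hc

theorem mem_ruleIdeal {x : FreeAlg k ι} :
    x ∈ b.ruleIdeal ↔ x ∈ multiples b.Rule (fun _ => True) := Iff.rfl

instance : b.ruleIdeal.IsTwoSided where
  mul_mem_of_left {x} c hx := by
    have hc := mem_wordSpan_top c
    rw [mem_ruleIdeal] at hx ⊢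
    induction hc using Submodule.span_induction with
    | mem c hc =>
      obtain ⟨w, -, rfl⟩ := hc
      simpa [word_nil] using word_mul_multiples (a := []) (b := w) (Q := fun _ => True)
        (fun _ _ => trivial) hx
    | zero => simp
    | add c d _ _ hc hd => rw [mul_add]; exact add_mem hc hd
    | smul a c _ hc => rw [mul_smul_comm]; exact Submodule.smul_mem _ _ hc

/-- The map from `g` to the algebra presented by the rewriting rules. -/
noncomputable def toQuotient : g →ₗ[k] FreeAlg k ι ⧸ b.ruleIdeal :=
  (Ideal.Quotient.mkₐ k b.ruleIdeal).toLinearMap ∘ₗ b.lin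

theorem toQuotient_apply (x : g) :
    b.toQuotient x = Ideal.Quotient.mkₐ k b.ruleIdeal (b.lin x) := rfl

theorem mk_eq_zero_of_mem {m : ℕ} {x : FreeAlg k ι} (hx : x ∈ b.consequences m) :
    Ideal.Quotient.mkₐ k b.ruleIdeal x = 0 :=
  Ideal.Quotient.eq_zero_iff_mem.2 (b.mem_ruleIdeal.2 (multiples_mono (fun _ _ => trivial) hx))

theorem toQuotient_br {x : g} (hx : x ∈ G.gr 0) (y : g) :
    b.toQuotient (G.br x y) = commutatorBilin k _ (b.toQuotient x) (b.toQuotient y) := by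
  have := b.mk_eq_zero_of_mem (b.lin_commutator_mem hx y)
  rw [map_sub, sub_eq_zero, commutatorBilin_apply, map_sub, map_mul, map_mul] at this
  exact this.symm

theorem toQuotient_jacobsonCoeff {x y : g} (hx : x ∈ G.gr 0) (hy : y ∈ G.gr 0) (m j : ℕ) :
    b.toQuotient (jacobsonCoeff G.br x y m j) =
      jacobsonCoeff (commutatorBilin k _) (b.toQuotient x) (b.toQuotient y) m j := by
  induction m generalizing j with
  | zero => cases j <;> simp [jacobsonCoeff]
  | succ m ih => cases j <;> simp only [jacobsonCoeff, map_add, b.toQuotient_br hx,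
      b.toQuotient_br hy, ih]

theorem pmap_zero [Fact p.Prime] : G.pmap 0 = 0 := by
  have := G.pmap_smul 0 0
  rwa [zero_smul, zero_pow (Fact.out : p.Prime).ne_zero, zero_smul] at this

theorem toQuotient_pow [Fact p.Prime] [CharP k p] (x : G.gr 0) :
    b.toQuotient (x : g) ^ p = b.toQuotient (G.pmap x : g) := by
  have key : ∀ x ∈ Submodule.span k {x | ∃ l, b.deg l = 0 ∧ x = b.toBasis l},
      ∃ h : x ∈ G.gr 0, b.toQuotient x ^ p = b.toQuotient (G.pmap ⟨x, h⟩ : g) := by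
    intro x hx
    induction hx using Submodule.span_induction with
    | mem x hx =>
      obtain ⟨l, hl, rfl⟩ := hx
      refine ⟨hl ▸ b.mem l, ?_⟩
      have h1 : word k (List.replicate p l) - b.lin (G.pmap ⟨b.toBasis l, hl ▸ b.mem l⟩) ∈
          b.ruleIdeal := by
        rw [mem_ruleIdeal]
        simpa [word_nil] using mem_multiples (a := []) (b := []) (P := fun _ => True)
          (Rule.pow (b := b) hl) trivial
      have h2 : Ideal.Quotient.mkₐ k b.ruleIdeal _ = 0 := Ideal.Quotient.eq_zero_iff_mem.2 h1
      rw [map_sub, sub_eq_zero, word_replicate, map_pow, ← b.lin_basis] at h2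
      exact h2
    | zero =>
      refine ⟨zero_mem _, ?_⟩
      have : (⟨0, zero_mem _⟩ : G.gr 0) = 0 := rfl
      rw [this, pmap_zero, map_zero, zero_pow (Fact.out : p.Prime).ne_zero]
      simp
    | add x y _ _ hx hy =>
      obtain ⟨hx, ex⟩ := hx
      obtain ⟨hy, ey⟩ := hy
      refine ⟨add_mem hx hy, ?_⟩
      have := G.pmap_add ⟨x, hx⟩ ⟨y, hy⟩
      rw [map_add, add_pow_prime_eq_jacobson (k := k), ex, ey,
        show (⟨x + y, add_mem hx hy⟩ : G.gr 0) = ⟨x, hx⟩ + ⟨y, hy⟩ from rfl, this]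
      simp only [map_add, map_sum, map_smul, b.toQuotient_jacobsonCoeff hx hy]
    | smul c x _ hx =>
      obtain ⟨hx, ex⟩ := hx
      refine ⟨Submodule.smul_mem _ _ hx, ?_⟩
      have := G.pmap_smul c ⟨x, hx⟩
      rw [map_smul, smul_pow, ex,
        show (⟨c • x, Submodule.smul_mem _ _ hx⟩ : G.gr 0) = c • ⟨x, hx⟩ from rfl, this]
      simp
  obtain ⟨h, e⟩ := key x (b.gr_le_span 0 x.2)
  exact e

theorem toQuotient_compat [Fact p.Prime] [CharP k p] : G.EnvCompat b.toQuotient where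
  br {i j x y} hx hy := by
    have := b.mk_eq_zero_of_mem (b.lin_commute_mem hx hy)
    rw [sub_sub, map_sub, sub_eq_zero, map_add, map_zsmul, map_mul, map_mul] at this
    exact this
  pow := b.toQuotient_pow

end HomogeneousBasis

/-- The product in `u(g)` of the elements of a family that are listed in a word. -/
noncomputable def monomial {ι : Type*} (G : RestrictedLieSuperalgebra k p g) (x : ι → g)
    (w : List ι) : G.Env :=
  (w.map fun i => G.ι (x i)).prod

theorem monomial_append {ι : Type*} (x : ι → g) (v w : List ι) :
    G.monomial x (v ++ w) = G.monomial x v * G.monomial x w := by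
  simp [monomial]

theorem monomial_cons {ι : Type*} (x : ι → g) (i : ι) (w : List ι) :
    G.monomial x (i :: w) = G.ι (x i) * G.monomial x w := by
  simp [monomial]

namespace HomogeneousBasis

open Rewriting

variable {ι : Type*} [LinearOrder ι] (b : G.HomogeneousBasis ι)

theorem envLift_toQuotient_monomial [Fact p.Prime] [CharP k p] (w : List ι) :
    G.envLift b.toQuotient b.toQuotient_compat (G.monomial b.toBasis w) =
      Ideal.Quotient.mkₐ k b.ruleIdeal (word k w) := by
  induction w with
  | nil => simp [monomial, word_nil]
  | cons i w ih =>
    rw [monomial_cons, map_mul, ih, envLift_ι, toQuotient_apply, lin_basis, ← map_mul,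
      ← word_append]
    rfl

/-- The Poincaré–Birkhoff–Witt theorem: the irreducible monomials are linearly independent
in `u(g)`. -/
theorem linearIndependent_monomial [WellFoundedLT ι] [Fact p.Prime] [CharP k p] (hp : 2 < p) :
    LinearIndependent k (fun w : {w : List ι // ¬ Reducible b.Rule w} =>
      G.monomial b.toBasis w.1) := by
  refine LinearIndependent.of_comp
    (G.envLift b.toQuotient b.toQuotient_compat).toLinearMap ?_
  have e : (G.envLift b.toQuotient b.toQuotient_compat).toLinearMap ∘
      (fun w : {w : List ι // ¬ Reducible b.Rule w} => G.monomial b.toBasis w.1) =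
      (Ideal.Quotient.mkₐ k b.ruleIdeal).toLinearMap ∘
        (fun w : {w : List ι // ¬ Reducible b.Rule w} => word k w.1) := by
    ext w
    exact b.envLift_toQuotient_monomial w.1
  rw [e]
  refine (linearIndependent_word.comp _ Subtype.val_injective).map ?_
  rw [Submodule.disjoint_def]
  intro x hx hx'
  rw [LinearMap.mem_ker] at hx'
  have h1 : x ∈ b.ruleIdeal := Ideal.Quotient.eq_zero_iff_mem.1 hx'
  refine eq_zero_of_mem_multiples b.rule_decreasing (b.resolve hp) (b.mem_ruleIdeal.1 h1) ?_
  refine (Submodule.span_le.2 ?_) hx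
  rintro _ ⟨w, rfl⟩
  exact word_mem_wordSpan w.2

end HomogeneousBasis
end RestrictedLieSuperalgebra

/-! ### Ordered words -/

section NormalWord

variable {ι : Type*} [LinearOrder ι]

/-- A word is normal if it is sorted and no letter `i` occurs `q i` times or more. -/
def IsNormalWord (q : ι → ℕ) (w : List ι) : Prop :=
  w.Pairwise (· ≤ ·) ∧ ∀ i, w.count i < q i

theorem exists_descent_of_not_pairwise {w : List ι} (h : ¬ w.Pairwise (· ≤ ·)) :
    ∃ a c i j, j < i ∧ w = a ++ [i, j] ++ c := by
  induction w with
  | nil => exact absurd List.Pairwise.nil h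
  | cons x w ih =>
    by_cases hw : w.Pairwise (· ≤ ·)
    · rw [List.pairwise_cons, not_and_or] at h
      rcases h with h | h
      · push Not at h
        obtain ⟨y, hy, hyx⟩ := h
        obtain ⟨z, w', rfl⟩ := List.exists_cons_of_ne_nil (List.ne_nil_of_mem hy)
        refine ⟨[], w', x, z, ?_, rfl⟩
        rcases List.mem_cons.1 hy with rfl | hy
        · exact hyx
        · exact ((List.pairwise_cons.1 hw).1 y hy).trans_lt hyx
      · exact absurd hw h
    · obtain ⟨a, c, i, j, hij, rfl⟩ := ih hw
      exact ⟨x :: a, c, i, j, hij, rfl⟩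

theorem exists_eq_replicate_append {i : ι} {w : List ι} (h : w.Pairwise (· ≤ ·))
    (hi : ∀ j ∈ w, i ≤ j) {n : ℕ} (hn : n ≤ w.count i) : ∃ c, w = List.replicate n i ++ c := by
  induction n generalizing w with
  | zero => exact ⟨w, rfl⟩
  | succ n ih =>
    cases w with
    | nil => simp at hn
    | cons x w =>
      rw [List.pairwise_cons] at h
      obtain rfl : x = i := by
        have : i ∈ x :: w := List.count_pos_iff.1 (by omega)
        rcases List.mem_cons.1 this with e | e
        · exact e.symm
        · exact le_antisymm (h.1 i e) (hi x (by simp))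
      obtain ⟨c, rfl⟩ := ih h.2 (fun j hj => hi j (by simp [hj])) (by simpa using hn)
      exact ⟨c, rfl⟩

theorem exists_eq_append_replicate_append {i : ι} {w : List ι} (h : w.Pairwise (· ≤ ·)) {n : ℕ}
    (hn : n ≤ w.count i) : ∃ a c, w = a ++ List.replicate n i ++ c := by
  induction w with
  | nil =>
    obtain rfl : n = 0 := by simpa using hn
    exact ⟨[], [], rfl⟩
  | cons x w ih =>
    by_cases hx : x = i
    · subst hx
      obtain ⟨c, hc⟩ := exists_eq_replicate_append h (by
        intro j hj
        rcases List.mem_cons.1 hj with rfl | hj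
        · exact le_rfl
        · exact (List.pairwise_cons.1 h).1 j hj) hn
      exact ⟨[], c, hc⟩
    · rw [List.count_cons_of_ne hx] at hn
      obtain ⟨a, c, rfl⟩ := ih (List.pairwise_cons.1 h).2 hn
      exact ⟨x :: a, c, rfl⟩

theorem exists_of_not_isNormalWord {q : ι → ℕ} {w : List ι} (h : ¬ IsNormalWord q w) :
    ∃ a c, (∃ i j, j < i ∧ w = a ++ [i, j] ++ c) ∨ ∃ i, w = a ++ List.replicate (q i) i ++ c := by
  by_cases hw : w.Pairwise (· ≤ ·)
  · have : ∃ i, q i ≤ w.count i := by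
      by_contra! h'
      exact h ⟨hw, h'⟩
    obtain ⟨i, hi⟩ := this
    obtain ⟨a, c, e⟩ := exists_eq_append_replicate_append hw hi
    exact ⟨a, c, Or.inr ⟨i, e⟩⟩
  · obtain ⟨a, c, i, j, hij, e⟩ := exists_descent_of_not_pairwise hw
    exact ⟨a, c, Or.inl ⟨i, j, hij, e⟩⟩

theorem IsNormalWord.sublist {q : ι → ℕ} {v w : List ι} (hw : IsNormalWord q w)
    (h : v.Sublist w) : IsNormalWord q v :=
  ⟨hw.1.sublist h, fun i => (h.count_le i).trans_lt (hw.2 i)⟩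

theorem IsNormalWord.of_map {α : Type*} [LinearOrder α] {q : ι → ℕ} {w : List α} {f : α → ι}
    (hf : StrictMono f) (hw : IsNormalWord q (w.map f)) : IsNormalWord (q ∘ f) w := by
  refine ⟨?_, fun i => ?_⟩
  · have := List.pairwise_map.1 hw.1
    exact this.imp fun h => hf.le_iff_le.1 h
  · have := hw.2 (f i)
    rwa [List.count_map_of_injective w f hf.injective] at this

/-- A normal word splits into letters that satisfy a downward closed predicate, followed by
letters that do not. -/
theorem IsNormalWord.exists_append {q : ι → ℕ} {P : ι → Prop} (hP : ∀ i j, P j → i ≤ j → P i)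
    {w : List ι} (hw : IsNormalWord q w) :
    ∃ w₁ w₂, w = w₁ ++ w₂ ∧ (∀ i ∈ w₁, P i) ∧ ∀ i ∈ w₂, ¬ P i := by
  induction w with
  | nil => exact ⟨[], [], rfl, by simp, by simp⟩
  | cons l w ih =>
    by_cases hl : P l
    · obtain ⟨w₁, w₂, rfl, h1, h2⟩ := ih (hw.sublist (List.sublist_cons_self l w))
      refine ⟨l :: w₁, w₂, rfl, ?_, h2⟩
      intro i hi
      rcases List.mem_cons.1 hi with rfl | hi
      exacts [hl, h1 i hi]
    · refine ⟨[], l :: w, rfl, by simp, ?_⟩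
      intro i hi hPi
      rcases List.mem_cons.1 hi with rfl | hi
      · exact hl hPi
      · exact hl (hP _ _ hPi ((List.pairwise_cons.1 hw.1).1 i hi))

variable [Fintype ι]

/-- The sorted word in which each letter `i` occurs `e i` times. -/
noncomputable def expWord (e : ι → ℕ) : List ι :=
  (∑ i, Multiset.replicate (e i) i).sort (· ≤ ·)

theorem coe_expWord (e : ι → ℕ) :
    (expWord e : Multiset ι) = ∑ i, Multiset.replicate (e i) i :=
  Multiset.sort_eq _ _

theorem pairwise_expWord (e : ι → ℕ) : (expWord e).Pairwise (· ≤ ·) :=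
  Multiset.pairwise_sort _ _

theorem count_expWord (e : ι → ℕ) (i : ι) : (expWord e).count i = e i := by
  rw [← Multiset.coe_count, coe_expWord, Multiset.count_sum']
  simp [Multiset.count_replicate]

theorem eq_expWord {w : List ι} (h : w.Pairwise (· ≤ ·)) : w = expWord fun i => w.count i := by
  refine List.Perm.eq_of_pairwise' h (pairwise_expWord _) ?_
  rw [List.perm_iff_count]
  intro i
  rw [count_expWord]

theorem expWord_injective : Function.Injective (expWord : (ι → ℕ) → List ι) := by
  intro e e' h
  ext i
  rw [← count_expWord e, h, count_expWord]

theorem sum_map_expWord {M : Type*} [AddCommMonoid M] (e : ι → ℕ) (f : ι → M) :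
    ((expWord e).map f).sum = ∑ i, e i • f i := by
  have h : ((Multiset.mapAddMonoidHom f) (∑ i, Multiset.replicate (e i) i)).sum =
      ∑ i, e i • f i := by
    rw [map_sum, Multiset.sum_sum]
    simp [Multiset.mapAddMonoidHom]
  rw [← Multiset.sum_coe, ← Multiset.map_coe, coe_expWord]
  exact h

end NormalWord

namespace RestrictedLieSuperalgebra

variable {k : Type u} {p : ℕ} {g : Type v} [Field k] [AddCommGroup g] [Module k g]
  {G : RestrictedLieSuperalgebra k p g}

/-- The least exponent of a letter that is not allowed in a normal word. -/
def expBound {ι : Type*} (p : ℕ) (deg : ι → ZMod 2) (i : ι) : ℕ := if deg i = 0 then p else 2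

theorem HomogeneousBasis.not_reducible {ι : Type*} [LinearOrder ι] (b : G.HomogeneousBasis ι)
    {w : List ι} (hw : IsNormalWord (expBound p b.deg) w) : ¬ Rewriting.Reducible b.Rule w := by
  rintro ⟨a, u, c, f, h, rfl⟩
  have hs : u.Pairwise (· ≤ ·) :=
    hw.1.sublist (List.IsInfix.sublist ⟨a, c, rfl⟩)
  have hc : ∀ i, u.count i < expBound p b.deg i := fun i =>
    (List.IsInfix.sublist (⟨a, c, rfl⟩ : u <:+: a ++ u ++ c)).count_le i |>.trans_lt (hw.2 i)
  cases h with
  | quad h => exact absurd (by simpa using hs) h.not_ge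
  | @sq i h => have := hc i; simp [expBound, h] at this
  | @pow i h => have := hc i; simp [expBound, h] at this

section Spanning

variable {M : Type*} [AddCommGroup M] [Module k M] [Module G.Env M] [IsScalarTower k G.Env M]
  {ι : Type*}

theorem monomial_mul_ι_mul_mem {x : ι → g} {v : M} {N : Submodule k M} {a c : List ι}
    (h : ∀ l, G.monomial x (a ++ [l] ++ c) • v ∈ N) {y : g}
    (hy : y ∈ Submodule.span k (Set.range x)) :
    (G.monomial x a * G.ι y * G.monomial x c) • v ∈ N := by
  induction hy using Submodule.span_induction with
  | mem y hy =>
    obtain ⟨l, rfl⟩ := hy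
    have := h l
    rwa [monomial_append, monomial_append, monomial, monomial, List.map_singleton,
      List.prod_singleton] at this
  | zero => simp
  | add y z _ _ hy hz =>
    rw [map_add, mul_add, add_mul, add_smul]; exact add_mem hy hz
  | smul r y _ hy =>
    rw [map_smul, mul_smul_comm, smul_mul_assoc, smul_assoc]
    exact Submodule.smul_mem _ _ hy

/-- Straightening: the normal monomials span everything that is generated by a family closed under
brackets and `p`-th powers. -/
theorem monomial_smul_mem [LinearOrder ι] [WellFoundedLT ι] [Fact p.Prime] {x : ι → g}
    {deg : ι → ZMod 2} (hx : ∀ i, x i ∈ G.gr (deg i))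
    (hbr : ∀ i j, G.br (x i) (x j) ∈ Submodule.span k (Set.range x))
    (hpow : ∀ i (h : x i ∈ G.gr 0), (G.pmap ⟨x i, h⟩ : g) ∈ Submodule.span k (Set.range x))
    {v : M} {N : Submodule k M}
    (hN : ∀ w, IsNormalWord (expBound p deg) w → G.monomial x w • v ∈ N) (w : List ι) :
    G.monomial x w • v ∈ N := by
  have hp : p.Prime := Fact.out
  induction w using WellFounded.induction (List.Shortlex.wf
    (wellFounded_lt : WellFounded ((· < ·) : ι → ι → Prop))) with
  | _ w ih =>
  by_cases hw : IsNormalWord (expBound p deg) w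
  · exact hN w hw
  obtain ⟨a, c, ⟨i, j, hij, rfl⟩ | ⟨i, rfl⟩⟩ := exists_of_not_isNormalWord hw
  · have e : G.monomial x (a ++ [i, j] ++ c) = superSign (deg i) (deg j) •
        G.monomial x (a ++ [j, i] ++ c) +
        G.monomial x a * G.ι (G.br (x i) (x j)) * G.monomial x c := by
      have h1 : ∀ i j, G.monomial x [i, j] = G.ι (x i) * G.ι (x j) := fun i j => by
        simp [monomial]
      rw [monomial_append, monomial_append, h1, G.ι_br (hx i) (hx j), monomial_append,
        monomial_append, h1]
      simp only [mul_add, add_mul, mul_smul_comm, smul_mul_assoc]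
    rw [e, add_smul, smul_assoc]
    refine add_mem (zsmul_mem (ih _ ?_) _) (monomial_mul_ι_mul_mem (fun l => ih _ ?_) (hbr i j))
    · exact Rewriting.Lt.append (v := [j, i]) (w := [i, j])
        (List.Shortlex.of_lex rfl (List.Lex.rel hij)) a c
    · exact List.Shortlex.of_length_lt (by simp)
  · have hrep : ∀ n, G.monomial x (List.replicate n i) = G.ι (x i) ^ n := fun n => by
      simp [monomial]
    rw [monomial_append, monomial_append, hrep]
    by_cases hi : deg i = 0
    · have hxi : x i ∈ G.gr 0 := hi ▸ hx i
      have hq : expBound p deg i = p := by simp [expBound, hi]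
      rw [hq, G.ι_pow ⟨x i, hxi⟩]
      refine monomial_mul_ι_mul_mem (fun l => ih _ ?_) (hpow i hxi)
      refine List.Shortlex.of_length_lt ?_
      have := hp.one_lt
      simp [hq]
      omega
    · have hi1 : deg i = 1 := by simpa using eq_add_one_of_ne hi
      have hxi : x i ∈ G.gr 1 := hi1 ▸ hx i
      have hq : expBound p deg i = 2 := by simp [expBound, hi]
      have e : G.ι (x i) ^ 2 = (2 : k)⁻¹ • G.ι (G.br (x i) (x i)) := by
        have h1 := G.ι_br hxi hxi
        rw [show superSign 1 1 = -1 by decide, neg_one_smul, ← sub_eq_iff_eq_add', sub_neg_eq_add,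
          ← two_smul k] at h1
        rw [← h1, smul_smul, inv_mul_cancel₀ G.two_ne_zero, one_smul, sq]
      rw [hq, e, mul_smul_comm, smul_mul_assoc, smul_assoc]
      refine Submodule.smul_mem _ _ (monomial_mul_ι_mul_mem (fun l => ih _ ?_) (hbr i i))
      exact List.Shortlex.of_length_lt (by simp [hq])

/-- If the letters of the second family act on `v` by scalars, then the normal monomials in
the first family suffice. -/
theorem ι_smul_mem_span_monomial {α β : Type*} [Fintype α] [LinearOrder α] [Finite β]
    [LinearOrder β] [Fact p.Prime] {x : α → g} {y : β → g} {degx : α → ZMod 2} {degy : β → ZMod 2}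
    (hx : ∀ i, x i ∈ G.gr (degx i)) (hy : ∀ j, y j ∈ G.gr (degy j)) {S : Submodule k g}
    (hS : S = Submodule.span k (Set.range x ∪ Set.range y))
    (hbr : ∀ s ∈ S, ∀ t ∈ S, G.br s t ∈ S)
    (hpow : ∀ s : G.gr 0, (s : g) ∈ S → (G.pmap s : g) ∈ S) {v : M}
    (hv : ∀ j, ∃ c : k, G.ι (y j) • v = c • v) {s : g} (hs : s ∈ S) {m : M}
    (hm : m ∈ Submodule.span k (Set.range fun e : ∀ i, Fin (expBound p degx i) =>
      G.monomial x (expWord fun i => (e i : ℕ)) • v)) :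
    G.ι s • m ∈ Submodule.span k (Set.range fun e : ∀ i, Fin (expBound p degx i) =>
      G.monomial x (expWord fun i => (e i : ℕ)) • v) := by
  set N := Submodule.span k (Set.range fun e : ∀ i, Fin (expBound p degx i) =>
      G.monomial x (expWord fun i => (e i : ℕ)) • v) with hN
  let z : α ⊕ₗ β → g := fun i => Sum.elim x y (ofLex i)
  let deg : α ⊕ₗ β → ZMod 2 := fun i => Sum.elim degx degy (ofLex i)
  have hz : ∀ i, z i ∈ G.gr (deg i) := by
    intro i
    rcases i with i | i
    exacts [hx i, hy i]
  have hrange : Set.range z = Set.range x ∪ Set.range y := by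
    rw [← Set.Sum.elim_range]
    exact (ofLex.surjective.range_comp (Sum.elim x y) : _)
  have hzS : S = Submodule.span k (Set.range z) := by rw [hS, hrange]
  have hzm : ∀ i, z i ∈ S := fun i => hzS ▸ Submodule.subset_span ⟨i, rfl⟩
  have hbase : ∀ w : List β, ∃ c : k, G.monomial y w • v = c • v := by
    intro w
    induction w with
    | nil => exact ⟨1, by simp [monomial]⟩
    | cons j w ih =>
      obtain ⟨c, hc⟩ := ih
      obtain ⟨d, hd⟩ := hv j
      exact ⟨c * d, by rw [monomial_cons, mul_smul, hc, smul_comm, hd, mul_smul]⟩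
  have hmap₁ : ∀ w : List α, G.monomial z (w.map (toLex ∘ Sum.inl)) = G.monomial x w := by
    intro w; rw [monomial, List.map_map]; rfl
  have hmap₂ : ∀ w : List β, G.monomial z (w.map (toLex ∘ Sum.inr)) = G.monomial y w := by
    intro w; rw [monomial, List.map_map]; rfl
  have hnormal : ∀ w, IsNormalWord (expBound p deg) w → G.monomial z w • v ∈ N := by
    intro w hw
    obtain ⟨w₁, w₂, rfl, h1, h2⟩ := hw.exists_append (P := fun i => (ofLex i).isLeft) (by
      intro i j hj hij
      rcases i with i | i <;> rcases j with j | j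
      · rfl
      · rfl
      · exact absurd hij (Sum.Lex.not_inr_le_inl)
      · exact hj)
    obtain ⟨w₁, rfl⟩ : ∃ w : List α, w₁ = w.map (toLex ∘ Sum.inl) := by
      refine Set.mem_range.1 ?_ |>.imp fun _ h => h.symm
      rw [Set.range_list_map]
      intro i hi
      have := h1 i hi
      rcases i with i | i
      · exact ⟨i, rfl⟩
      · exact absurd (show false = true from this) (by simp)
    obtain ⟨w₂, rfl⟩ : ∃ w : List β, w₂ = w.map (toLex ∘ Sum.inr) := by
      refine Set.mem_range.1 ?_ |>.imp fun _ h => h.symm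
      rw [Set.range_list_map]
      intro i hi
      have := h2 i hi
      rcases i with i | i
      · exact absurd rfl this
      · exact ⟨i, rfl⟩
    obtain ⟨c, hc⟩ := hbase w₂
    have hw1 : IsNormalWord (expBound p degx) w₁ :=
      (hw.sublist (List.sublist_append_left _ _)).of_map (fun i j h => Sum.Lex.inl_lt_inl_iff.2 h)
    rw [monomial_append, mul_smul, hmap₁, hmap₂, hc, smul_comm]
    refine Submodule.smul_mem _ _ (Submodule.subset_span ⟨fun i => ⟨w₁.count i, hw1.2 i⟩, ?_⟩)
    dsimp only
    rw [← eq_expWord hw1.1]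
  have : Finite (α ⊕ₗ β) := inferInstanceAs (Finite (α ⊕ β))
  have hall := monomial_smul_mem hz (fun i j => hzS ▸ hbr _ (hzm i) _ (hzm j))
    (fun i h => hzS ▸ hpow ⟨z i, h⟩ (hzm i)) hnormal
  induction hm using Submodule.span_induction with
  | mem m hm =>
    obtain ⟨e, rfl⟩ := hm
    dsimp only
    rw [← hmap₁, smul_smul]
    have := monomial_mul_ι_mul_mem (a := []) (c := (expWord fun i => (e i : ℕ)).map
      (toLex ∘ Sum.inl)) (v := v) (N := N) (x := z) (fun l => hall _) (y := s) (hzS ▸ hs)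
    simpa [monomial] using this
  | zero => simp
  | add m n _ _ hm hn => rw [smul_add]; exact add_mem hm hn
  | smul c m _ hm => rw [smul_comm]; exact Submodule.smul_mem _ _ hm

end Spanning
end RestrictedLieSuperalgebra

namespace RestrictedLieSuperalgebra

variable {k : Type u} {p : ℕ} {g : Type v} [Field k] [AddCommGroup g] [Module k g]
  {G : RestrictedLieSuperalgebra k p g} {h : Submodule k g}

/-! ### Restricted representations of a torus -/

/-- A restricted representation of an abelian restricted subalgebra `h` of the even part of `g`:
the operators `ρ x` commute, and `ρ (x^{[p]}) = (ρ x)^p`. -/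
structure IsTorusRep (G : RestrictedLieSuperalgebra k p g) (h : Submodule k g) {V : Type*}
    [AddCommGroup V] [Module k V] (ρ : h →ₗ[k] Module.End k V) : Prop where
  comm : ∀ x y, Commute (ρ x) (ρ y)
  pow : ∀ (x : G.gr 0) (hx : (x : g) ∈ h) (hx' : (G.pmap x : g) ∈ h),
    ρ ⟨_, hx'⟩ = ρ ⟨x, hx⟩ ^ p

/-- The space of vectors of weight `μ` in a representation `ρ` of `h`. -/
def weightSpace {V : Type*} [AddCommGroup V] [Module k V] (ρ : h →ₗ[k] Module.End k V)
    (μ : Module.Dual k h) : Submodule k V :=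
  ⨅ x, (ρ x).eigenspace (μ x)

section

variable {V : Type*} [AddCommGroup V] [Module k V] {ρ : h →ₗ[k] Module.End k V}

theorem mem_weightSpace {μ : Module.Dual k h} {v : V} :
    v ∈ weightSpace ρ μ ↔ ∀ x, ρ x v = μ x • v := by
  simp [weightSpace, Submodule.mem_iInf]

/-- A nonzero simultaneous eigenvector has a linear and restricted eigenvalue. -/
theorem IsTorusRep.exists_weight (hρ : G.IsTorusRep h ρ) {v : V} (hv : v ≠ 0) {χ : h → k}
    (hχ : ∀ x, ρ x v = χ x • v) : ∃ μ : G.Weight h, ∀ x, μ.1 x = χ x := by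
  have inj : ∀ {a b : k}, a • v = b • v → a = b := fun e => smul_left_injective k hv e
  refine ⟨⟨⟨⟨χ, fun x y => inj ?_⟩, fun a x => inj ?_⟩, fun x hx hx' => inj ?_⟩, fun _ => rfl⟩
  · rw [← hχ, map_add, LinearMap.add_apply, hχ, hχ, add_smul]
  · rw [← hχ, map_smul, LinearMap.smul_apply, hχ, smul_smul]
    rfl
  · have e : ∀ n : ℕ, (ρ ⟨x, hx⟩ ^ n) v = χ ⟨x, hx⟩ ^ n • v := by
      intro n
      induction n with
      | zero => simp
      | succ n ih => rw [pow_succ, Module.End.mul_apply, hχ, map_smul, ih, smul_smul, pow_succ,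
          mul_comm]
    change χ _ • v = χ _ ^ p • v
    rw [← hχ, hρ.pow x hx hx', e]

theorem IsTorusRep.iterate (hρ : G.IsTorusRep h ρ) (hT : G.IsTorus h) (x : G.gr 0)
    (hx : (x : g) ∈ h) (i : ℕ) :
    ∃ hi : ((G.pmap^[i] x : G.gr 0) : g) ∈ h, ρ ⟨_, hi⟩ = ρ ⟨x, hx⟩ ^ p ^ i := by
  induction i with
  | zero => exact ⟨hx, by simp⟩
  | succ i ih =>
    obtain ⟨hi, e⟩ := ih
    rw [Function.iterate_succ_apply']
    exact ⟨hT.pmap_mem _ hi, by rw [hρ.pow _ hi, e, pow_succ, pow_mul]⟩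

open Polynomial in
/-- Since `x` is a combination of the `x^{[p]^i}` with `i ≥ 1`, the operator `ρ x` is a root of a
polynomial `X - q` with `q' = 0`, which is separable. -/
theorem IsTorusRep.isSemisimple [Fact p.Prime] [CharP k p] (hρ : G.IsTorusRep h ρ)
    (hT : G.IsTorus h) (x : h) : (ρ x).IsSemisimple := by
  let x' : G.gr 0 := ⟨x, hT.le x.2⟩
  have key : ∀ y ∈ Submodule.span k {y : g | ∃ i : ℕ, 1 ≤ i ∧ y = (G.pmap^[i] x' : G.gr 0)},
      ∃ hy : y ∈ h, ∃ q : k[X], derivative q = 0 ∧ ρ ⟨y, hy⟩ = aeval (ρ x) q := by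
    intro y hy
    induction hy using Submodule.span_induction with
    | mem y hy =>
      obtain ⟨i, hi, rfl⟩ := hy
      obtain ⟨hm, hw⟩ := hρ.iterate hT x' x.2 i
      refine ⟨hm, X ^ p ^ i, ?_, by rw [hw]; simp [x']⟩
      rw [derivative_X_pow, Nat.cast_pow, CharP.cast_eq_zero, zero_pow (by omega)]
      simp
    | zero => exact ⟨h.zero_mem, 0, by simp, by rw [map_zero]; exact map_zero ρ⟩
    | add y z _ _ hy hz =>
      obtain ⟨hy, q, hq, e⟩ := hy
      obtain ⟨hz, q', hq', e'⟩ := hz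
      refine ⟨h.add_mem hy hz, q + q', by simp [hq, hq'], ?_⟩
      rw [map_add, ← e, ← e', ← map_add]
      rfl
    | smul a y _ hy =>
      obtain ⟨hy, q, hq, e⟩ := hy
      refine ⟨h.smul_mem a hy, a • q, by simp [hq], ?_⟩
      rw [map_smul, ← e, ← map_smul]
      rfl
  obtain ⟨_, q, hq, e⟩ := key x (hT.semisimple x' x.2)
  have hsep : (X - q).Separable := by
    rw [separable_def, derivative_sub, hq, derivative_X, sub_zero]
    exact isCoprime_one_right
  refine Module.End.isSemisimple_of_squarefree_aeval_eq_zero hsep.squarefree ?_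
  rw [map_sub, aeval_X, ← e, sub_self]

theorem IsTorusRep.maxGenEigenspace_eq [Fact p.Prime] [CharP k p] [FiniteDimensional k V] (hρ : G.IsTorusRep h ρ)
    (hT : G.IsTorus h) (x : h) (a : k) : (ρ x).maxGenEigenspace a = (ρ x).eigenspace a :=
  ((hρ.isSemisimple hT x).isFinitelySemisimple).maxGenEigenspace_eq_eigenspace a

variable [Fact p.Prime] [CharP k p]

theorem IsTorusRep.iSup_weightSpace [IsAlgClosed k] [FiniteDimensional k V] (hρ : G.IsTorusRep h ρ)
    (hT : G.IsTorus h) : ⨆ μ : G.Weight h, weightSpace ρ μ.1 = ⊤ := by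
  have key := Module.End.iSup_iInf_maxGenEigenspace_eq_top_of_iSup_maxGenEigenspace_eq_top_of_commute
    (fun x => ρ x) (fun x y _ => hρ.comm x y)
    fun x => Module.End.iSup_maxGenEigenspace_eq_top (ρ x)
  rw [eq_top_iff, ← key]
  refine iSup_le fun χ v hv => ?_
  rcases eq_or_ne v 0 with rfl | h0
  · exact zero_mem _
  simp only [hρ.maxGenEigenspace_eq hT, Submodule.mem_iInf, Module.End.mem_eigenspace_iff] at hv
  obtain ⟨μ, hμ⟩ := hρ.exists_weight h0 hv
  exact Submodule.mem_iSup_of_mem μ (mem_weightSpace.2 fun x => by rw [hv, hμ])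

theorem IsTorusRep.iSupIndep_weightSpace [FiniteDimensional k V] (hρ : G.IsTorusRep h ρ)
    (hT : G.IsTorus h) : iSupIndep fun μ : G.Weight h => weightSpace ρ μ.1 := by
  have key := Module.End.independent_iInf_maxGenEigenspace_of_forall_mapsTo (fun x => ρ x)
    fun x y a => Module.End.mapsTo_maxGenEigenspace_of_comm (hρ.comm y x) a
  have inj : Function.Injective fun μ : G.Weight h => (fun x => μ.1 x : h → k) :=
    fun μ ν e => Subtype.ext (LinearMap.ext fun x => congrFun e x)
  have := key.comp inj
  simp only [hρ.maxGenEigenspace_eq hT] at this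
  exact this

/-- An `h`-stable subspace is spanned by weight vectors. -/
theorem IsTorusRep.le_span_weight [IsAlgClosed k] [FiniteDimensional k V] (hρ : G.IsTorusRep h ρ)
    (hT : G.IsTorus h) {U : Submodule k V} (hU : ∀ x, ∀ v ∈ U, ρ x v ∈ U) :
    U ≤ ⨆ μ : G.Weight h, U ⊓ weightSpace ρ μ.1 := by
  let σ : h →ₗ[k] Module.End k U :=
    { toFun := fun x => (ρ x).restrict (hU x)
      map_add' := fun x y => by ext v; simp [LinearMap.restrict_apply]
      map_smul' := fun a x => by ext v; simp [LinearMap.restrict_apply] }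
  have hσv : ∀ x (v : U), (σ x v : V) = ρ x v := fun x v => rfl
  have hσ : G.IsTorusRep h σ := by
    refine ⟨fun x y => ?_, fun x hx hx' => ?_⟩
    · ext v
      have := LinearMap.congr_fun (hρ.comm x y) (v : V)
      simpa [hσv] using this
    · ext v
      rw [hσv, hρ.pow x hx hx']
      change _ = (((LinearMap.restrict (ρ ⟨x, hx⟩) (hU _)) ^ p) v : V)
      rw [Module.End.pow_restrict, LinearMap.coe_restrict_apply]
  intro v hv
  have hmem : (⟨v, hv⟩ : U) ∈ ⨆ μ : G.Weight h, weightSpace σ μ.1 := by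
    rw [hσ.iSup_weightSpace hT]; trivial
  have := Submodule.mem_map_of_mem (f := U.subtype) hmem
  rw [Submodule.map_iSup] at this
  refine (iSup_mono fun μ => ?_ : _ ≤ ⨆ μ : G.Weight h, U ⊓ weightSpace ρ μ.1) this
  rintro _ ⟨w, hw, rfl⟩
  refine ⟨w.2, mem_weightSpace.2 fun x => ?_⟩
  have := congrArg Subtype.val (mem_weightSpace.1 hw x)
  simpa [hσv] using this

/-- A nonzero `h`-stable subspace contains a nonzero weight vector. -/
theorem IsTorusRep.exists_weightVector [IsAlgClosed k] [FiniteDimensional k V] (hρ : G.IsTorusRep h ρ)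
    (hT : G.IsTorus h) {U : Submodule k V} (hU : ∀ x, ∀ v ∈ U, ρ x v ∈ U) (h0 : U ≠ ⊥) :
    ∃ v ∈ U, v ≠ 0 ∧ ∃ μ : G.Weight h, v ∈ weightSpace ρ μ.1 := by
  by_contra! hcon
  refine h0 (eq_bot_iff.2 ((hρ.le_span_weight hT hU).trans (iSup_le fun μ v hv => ?_)))
  by_contra hne
  exact hcon v hv.1 hne μ hv.2

/-- Every vector of an `h`-stable subspace `U` is a sum of weight vectors of `U`. -/
theorem IsTorusRep.exists_sum_weight [IsAlgClosed k] [FiniteDimensional k V] (hρ : G.IsTorusRep h ρ)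
    (hT : G.IsTorus h) [Fintype (G.Weight h)] {U : Submodule k V}
    (hU : ∀ x, ∀ v ∈ U, ρ x v ∈ U) {v : V} (hv : v ∈ U) :
    ∃ w : G.Weight h → V, (∀ μ, w μ ∈ U ∧ w μ ∈ weightSpace ρ μ.1) ∧ ∑ μ, w μ = v := by
  have := hρ.le_span_weight hT hU hv
  obtain ⟨w, hw⟩ := (Submodule.mem_iSup_iff_exists_finsupp _ _).1 this
  refine ⟨w, fun μ => hw.1 μ, ?_⟩
  rw [← hw.2, Finsupp.sum_fintype _ _ fun _ => rfl]

/-- Linearly independent weight vectors in an `h`-stable subspace `U` complete to a basis of `U`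
that consists of weight vectors. -/
theorem IsTorusRep.exists_basis [IsAlgClosed k] [FiniteDimensional k V] (hρ : G.IsTorusRep h ρ)
    (hT : G.IsTorus h) {U : Submodule k V} (hU : ∀ x, ∀ v ∈ U, ρ x v ∈ U) {d : ℕ}
    {v : Fin d → V} (hv : LinearIndependent k v) (hvU : ∀ i, v i ∈ U) {μ : Fin d → G.Weight h}
    (hvμ : ∀ i, v i ∈ weightSpace ρ (μ i).1) :
    ∃ (a : ℕ) (w : Fin a → V) (ν : Fin a → G.Weight h), d + a = Module.finrank k U ∧
      (∀ i, w i ∈ weightSpace ρ (ν i).1) ∧ Submodule.span k (Set.range v ∪ Set.range w) = U := by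
  classical
  let t : Set V := {x | x ∈ U ∧ ∃ ν : G.Weight h, x ∈ weightSpace ρ ν.1}
  have hvt : Set.range v ⊆ t := by
    rintro _ ⟨i, rfl⟩
    exact ⟨hvU i, μ i, hvμ i⟩
  have hli : LinearIndepOn k id (Set.range v) := (linearIndepOn_id_range_iff hv.injective).2 hv
  obtain ⟨B, hBt, hvB, htB, hB⟩ := exists_linearIndepOn_id_extension hli hvt
  have hspan : Submodule.span k B = U := by
    refine le_antisymm (Submodule.span_le.2 fun x hx => (hBt hx).1) ?_
    refine (hρ.le_span_weight hT hU).trans (iSup_le fun ν x hx => htB ⟨hx.1, ν, hx.2⟩)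
  have hfin : B.Finite := hB.linearIndependent.setFinite
  let C : Set V := B \ Set.range v
  have hCfin : C.Finite := hfin.subset Set.sdiff_subset
  have := hCfin.fintype
  have := hfin.fintype
  let e : Fin (Fintype.card C) ≃ C := (Fintype.equivFin C).symm
  have hw : ∀ i, ∃ ν : G.Weight h, (e i : V) ∈ weightSpace ρ ν.1 := fun i => (hBt (e i).2.1).2
  choose ν hν using hw
  refine ⟨Fintype.card C, fun i => e i, ν, ?_, hν, ?_⟩
  · have h1 : (Set.range v).ncard = d := by
      rw [← Set.image_univ, Set.ncard_image_of_injective _ hv.injective, Set.ncard_univ,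
        Nat.card_eq_fintype_card, Fintype.card_fin]
    rw [← hspan, finrank_span_set_eq_card hB.linearIndependent, ← Nat.card_eq_fintype_card,
      Nat.card_coe_set_eq, ← Set.ncard_eq_toFinset_card', ← h1, add_comm]
    exact Set.ncard_sdiff_add_ncard_of_subset hvB hfin
  · rw [← hspan]
    congr 1
    have : Set.range (fun i => (e i : V)) = C := by
      rw [show (fun i => (e i : V)) = Subtype.val ∘ e from rfl, Set.range_comp, e.range_eq_univ,
        Set.image_univ, Subtype.range_coe]
    rw [this, Set.union_sdiff_cancel hvB]

/-- The exchange lemma for weight vectors: a nonzero weight vector in the span of weight vectors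
`w i` can replace some `w j` of the same weight. -/
theorem IsTorusRep.exists_exchange [FiniteDimensional k V] (hρ : G.IsTorusRep h ρ)
    (hT : G.IsTorus h) {J : Type*} [Fintype J] {w : J → V} {ν : J → G.Weight h}
    (hw : ∀ j, w j ∈ weightSpace ρ (ν j).1) {v : V} (h0 : v ≠ 0) {μ : G.Weight h}
    (hv : v ∈ weightSpace ρ μ.1) (hspan : v ∈ Submodule.span k (Set.range w)) :
    ∃ j, ν j = μ ∧ w j ∈ Submodule.span k (insert v (w '' {i | i ≠ j})) := by
  classical
  obtain ⟨c, rfl⟩ := (Submodule.mem_span_range_iff_exists_fun k).1 hspan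
  have hsplit := Finset.sum_filter_add_sum_filter_not Finset.univ (fun j => ν j = μ)
    fun j => c j • w j
  have h1 : ∑ j with ν j = μ, c j • w j ∈ weightSpace ρ μ.1 :=
    Submodule.sum_mem _ fun j hj => Submodule.smul_mem _ _ (by
      rw [← (Finset.mem_filter.1 hj).2]; exact hw j)
  have h2 : ∑ j with ¬ν j = μ, c j • w j = 0 := by
    refine Submodule.disjoint_def.1 (hρ.iSupIndep_weightSpace hT μ) _ ?_ ?_
    · rw [← hsplit] at hv
      exact (Submodule.add_mem_iff_right _ h1).1 hv
    · refine Submodule.sum_mem _ fun j hj => Submodule.smul_mem _ _ ?_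
      exact Submodule.mem_iSup_of_mem (ν j)
        (Submodule.mem_iSup_of_mem (Finset.mem_filter.1 hj).2 (hw j))
  rw [h2, add_zero] at hsplit
  obtain ⟨j, hj, hcj⟩ := Finset.exists_ne_zero_of_sum_ne_zero (hsplit.trans_ne h0)
  refine ⟨j, (Finset.mem_filter.1 hj).2, ?_⟩
  have hc : c j ≠ 0 := fun e => hcj (by rw [e, zero_smul])
  have e : w j = (c j)⁻¹ • (∑ i, c i • w i - ∑ i ∈ Finset.univ.erase j, c i • w i) := by
    rw [← Finset.add_sum_erase _ _ (Finset.mem_univ j), add_sub_cancel_right, smul_smul,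
      inv_mul_cancel₀ hc, one_smul]
  rw [e]
  refine Submodule.smul_mem _ _ (sub_mem (Submodule.subset_span (Set.mem_insert _ _))
    (Submodule.sum_mem _ fun i hi => Submodule.smul_mem _ _ (Submodule.subset_span
      (Set.mem_insert_of_mem _ ⟨i, (Finset.mem_erase.1 hi).1, rfl⟩))))

end

/-- The adjoint representation of a torus on `g`. -/
def adTorus (G : RestrictedLieSuperalgebra k p g) (h : Submodule k g) : h →ₗ[k] Module.End k g :=
  G.br ∘ₗ h.subtype

theorem isTorusRep_ad (hT : G.IsTorus h) : G.IsTorusRep h (G.adTorus h) where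
  comm x y := by
    ext z
    have := G.jacobi z (hT.le x.2) (hT.le y.2)
    rw [hT.abelian x.2 y.2, superSign_zero_left] at this
    simpa [adTorus] using this
  pow x hx hx' := by
    ext z
    exact G.pmap_ad x z

/-- The action of a torus on a `u(g)`-module. -/
noncomputable def envTorus (G : RestrictedLieSuperalgebra k p g) (h : Submodule k g) (M : Type*)
    [AddCommGroup M] [Module k M] [Module G.Env M] [IsScalarTower k G.Env M] :
    h →ₗ[k] Module.End k M :=
  (Algebra.lsmul k k M).toLinearMap ∘ₗ G.ι ∘ₗ h.subtype

section

variable {M : Type*} [AddCommGroup M] [Module k M] [Module G.Env M] [IsScalarTower k G.Env M]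

theorem envTorus_apply (x : h) (m : M) : G.envTorus h M x m = G.ι (x : g) • m := rfl

theorem isTorusRep_env (hT : G.IsTorus h) : G.IsTorusRep h (G.envTorus h M) where
  comm x y := by
    have := G.ι_br (hT.le x.2) (hT.le y.2)
    rw [hT.abelian x.2 y.2, superSign_zero_left, map_zero, add_zero, one_smul] at this
    have hc : Commute (G.ι (x : g)) (G.ι (y : g)) := this
    exact hc.map (Algebra.lsmul k k M)
  pow x hx hx' := by
    change Algebra.lsmul k k M (G.ι _) = Algebra.lsmul k k M (G.ι _) ^ p
    rw [← map_pow]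
    exact congrArg _ (G.ι_pow x).symm

theorem mem_weightSpace_env {μ : Module.Dual k h} {m : M} :
    m ∈ weightSpace (G.envTorus h M) μ ↔ ∀ x : h, G.ι (x : g) • m = μ x • m :=
  mem_weightSpace

/-- Weights add up when a weight vector of `g` acts on a weight vector of a module. -/
theorem ι_smul_mem_weightSpace (hT : G.IsTorus h) {x : g} {j : ZMod 2} (hx : x ∈ G.gr j)
    {ξ : Module.Dual k h} (hξ : x ∈ weightSpace (G.adTorus h) ξ) {μ : Module.Dual k h} {m : M}
    (hm : m ∈ weightSpace (G.envTorus h M) μ) :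
    G.ι x • m ∈ weightSpace (G.envTorus h M) (ξ + μ) := by
  rw [mem_weightSpace_env] at hm ⊢
  intro z
  have h1 := G.ι_br (hT.le z.2) hx
  have h2 : G.br (z : g) x = ξ z • x := mem_weightSpace.1 hξ z
  rw [superSign_zero_left, one_smul, h2, map_smul] at h1
  rw [← mul_smul, h1, add_smul, mul_smul, hm, smul_comm (G.ι x), smul_assoc, LinearMap.add_apply,
    add_smul, add_comm]

end

/-! ### Restricted weights -/

section Weight

variable [Fact p.Prime] [CharP k p]

/-- The group of restricted weights. -/
def weightGroup (G : RestrictedLieSuperalgebra k p g) (h : Submodule k g) :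
    AddSubgroup (Module.Dual k h) where
  carrier := {wt | G.IsRestrictedWeight h wt}
  zero_mem' x hx hx' := by
    simp [zero_pow (Fact.out : p.Prime).ne_zero]
  add_mem' {μ ν} hμ hν x hx hx' := by
    rw [LinearMap.add_apply, LinearMap.add_apply, hμ x hx hx', hν x hx hx', add_pow_char]
  neg_mem' {μ} hμ x hx hx' := by
    have h0 := (add_pow_char (μ ⟨x, hx⟩) (-μ ⟨x, hx⟩) p).symm
    rw [add_neg_cancel, zero_pow (Fact.out : p.Prime).ne_zero] at h0
    rw [LinearMap.neg_apply, LinearMap.neg_apply, hμ x hx hx', neg_eq_of_add_eq_zero_right h0]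

noncomputable instance : AddCommGroup (G.Weight h) :=
  inferInstanceAs (AddCommGroup (G.weightGroup h))

theorem coe_weight_add (μ ν : G.Weight h) : (μ + ν).1 = μ.1 + ν.1 := rfl

theorem coe_weight_sum {ι : Type*} (s : Finset ι) (μ : ι → G.Weight h) :
    (∑ i ∈ s, μ i).1 = ∑ i ∈ s, (μ i).1 :=
  map_sum (G.weightGroup h).subtype μ s

theorem coe_weight_nsmul (n : ℕ) (μ : G.Weight h) : (n • μ).1 = n • μ.1 := rfl

/-- If there are `dim h` linearly independent restricted weights, then the restricted weights are
their `𝔽_p`-combinations. -/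
theorem bijective_sum_weight [IsAlgClosed k] [FiniteDimensional k h]
    {μ : Fin (Module.finrank k h) → G.Weight h} (hT : G.IsTorus h)
    (hμ : LinearIndependent k fun i => (μ i).1) :
    Function.Bijective fun e : Fin (Module.finrank k h) → Fin p => ∑ i, (e i : ℕ) • μ i := by
  constructor
  · intro e e' hee
    have h1 : ∑ i, ((e i : ℕ) : k) • (μ i).1 = ∑ i, ((e' i : ℕ) : k) • (μ i).1 := by
      have := congrArg Subtype.val hee
      simpa [coe_weight_sum, coe_weight_nsmul, ← Nat.cast_smul_eq_nsmul k] using this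
    have h2 := Fintype.linearIndependent_iff.1 hμ (fun i => ((e i : ℕ) : k) - ((e' i : ℕ) : k))
      (by simp [sub_smul, h1])
    funext i
    have h3 : ((e i : ℕ) : k) = ((e' i : ℕ) : k) := sub_eq_zero.1 (h2 i)
    rw [CharP.cast_eq_iff_mod_eq k p, Nat.mod_eq_of_lt (e i).2, Nat.mod_eq_of_lt (e' i).2] at h3
    exact Fin.ext h3
  · intro ν
    have hcard : Fintype.card (Fin (Module.finrank k h)) = Module.finrank k (Module.Dual k h) := by
      rw [Fintype.card_fin, Subspace.dual_finrank_eq]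
    have htop := hμ.span_eq_top_of_card_eq_finrank' hcard
    obtain ⟨c, hc⟩ := (Submodule.mem_span_range_iff_exists_fun k).1
      (htop.ge (Submodule.mem_top (x := ν.1)))
    -- With `d i ^ p = c i - c i ^ p`, the functional `∑ i, d i • μ i` has zero `p`-th power.
    choose d hd using fun i => IsAlgClosed.exists_pow_nat_eq (c i - c i ^ p)
      (Fact.out : p.Prime).pos
    have hd0 : ∑ i, d i • (μ i).1 = 0 := by
      ext x
      let x' : G.gr 0 := ⟨x, hT.le x.2⟩
      have hx' := hT.pmap_mem x' x.2
      have e1 := ν.2 x' x.2 hx'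
      rw [← hc] at e1
      simp only [LinearMap.sum_apply, LinearMap.smul_apply, smul_eq_mul, sum_pow_char] at e1
      rw [LinearMap.zero_apply, ← pow_eq_zero_iff (Fact.out : p.Prime).ne_zero]
      simp only [LinearMap.sum_apply, LinearMap.smul_apply, smul_eq_mul, sum_pow_char, mul_pow, hd,
        sub_mul, Finset.sum_sub_distrib]
      rw [sub_eq_zero]
      simp only [mul_pow] at e1
      rw [← e1]
      exact Finset.sum_congr rfl fun i _ => by rw [(μ i).2 x' x.2 hx']
    have hcp : ∀ i, c i ^ p = c i := fun i => by
      have := Fintype.linearIndependent_iff.1 hμ d hd0 i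
      have h1 := hd i
      rw [this, zero_pow (Fact.out : p.Prime).ne_zero] at h1
      exact (sub_eq_zero.1 h1.symm).symm
    have hn : ∀ i, ∃ n : Fin p, ((n : ℕ) : k) = c i := fun i => by
      obtain ⟨z, hz⟩ := (mem_bot_iff_intCast p k).1 ((Subfield.mem_bot_iff_pow_eq_self k p).2 (hcp i))
      have hp0 : (p : ℤ) ≠ 0 := by exact_mod_cast (Fact.out : p.Prime).ne_zero
      have h0 := Int.emod_nonneg z hp0
      have hlt := Int.emod_lt_of_pos z (b := p) (by omega)
      refine ⟨⟨(z % p).toNat, by omega⟩, ?_⟩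
      have h1 : (((z % p).toNat : ℤ) : k) = (z : k) := by
        rw [Int.toNat_of_nonneg h0, CharP.intCast_eq_intCast k p]
        exact Int.mod_modEq z p
      rw [← hz, ← h1, Int.cast_natCast]
    choose n hn using hn
    refine ⟨n, Subtype.ext ?_⟩
    simp only [coe_weight_sum, coe_weight_nsmul, ← Nat.cast_smul_eq_nsmul k, hn, hc]

end Weight

end RestrictedLieSuperalgebra

namespace RestrictedLieSuperalgebra

variable {k : Type u} {p : ℕ} {g : Type v} [Field k] [AddCommGroup g] [Module k g]
  {G : RestrictedLieSuperalgebra k p g}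

/-! ### Supermodules -/

theorem ZMod.add_add_cancel_two (i d : ZMod 2) : i + d + d = i := by
  revert i d; decide

theorem ZMod.add_one_add_one (i : ZMod 2) : i + 1 + 1 = i := by
  revert i; decide

/-- A subspace stable under the operators `x ∈ g` is stable under `u(g)`. -/
theorem env_smul_mem {M : Type*} [AddCommGroup M] [Module k M] [Module G.Env M]
    [IsScalarTower k G.Env M] {U : Submodule k M} (hU : ∀ x, ∀ m ∈ U, G.ι x • m ∈ U) (a : G.Env) {m : M}
    (hm : m ∈ U) : a • m ∈ U := by
  obtain ⟨t, rfl⟩ : ∃ t, G.envMk t = a := RingQuot.mkAlgHom_surjective k (EnvRel G) a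
  induction t using TensorAlgebra.induction generalizing m with
  | algebraMap r =>
    rw [AlgHom.commutes, algebraMap_smul]
    exact U.smul_mem r hm
  | ι x => exact hU x m hm
  | mul a b ha hb => rw [map_mul, mul_smul]; exact ha (hb hm)
  | add a b ha hb => rw [map_add, add_smul]; exact add_mem (ha hm) (hb hm)

namespace SuperMod

variable (M : G.SuperMod)

instance : Module.Finite G.Env M.carrier := M.finite

theorem finite_base [Module.Finite k G.Env] : Module.Finite k M.carrier :=
  Module.Finite.trans G.Env M.carrier

variable {M}

theorem exists_add (i : ZMod 2) (m : M.carrier) :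
    ∃ x ∈ M.gr i, ∃ y ∈ M.gr (i + 1), x + y = m := by
  obtain ⟨x, hx, y, hy, rfl⟩ :=
    Submodule.mem_sup.1 (M.isCompl.sup_eq_top.ge (Submodule.mem_top (x := m)))
  rcases eq_or_ne i 0 with rfl | hi
  · exact ⟨x, hx, y, hy, rfl⟩
  · obtain rfl : i = 0 + 1 := eq_add_one_of_ne hi
    exact ⟨y, hy, x, hx, add_comm _ _⟩

theorem eq_zero_of_mem {i : ZMod 2} {x : M.carrier} (h0 : x ∈ M.gr i) (h1 : x ∈ M.gr (i + 1)) :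
    x = 0 := by
  rcases eq_or_ne i 0 with rfl | hi
  · exact Submodule.disjoint_def.1 M.isCompl.disjoint x h0 h1
  · obtain rfl : i = 0 + 1 := eq_add_one_of_ne hi
    exact Submodule.disjoint_def.1 M.isCompl.disjoint x h1 h0

theorem left_eq_of_add_eq {i : ZMod 2} {x x' y y' : M.carrier} (hx : x ∈ M.gr i) (hx' : x' ∈ M.gr i)
    (hy : y ∈ M.gr (i + 1)) (hy' : y' ∈ M.gr (i + 1)) (e : x + y = x' + y') : x = x' := by
  have : x - x' = y' - y := by rw [sub_eq_sub_iff_add_eq_add, e, add_comm]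
  exact sub_eq_zero.1 (eq_zero_of_mem (sub_mem hx hx') (this ▸ sub_mem hy' hy))

/-- A subspace is graded if it contains the homogeneous components of its elements. -/
def IsGraded (U : Submodule k M.carrier) : Prop :=
  ∀ (i : ZMod 2) (x y : M.carrier), x ∈ M.gr i → y ∈ M.gr (i + 1) → x + y ∈ U → x ∈ U

theorem IsGraded.right {U : Submodule k M.carrier} (hU : IsGraded U) {i : ZMod 2}
    {x y : M.carrier} (hx : x ∈ M.gr i) (hy : y ∈ M.gr (i + 1)) (h : x + y ∈ U) : y ∈ U :=
  (Submodule.add_mem_iff_right _ (hU i x y hx hy h)).1 h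

theorem isGraded_of_le {U : Submodule k M.carrier}
    (hU : ∀ m ∈ U, ∃ x ∈ M.gr 0, ∃ y ∈ M.gr 1, x ∈ U ∧ y ∈ U ∧ x + y = m) : IsGraded U := by
  intro i x y hx hy hxy
  obtain ⟨x', hx', y', hy', hxU, hyU, e⟩ := hU _ hxy
  rcases eq_or_ne i 0 with rfl | hi
  · rwa [left_eq_of_add_eq hx hx' hy hy' e.symm]
  · obtain rfl : i = 0 + 1 := eq_add_one_of_ne hi
    rw [ZMod.add_one_add_one] at hy
    rwa [left_eq_of_add_eq (i := 0 + 1) hx hy' (by rwa [ZMod.add_one_add_one])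
      (by rwa [ZMod.add_one_add_one]) (e.symm.trans (add_comm _ _))]

theorem isGraded_span {s : Set M.carrier} (hs : ∀ m ∈ s, ∃ i, m ∈ M.gr i) :
    IsGraded (Submodule.span k s) := by
  refine isGraded_of_le fun m hm => ?_
  induction hm using Submodule.span_induction with
  | mem m hm =>
    obtain ⟨i, hi⟩ := hs m hm
    have hmU := Submodule.subset_span (R := k) hm
    rcases eq_or_ne i 0 with rfl | h0
    · exact ⟨m, hi, 0, zero_mem _, hmU, zero_mem _, add_zero m⟩
    · obtain rfl : i = 0 + 1 := eq_add_one_of_ne h0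
      exact ⟨0, zero_mem _, m, hi, zero_mem _, hmU, zero_add m⟩
  | zero => exact ⟨0, zero_mem _, 0, zero_mem _, zero_mem _, zero_mem _, add_zero 0⟩
  | add a b _ _ ha hb =>
    obtain ⟨x, hx, y, hy, hxU, hyU, rfl⟩ := ha
    obtain ⟨x', hx', y', hy', hxU', hyU', rfl⟩ := hb
    exact ⟨_, add_mem hx hx', _, add_mem hy hy', add_mem hxU hxU', add_mem hyU hyU',
      add_add_add_comm _ _ _ _⟩
  | smul c a _ ha =>
    obtain ⟨x, hx, y, hy, hxU, hyU, rfl⟩ := ha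
    exact ⟨_, Submodule.smul_mem _ c hx, _, Submodule.smul_mem _ c hy, Submodule.smul_mem _ c hxU,
      Submodule.smul_mem _ c hyU, (smul_add _ _ _).symm⟩

theorem smul_mem_of_homogeneous {U : Submodule k M.carrier}
    (hU : ∀ i, ∀ x ∈ G.gr i, ∀ m ∈ U, G.ι x • m ∈ U) (x : g) {m : M.carrier} (hm : m ∈ U) :
    G.ι x • m ∈ U := by
  obtain ⟨y, hy, z, hz, rfl⟩ := exists_even_add_odd (G := G) x
  rw [map_add, add_smul]
  exact add_mem (hU 0 y hy m hm) (hU 1 z hz m hm)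

/-- The submodule generated by homogeneous elements is graded. -/
theorem isGraded_env_span {s : Set M.carrier} (hs : ∀ m ∈ s, ∃ i, m ∈ M.gr i) :
    IsGraded ((Submodule.span G.Env s).restrictScalars k) := by
  have hstable : ∀ x, ∀ m ∈ Submodule.span k {m | m ∈ Submodule.span G.Env s ∧ ∃ i, m ∈ M.gr i},
      G.ι x • m ∈ Submodule.span k {m | m ∈ Submodule.span G.Env s ∧ ∃ i, m ∈ M.gr i} := by
    refine fun x m hm => smul_mem_of_homogeneous (fun i y hy m hm => ?_) x hm
    induction hm using Submodule.span_induction with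
    | mem m hm =>
      obtain ⟨hm, j, hj⟩ := hm
      exact Submodule.subset_span ⟨Submodule.smul_mem _ _ hm, _, M.smul_mem hy hj⟩
    | zero => rw [smul_zero]; exact zero_mem _
    | add a b _ _ ha hb => rw [smul_add]; exact add_mem ha hb
    | smul c a _ ha => rw [smul_comm]; exact Submodule.smul_mem _ c ha
  have : (Submodule.span G.Env s).restrictScalars k =
      Submodule.span k {m | m ∈ Submodule.span G.Env s ∧ ∃ i, m ∈ M.gr i} := by
    refine le_antisymm (fun m hm => ?_) (Submodule.span_le.2 fun m hm => hm.1)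
    rw [Submodule.restrictScalars_mem] at hm
    induction hm using Submodule.span_induction with
    | mem m hm => exact Submodule.subset_span ⟨Submodule.subset_span hm, hs m hm⟩
    | zero => exact zero_mem _
    | add a b _ _ ha hb => exact add_mem ha hb
    | smul c a _ ha => exact env_smul_mem hstable c ha
  rw [this]
  exact isGraded_span fun m hm => hm.2

variable {N : G.SuperMod} {d : ZMod 2} {f : M.carrier →ₗ[G.Env] N.carrier}

theorem isGraded_comap (hf : IsHomogeneousMap d f) {U : Submodule G.Env N.carrier}
    (hU : IsGraded (U.restrictScalars k)) : IsGraded ((U.comap f).restrictScalars k) := by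
  intro i x y hx hy hxy
  have hy' := hf _ _ hy
  rw [add_right_comm] at hy'
  refine hU (i + d) (f x) (f y) (hf _ _ hx) hy' ?_
  have : f (x + y) ∈ U := hxy
  rwa [map_add] at this

theorem isGraded_map (hf : IsHomogeneousMap d f) {U : Submodule G.Env M.carrier}
    (hU : IsGraded (U.restrictScalars k)) : IsGraded ((U.map f).restrictScalars k) := by
  intro i x y hx hy hxy
  obtain ⟨m, hm, e⟩ := hxy
  obtain ⟨a, ha, b, hb, rfl⟩ := exists_add (i + d) m
  have ha' := hf _ _ ha
  have hb' := hf _ _ hb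
  rw [ZMod.add_add_cancel_two] at ha'
  rw [add_right_comm, ZMod.add_add_cancel_two] at hb'
  rw [map_add] at e
  rw [← left_eq_of_add_eq ha' hx hb' hy e]
  exact ⟨a, hU _ a b ha hb hm, rfl⟩

theorem isGraded_top : IsGraded (M := M) ((⊤ : Submodule G.Env M.carrier).restrictScalars k) :=
  fun _ _ _ _ _ _ => trivial

theorem isGraded_range (hf : IsHomogeneousMap d f) :
    IsGraded ((LinearMap.range f).restrictScalars k) := by
  rw [LinearMap.range_eq_map]
  exact isGraded_map hf isGraded_top

/-- A graded submodule of a supermodule, as a supermodule. -/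
noncomputable abbrev sub [Module.Finite k G.Env] (M : G.SuperMod) (U : Submodule G.Env M.carrier)
    (hU : IsGraded (U.restrictScalars k)) : G.SuperMod where
  carrier := U
  gr i := (M.gr i).comap (U.subtype.restrictScalars k)
  isCompl := by
    constructor
    · rw [Submodule.disjoint_def]
      exact fun x h0 h1 => Subtype.ext (eq_zero_of_mem (i := 0) h0 h1)
    · rw [codisjoint_iff, eq_top_iff]
      rintro ⟨m, hm⟩ -
      obtain ⟨x, hx, y, hy, rfl⟩ := exists_add 0 m
      exact Submodule.mem_sup.2 ⟨⟨x, hU _ x y hx hy hm⟩, hx, ⟨y, hU.right hx hy hm⟩, hy, rfl⟩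
  smul_mem hx hm := M.smul_mem hx hm
  finite := by
    have := M.finite_base
    have : Module.Finite k U := Module.Finite.of_injective (U.subtype.restrictScalars k)
      U.subtype_injective
    exact Module.Finite.of_restrictScalars_finite k G.Env U

/-- The quotient of a supermodule by a graded submodule. -/
noncomputable abbrev quot (M : G.SuperMod) (U : Submodule G.Env M.carrier)
    (hU : IsGraded (U.restrictScalars k)) : G.SuperMod where
  carrier := M.carrier ⧸ U
  gr i := (M.gr i).map (U.mkQ.restrictScalars k)
  isCompl := by
    constructor
    · rw [Submodule.disjoint_def]
      rintro _ ⟨x, hx, rfl⟩ ⟨y, hy, e⟩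
      have hxy : x + -y ∈ U := by
        rw [← sub_eq_add_neg]
        exact (Submodule.Quotient.eq U).1 e.symm
      exact (Submodule.Quotient.mk_eq_zero U).2 (hU 0 x (-y) hx (neg_mem hy) hxy)
    · rw [codisjoint_iff, eq_top_iff]
      rintro m -
      obtain ⟨m, rfl⟩ := U.mkQ_surjective m
      obtain ⟨x, hx, y, hy, rfl⟩ := exists_add 0 m
      rw [map_add]
      exact Submodule.add_mem_sup ⟨x, hx, rfl⟩ ⟨y, hy, rfl⟩
  smul_mem := by
    rintro i j x _ hx ⟨m, hm, rfl⟩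
    exact ⟨_, M.smul_mem hx hm, map_smul U.mkQ _ _⟩
  finite := inferInstance

theorem isHomogeneousMap_subtype [Module.Finite k G.Env] {U : Submodule G.Env M.carrier}
    (hU : IsGraded (U.restrictScalars k)) :
    IsHomogeneousMap (M := M.sub U hU) (N := M) 0 U.subtype := by
  intro i m hm
  rw [add_zero]
  exact hm

theorem isHomogeneousMap_mkQ {U : Submodule G.Env M.carrier}
    (hU : IsGraded (U.restrictScalars k)) :
    IsHomogeneousMap (M := M) (N := M.quot U hU) 0 U.mkQ := by
  intro i m hm
  rw [add_zero]
  exact ⟨m, hm, rfl⟩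

/-! ### The Grothendieck group -/

/-- A short exact sequence of supermodules, with homogeneous maps. -/
structure ShortExact {M' M M'' : G.SuperMod} (f : M'.carrier →ₗ[G.Env] M.carrier)
    (q : M.carrier →ₗ[G.Env] M''.carrier) : Prop where
  homogeneous_left : ∃ d, IsHomogeneousMap d f
  homogeneous_right : ∃ e, IsHomogeneousMap e q
  injective : Function.Injective f
  exact : Function.Exact f q
  surjective : Function.Surjective q

theorem ShortExact.cls_eq {M' M M'' : G.SuperMod} {f : M'.carrier →ₗ[G.Env] M.carrier}
    {q : M.carrier →ₗ[G.Env] M''.carrier} (hs : ShortExact f q) : M.cls = M'.cls + M''.cls := by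
  obtain ⟨d, hd⟩ := hs.homogeneous_left
  obtain ⟨e, he⟩ := hs.homogeneous_right
  have := (QuotientAddGroup.eq_zero_iff _).2 (AddSubgroup.subset_closure
    ⟨M', M, M'', d, e, f, q, hd, he, hs.injective, hs.exact, hs.surjective, rfl⟩ :
    _ ∈ G.grothendieckRel)
  exact sub_eq_zero.1 this

theorem ShortExact.finrank_eq [Module.Finite k G.Env] {M' M M'' : G.SuperMod}
    {f : M'.carrier →ₗ[G.Env] M.carrier} {q : M.carrier →ₗ[G.Env] M''.carrier}
    (hs : ShortExact f q) : Module.finrank k M.carrier =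
      Module.finrank k M'.carrier + Module.finrank k M''.carrier := by
  have := M.finite_base
  have h1 := LinearMap.finrank_range_add_finrank_ker (q.restrictScalars k)
  have h2 : LinearMap.ker (q.restrictScalars k) = LinearMap.range (f.restrictScalars k) := by
    ext m
    exact hs.exact m
  rw [LinearMap.range_eq_top.2 (show Function.Surjective (q.restrictScalars k) from hs.surjective),
    finrank_top, h2, LinearMap.finrank_range_of_inj
      (show Function.Injective (f.restrictScalars k) from hs.injective)] at h1
  omega

theorem shortExact_sub_quot [Module.Finite k G.Env] {U : Submodule G.Env M.carrier}
    (hU : IsGraded (U.restrictScalars k)) :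
    ShortExact (M' := M.sub U hU) (M'' := M.quot U hU) U.subtype U.mkQ where
  homogeneous_left := ⟨0, isHomogeneousMap_subtype hU⟩
  homogeneous_right := ⟨0, isHomogeneousMap_mkQ hU⟩
  injective := U.subtype_injective
  exact := LinearMap.exact_subtype_mkQ U
  surjective := U.mkQ_surjective

theorem cls_eq_zero [Subsingleton M.carrier] : M.cls = 0 := by
  have hs : ShortExact (M' := M) (M := M) (M'' := M) LinearMap.id LinearMap.id :=
    ⟨⟨0, fun i m hm => by rwa [add_zero]⟩, ⟨0, fun i m hm => by rwa [add_zero]⟩,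
      Function.injective_id, fun m => ⟨fun _ => ⟨m, rfl⟩, fun _ => Subsingleton.elim _ _⟩,
      Function.surjective_id⟩
  simpa using hs.cls_eq

/-- A homogeneous isomorphism `M → N`, seen as a short exact sequence with third term `0`. -/
theorem shortExact_of_bijective (hf : IsHomogeneousMap d f) (hb : Function.Bijective f) :
    ShortExact (M'' := N.quot ⊤ isGraded_top) f (⊤ : Submodule G.Env N.carrier).mkQ where
  homogeneous_left := ⟨d, hf⟩
  homogeneous_right := ⟨0, isHomogeneousMap_mkQ _⟩
  injective := hb.1
  exact m := ⟨fun _ => hb.2 m, fun _ => (Submodule.Quotient.mk_eq_zero _).2 trivial⟩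
  surjective := Submodule.mkQ_surjective _

instance subsingleton_quot_top :
    Subsingleton (N.quot (⊤ : Submodule G.Env N.carrier) isGraded_top).carrier :=
  Submodule.Quotient.subsingleton_iff.2 rfl

theorem cls_eq_of_bijective (hf : IsHomogeneousMap d f) (hb : Function.Bijective f) :
    M.cls = N.cls := by
  rw [(shortExact_of_bijective hf hb).cls_eq, cls_eq_zero (M := N.quot ⊤ isGraded_top), add_zero]

/-! ### Multiplicities of simple supermodules -/

/-- A supermodule is simple if it is nonzero and has no proper nonzero graded submodule. -/
structure IsSimple (S : G.SuperMod) : Prop where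
  nontrivial : Nontrivial S.carrier
  eq_bot_or_eq_top : ∀ U : Submodule G.Env S.carrier, IsGraded (U.restrictScalars k) →
    U = ⊥ ∨ U = ⊤

/-- `S.Occurs M n` means that `M` has a filtration by graded submodules with at least `n` factors
isomorphic to `S` (up to parity). -/
inductive Occurs (S : G.SuperMod) : G.SuperMod → ℕ → Prop
  | zero (M : G.SuperMod) : Occurs S M 0
  | self : Occurs S S 1
  | extension {M' M M'' : G.SuperMod} {f : M'.carrier →ₗ[G.Env] M.carrier}
      {q : M.carrier →ₗ[G.Env] M''.carrier} {a b : ℕ} (hs : ShortExact f q)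
      (ha : Occurs S M' a) (hb : Occurs S M'' b) : Occurs S M (a + b)

theorem Occurs.of_bijective {S : G.SuperMod} {n : ℕ} (hn : S.Occurs M n)
    (hf : IsHomogeneousMap d f) (hb : Function.Bijective f) : S.Occurs N n :=
  Occurs.extension (shortExact_of_bijective hf hb) hn (Occurs.zero _)

/-- The inverse of a homogeneous bijection is homogeneous. -/
theorem isHomogeneousMap_symm (hf : IsHomogeneousMap d f) (hb : Function.Bijective f) :
    IsHomogeneousMap d ((LinearEquiv.ofBijective f hb).symm : N.carrier →ₗ[G.Env] M.carrier) := by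
  intro i n hn
  obtain ⟨m, rfl⟩ := hb.2 n
  have e : (LinearEquiv.ofBijective f hb).symm (f m) = m :=
    (LinearEquiv.ofBijective f hb).symm_apply_apply m
  change (LinearEquiv.ofBijective f hb).symm (f m) ∈ M.gr (i + d)
  rw [e]
  obtain ⟨x, hx, y, hy, rfl⟩ := exists_add (i + d) m
  have hx' := hf _ _ hx
  have hy' := hf _ _ hy
  rw [ZMod.add_add_cancel_two] at hx'
  rw [add_right_comm, ZMod.add_add_cancel_two] at hy'
  rw [map_add] at hn
  have hy0 : f y ∈ N.gr i := (Submodule.add_mem_iff_right _ hx').1 hn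
  have : y = 0 := hb.1 (by rw [map_zero]; exact eq_zero_of_mem hy0 hy')
  rwa [this, add_zero]

theorem Occurs.of_bijective' {S : G.SuperMod} {n : ℕ} (hn : S.Occurs N n)
    (hf : IsHomogeneousMap d f) (hb : Function.Bijective f) : S.Occurs M n :=
  hn.of_bijective (isHomogeneousMap_symm hf hb) (LinearEquiv.ofBijective f hb).symm.bijective

theorem finrank_eq_zero [Subsingleton M.carrier] : Module.finrank k M.carrier = 0 :=
  Module.finrank_zero_of_subsingleton

theorem IsSimple.of_bijective (hM : M.IsSimple) (hf : IsHomogeneousMap d f)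
    (hb : Function.Bijective f) : N.IsSimple where
  nontrivial := by
    have := hM.nontrivial
    exact hb.1.nontrivial
  eq_bot_or_eq_top U hU := by
    rw [← Submodule.map_comap_eq_of_surjective hb.2 U]
    rcases hM.eq_bot_or_eq_top _ (isGraded_comap hf hU) with e | e <;> rw [e]
    · exact Or.inl (Submodule.map_bot _)
    · exact Or.inr (by rw [Submodule.map_top, LinearMap.range_eq_top.2 hb.2])

variable [Module.Finite k G.Env]

/-- The factors of a filtration of `M` are distributed over those of a graded submodule `U` and of
`M / U`. -/
theorem Occurs.exists_add_eq {S : G.SuperMod} (hS : S.IsSimple) {M : G.SuperMod} {n : ℕ}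
    (hn : S.Occurs M n) (U : Submodule G.Env M.carrier) (hU : IsGraded (U.restrictScalars k)) :
    ∃ a b, a + b = n ∧ S.Occurs (M.sub U hU) a ∧ S.Occurs (M.quot U hU) b := by
  induction hn with
  | zero M => exact ⟨0, 0, rfl, .zero _, .zero _⟩
  | self =>
    rcases hS.eq_bot_or_eq_top U hU with rfl | rfl
    · refine ⟨0, 1, rfl, .zero _, Occurs.self.of_bijective (isHomogeneousMap_mkQ hU)
        ⟨?_, Submodule.mkQ_surjective _⟩⟩
      rw [← LinearMap.ker_eq_bot, Submodule.ker_mkQ]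
    · refine ⟨1, 0, rfl, Occurs.self.of_bijective' (isHomogeneousMap_subtype hU)
        ⟨Submodule.subtype_injective _, fun m => ⟨⟨m, trivial⟩, rfl⟩⟩, .zero _⟩
  | @extension M' M M'' f q a b hs ha hb iha ihb =>
    obtain ⟨d, hd⟩ := hs.homogeneous_left
    obtain ⟨e, he⟩ := hs.homogeneous_right
    obtain ⟨a₁, a₂, rfl, h1, h2⟩ := iha (U.comap f) (isGraded_comap hd hU)
    obtain ⟨b₁, b₂, rfl, h3, h4⟩ := ihb (U.map q) (isGraded_map he hU)
    refine ⟨a₁ + b₁, a₂ + b₂, by omega, ?_, ?_⟩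
    · refine Occurs.extension (M' := M'.sub _ (isGraded_comap hd hU)) (M := M.sub U hU)
        (M'' := M''.sub _ (isGraded_map he hU)) (f := f.restrict (p := U.comap f) (q := U) fun x hx => hx)
        (q := q.restrict (p := U) (q := U.map q) fun x hx => ⟨x, hx, rfl⟩)
        ⟨⟨d, fun i m hm => hd i _ hm⟩, ⟨e, fun i m hm => he i _ hm⟩, ?_, ?_, ?_⟩ h1 h3
      · exact fun x y hxy => Subtype.ext (hs.injective (congrArg Subtype.val hxy))
      · intro m
        constructor
        · intro hm
          obtain ⟨x, hx⟩ := (hs.exact m.1).1 (congrArg Subtype.val hm)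
          exact ⟨⟨x, show f x ∈ U by rw [hx]; exact m.2⟩, Subtype.ext hx⟩
        · rintro ⟨x, rfl⟩
          exact Subtype.ext ((hs.exact _).2 ⟨x.1, rfl⟩)
      · rintro ⟨_, m, hm, rfl⟩
        exact ⟨⟨m, hm⟩, rfl⟩
    · refine Occurs.extension (M' := M'.quot _ (isGraded_comap hd hU)) (M := M.quot U hU)
        (M'' := M''.quot _ (isGraded_map he hU)) (f := Submodule.mapQ (U.comap f) U f le_rfl)
        (q := Submodule.mapQ U (U.map q) q (Submodule.le_comap_map _ _))
        ⟨⟨d, ?_⟩, ⟨e, ?_⟩, ?_, ?_, ?_⟩ h2 h4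
      · rintro i _ ⟨m, hm, rfl⟩
        exact ⟨f m, hd i m hm, rfl⟩
      · rintro i _ ⟨m, hm, rfl⟩
        exact ⟨q m, he i m hm, rfl⟩
      · rw [← LinearMap.ker_eq_bot, LinearMap.ker_eq_bot']
        intro x hx
        obtain ⟨x, rfl⟩ := Submodule.mkQ_surjective _ x
        exact (Submodule.Quotient.mk_eq_zero _).2 ((Submodule.Quotient.mk_eq_zero U).1 hx)
      · intro m
        obtain ⟨m, rfl⟩ := Submodule.mkQ_surjective _ m
        constructor
        · intro hm
          obtain ⟨m', hm', e⟩ := (Submodule.Quotient.mk_eq_zero (U.map q)).1 hm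
          obtain ⟨x, hx⟩ := (hs.exact (m - m')).1 (by rw [map_sub, e, sub_self])
          refine ⟨Submodule.Quotient.mk x, ?_⟩
          change Submodule.Quotient.mk (f x) = Submodule.Quotient.mk m
          rw [hx, Submodule.Quotient.eq]
          simpa using hm'
        · rintro ⟨x, hx⟩
          obtain ⟨x, rfl⟩ := Submodule.mkQ_surjective _ x
          have hx : f x - m ∈ U := (Submodule.Quotient.eq U).1 hx
          refine (Submodule.Quotient.mk_eq_zero (U.map q)).2 ⟨-(f x - m), neg_mem hx, ?_⟩
          rw [map_neg, map_sub, (hs.exact _).2 ⟨x, rfl⟩, zero_sub, neg_neg]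
      · intro m
        obtain ⟨m, rfl⟩ := Submodule.mkQ_surjective _ m
        obtain ⟨m, rfl⟩ := hs.surjective m
        exact ⟨Submodule.Quotient.mk m, rfl⟩

theorem Occurs.mul_finrank_le {S M : G.SuperMod} {n : ℕ} (hn : S.Occurs M n) :
    n * Module.finrank k S.carrier ≤ Module.finrank k M.carrier := by
  induction hn with
  | zero M => simp
  | self => simp
  | extension hs _ _ iha ihb => rw [hs.finrank_eq, add_mul]; omega

theorem finrank_pos [Nontrivial M.carrier] : 0 < Module.finrank k M.carrier := by
  have := M.finite_base
  exact Module.finrank_pos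

theorem subsingleton_of_finrank (h0 : Module.finrank k M.carrier = 0) : Subsingleton M.carrier := by
  have := M.finite_base
  exact Module.finrank_zero_iff.1 h0

theorem Occurs.eq_zero {S : G.SuperMod} (hS : S.IsSimple) {n : ℕ} (hn : S.Occurs M n)
    [Subsingleton M.carrier] : n = 0 := by
  have := hS.nontrivial
  have h1 := hn.mul_finrank_le
  have h2 := S.finrank_pos
  rw [finrank_eq_zero (M := M)] at h1
  rcases Nat.eq_zero_or_pos n with h | h
  · exact h
  · have := Nat.mul_pos h h2
    omega

/-- A simple supermodule has no factor isomorphic to `S`, unless its class is that of `S`. -/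
theorem Occurs.eq_zero_or_cls_eq {S : G.SuperMod} (hS : S.IsSimple) {n : ℕ} (hn : S.Occurs M n)
    (hM : M.IsSimple) : n = 0 ∨ M.cls = S.cls := by
  induction hn with
  | zero M => exact Or.inl rfl
  | self => exact Or.inr rfl
  | @extension M' M M'' f q a b hs ha hb iha ihb =>
    obtain ⟨d, hd⟩ := hs.homogeneous_left
    obtain ⟨e, he⟩ := hs.homogeneous_right
    rcases hM.eq_bot_or_eq_top _ (isGraded_range hd) with h0 | h0
    · have hM' : Subsingleton M'.carrier := by
        rw [LinearMap.range_eq_bot] at h0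
        subst h0
        exact ⟨fun x y => hs.injective rfl⟩
      have hq : Function.Bijective q := by
        refine ⟨?_, hs.surjective⟩
        rw [← LinearMap.ker_eq_bot, hs.exact.linearMap_ker_eq, h0]
      have ha0 := ha.eq_zero hS
      rcases ihb (hM.of_bijective he hq) with hb0 | hb0
      · exact Or.inl (by omega)
      · exact Or.inr ((cls_eq_of_bijective he hq).trans hb0)
    · have hM'' : Subsingleton M''.carrier := by
        refine ⟨fun x y => ?_⟩
        obtain ⟨x, rfl⟩ := hs.surjective x
        obtain ⟨y, rfl⟩ := hs.surjective y
        rw [(hs.exact x).2 (LinearMap.range_eq_top.1 h0 x),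
          (hs.exact y).2 (LinearMap.range_eq_top.1 h0 y)]
      have hf : Function.Bijective f := ⟨hs.injective, LinearMap.range_eq_top.1 h0⟩
      have hb0 := hb.eq_zero hS
      have hM' : M'.IsSimple := hM.of_bijective (isHomogeneousMap_symm hd hf)
        (LinearEquiv.ofBijective f hf).symm.bijective
      rcases iha hM' with ha0 | ha0
      · exact Or.inl (by omega)
      · exact Or.inr ((cls_eq_of_bijective hd hf).symm.trans ha0)

/-- The multiplicity of the simple supermodule `S` in `M`. -/
noncomputable def mult (S M : G.SuperMod) : ℕ := sSup {n | S.Occurs M n}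

theorem bddAbove_occurs {S : G.SuperMod} (hS : S.IsSimple) (M : G.SuperMod) :
    BddAbove {n | S.Occurs M n} := by
  have := hS.nontrivial
  refine ⟨Module.finrank k M.carrier, fun n hn => ?_⟩
  exact (Nat.le_mul_of_pos_right n S.finrank_pos).trans (Occurs.mul_finrank_le hn)

theorem occurs_mult {S : G.SuperMod} (hS : S.IsSimple) (M : G.SuperMod) :
    S.Occurs M (S.mult M) :=
  Nat.sSup_mem ⟨0, Occurs.zero M⟩ (bddAbove_occurs hS M)

theorem Occurs.le_mult {S : G.SuperMod} (hS : S.IsSimple) {n : ℕ} (hn : S.Occurs M n) :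
    n ≤ S.mult M :=
  le_csSup (bddAbove_occurs hS M) hn

theorem ShortExact.mult_eq {S : G.SuperMod} (hS : S.IsSimple) {M' M M'' : G.SuperMod}
    {f : M'.carrier →ₗ[G.Env] M.carrier} {q : M.carrier →ₗ[G.Env] M''.carrier}
    (hs : ShortExact f q) : S.mult M = S.mult M' + S.mult M'' := by
  refine le_antisymm ?_
    ((Occurs.extension hs (occurs_mult hS M') (occurs_mult hS M'')).le_mult hS)
  obtain ⟨d, hd⟩ := hs.homogeneous_left
  obtain ⟨e, he⟩ := hs.homogeneous_right
  obtain ⟨a, b, hab, ha, hb⟩ := (occurs_mult hS M).exists_add_eq hS _ (isGraded_range hd)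
  rw [← hab]
  refine add_le_add ?_ ?_
  · exact (ha.of_bijective' (f := f.rangeRestrict) (fun i m hm => hd i m hm)
      ⟨fun x y h => hs.injective (congrArg Subtype.val h), f.surjective_rangeRestrict⟩).le_mult hS
  · have hle : LinearMap.range f ≤ LinearMap.ker q := by
      rw [hs.exact.linearMap_ker_eq]
    refine (hb.of_bijective (d := e) (f := (LinearMap.range f).liftQ q hle) ?_ ⟨?_, ?_⟩).le_mult hS
    · rintro i _ ⟨m, hm, rfl⟩
      exact he i m hm
    · rw [← LinearMap.ker_eq_bot, Submodule.ker_liftQ_eq_bot]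
      rw [hs.exact.linearMap_ker_eq]
    · intro m
      obtain ⟨m, rfl⟩ := hs.surjective m
      exact ⟨Submodule.Quotient.mk m, rfl⟩

/-- The multiplicity of `S`, as a homomorphism from the Grothendieck group to `ℤ`. -/
noncomputable def multHom {S : G.SuperMod} (hS : S.IsSimple) : G.GrothendieckGroup →+ ℤ :=
  QuotientAddGroup.lift _ (FreeAbelianGroup.lift fun M => (S.mult M : ℤ)) (by
    rw [grothendieckRel, AddSubgroup.closure_le]
    rintro _ ⟨M', M, M'', d, e, f, q, hd, he, hf, hfq, hq, rfl⟩
    change FreeAbelianGroup.lift _ _ = 0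
    have hs : ShortExact f q := ⟨⟨d, hd⟩, ⟨e, he⟩, hf, hfq, hq⟩
    rw [map_sub, map_add]
    simp only [FreeAbelianGroup.lift_apply_of]
    rw [hs.mult_eq hS]
    push_cast
    ring)

theorem multHom_cls {S : G.SuperMod} (hS : S.IsSimple) (M : G.SuperMod) :
    multHom hS M.cls = S.mult M := by
  change FreeAbelianGroup.lift (fun M => (S.mult M : ℤ)) (FreeAbelianGroup.of M) = _
  exact FreeAbelianGroup.lift_apply_of _ _

theorem mult_self {S : G.SuperMod} (hS : S.IsSimple) : S.mult S = 1 := by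
  have := hS.nontrivial
  refine le_antisymm ?_ (Occurs.self.le_mult hS)
  have h1 := (occurs_mult hS S).mul_finrank_le
  exact Nat.le_of_mul_le_mul_right (by rwa [one_mul]) S.finrank_pos

theorem mult_eq_zero {S T : G.SuperMod} (hS : S.IsSimple) (hT : T.IsSimple)
    (hST : T.cls ≠ S.cls) : S.mult T = 0 :=
  ((occurs_mult hS T).eq_zero_or_cls_eq hS hT).resolve_right hST

/-- The classes of simple supermodules generate the Grothendieck group. -/
theorem cls_mem_span_simple (M : G.SuperMod) :
    M.cls ∈ Submodule.span ℤ {c | ∃ S : G.SuperMod, S.IsSimple ∧ S.cls = c} := by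
  induction hn : Module.finrank k M.carrier using Nat.strong_induction_on generalizing M with
  | _ n ih =>
    subst hn
    rcases subsingleton_or_nontrivial M.carrier with h0 | h0
    · rw [cls_eq_zero]
      exact zero_mem _
    by_cases hM : M.IsSimple
    · exact Submodule.subset_span ⟨M, hM, rfl⟩
    obtain ⟨U, hU, hbot, htop⟩ : ∃ U : Submodule G.Env M.carrier,
        IsGraded (U.restrictScalars k) ∧ U ≠ ⊥ ∧ U ≠ ⊤ := by
      by_contra! hcon
      exact hM ⟨h0, fun U hU => or_iff_not_imp_left.2 (hcon U hU)⟩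
    have hs := shortExact_sub_quot hU
    have hd := hs.finrank_eq
    have h1 : Nontrivial (M.sub U hU).carrier := (Submodule.nontrivial_iff_ne_bot).2 hbot
    have h2 : Nontrivial (M.quot U hU).carrier := Submodule.Quotient.nontrivial_iff.2 htop
    have h1' := (M.sub U hU).finrank_pos
    have h2' := (M.quot U hU).finrank_pos
    rw [hs.cls_eq]
    exact add_mem (ih _ (by omega) (M.sub U hU) rfl) (ih _ (by omega) (M.quot U hU) rfl)

/-- The Grothendieck group is free on the classes of the simple supermodules (Jordan-Hölder). -/
theorem free_grothendieckGroup : Module.Free ℤ G.GrothendieckGroup := by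
  let s : Set G.GrothendieckGroup := {c | ∃ S : G.SuperMod, S.IsSimple ∧ S.cls = c}
  have hli : LinearIndependent ℤ (Subtype.val : s → G.GrothendieckGroup) := by
    rw [linearIndependent_iff']
    rintro t c h0 ⟨_, S, hS, rfl⟩ hi
    have h1 := congrArg (multHom hS) h0
    rw [map_sum, map_zero, Finset.sum_eq_single ⟨S.cls, S, hS, rfl⟩] at h1
    · rw [map_zsmul, multHom_cls, mult_self hS] at h1
      simpa using h1
    · rintro ⟨_, T, hT, rfl⟩ _ hne
      rw [map_zsmul, multHom_cls, mult_eq_zero hS hT fun e => hne (Subtype.ext e)]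
      simp
    · exact fun hcon => absurd hi hcon
  have hspan : ⊤ ≤ Submodule.span ℤ (Set.range (Subtype.val : s → G.GrothendieckGroup)) := by
    rw [Subtype.range_coe]
    rintro x -
    obtain ⟨x, rfl⟩ := QuotientAddGroup.mk_surjective x
    induction x using FreeAbelianGroup.induction_on with
    | zero => exact zero_mem _
    | of M => exact cls_mem_span_simple M
    | neg M h => exact neg_mem h
    | add x y hx hy => exact add_mem hx hy
  exact Module.Free.of_basis (Module.Basis.mk hli hspan)

theorem nsmul_left_cancel {n : ℕ} (hn : n ≠ 0) {x y : G.GrothendieckGroup} (e : n • x = n • y) :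
    x = y := by
  have := free_grothendieckGroup (G := G)
  have h1 : (n : ℤ) • (x - y) = 0 := by rw [natCast_zsmul, nsmul_sub, e, sub_self]
  have h2 := (smul_eq_zero.1 h1).resolve_left (by exact_mod_cast hn)
  exact sub_eq_zero.1 h2

end SuperMod

end RestrictedLieSuperalgebra

/-! ### Engel's theorem -/

/-- Engel's theorem: if the operators `φ x` are nilpotent and closed under commutators, and `U < W`
are stable subspaces, then some vector of `W` outside `U` is mapped into `U` by all `φ x`. -/
theorem exists_mem_notMem_of_isNilpotent {k N V : Type*} [Field k] [AddCommGroup N] [Module k N]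
    [AddCommGroup V] [Module k V] [FiniteDimensional k V] (φ : N →ₗ[k] Module.End k V)
    (hbr : ∀ x y, ∃ z, φ z = φ x * φ y - φ y * φ x) (hnil : ∀ x, IsNilpotent (φ x))
    {U W : Submodule k V} (hU : ∀ x, ∀ v ∈ U, φ x v ∈ U) (hW : ∀ x, ∀ v ∈ W, φ x v ∈ W)
    (hlt : U < W) : ∃ v ∈ W, v ∉ U ∧ ∀ x, φ x v ∈ U := by
  let U' : Submodule k W := U.comap W.subtype
  have hU' : ∀ x, U' ≤ U'.comap ((φ x).restrict (hW x)) := fun x v hv => hU x v hv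
  let ψ : N →ₗ[k] Module.End k (W ⧸ U') :=
    { toFun := fun x => U'.mapQ U' ((φ x).restrict (hW x)) (hU' x)
      map_add' := fun x y => by
        ext v
        change Submodule.Quotient.mk _ = Submodule.Quotient.mk _
        congr 1
        ext
        simp [LinearMap.restrict_apply]
      map_smul' := fun a x => by
        ext v
        change Submodule.Quotient.mk _ = Submodule.Quotient.mk _
        congr 1
        ext
        simp [LinearMap.restrict_apply] }
  have hψ : ∀ x (v : W), ψ x (Submodule.Quotient.mk v) =
      Submodule.Quotient.mk ⟨φ x v, hW x v v.2⟩ := fun x v => rfl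
  have hψpow : ∀ x (n : ℕ) (v : W), ∃ hv : (φ x ^ n) v ∈ W,
      (ψ x ^ n) (Submodule.Quotient.mk v) = Submodule.Quotient.mk ⟨_, hv⟩ := by
    intro x n v
    induction n with
    | zero => exact ⟨v.2, rfl⟩
    | succ n ih =>
      obtain ⟨hv, e⟩ := ih
      refine ⟨by rw [pow_succ', Module.End.mul_apply]; exact hW x _ hv, ?_⟩
      rw [pow_succ', Module.End.mul_apply, e, hψ]
      congr 2
      rw [pow_succ', Module.End.mul_apply]
  let _ : LieRing (Module.End k (W ⧸ U')) := LieRing.ofAssociativeRing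
  let L : LieSubalgebra k (Module.End k (W ⧸ U')) :=
    { LinearMap.range ψ with
      lie_mem' := by
        rintro _ _ ⟨x, rfl⟩ ⟨y, rfl⟩
        obtain ⟨z, hz⟩ := hbr x y
        refine ⟨z, ?_⟩
        rw [Ring.lie_def]
        refine LinearMap.ext fun v => ?_
        obtain ⟨v, rfl⟩ := Submodule.mkQ_surjective _ v
        change Submodule.Quotient.mk (p := U') _ =
          Submodule.Quotient.mk (p := U') _ - Submodule.Quotient.mk (p := U') _
        rw [← Submodule.Quotient.mk_sub]
        congr 1
        ext
        simp [LinearMap.restrict_apply, hz] }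
  have : Nontrivial (W ⧸ U') := by
    rw [Submodule.Quotient.nontrivial_iff]
    intro htop
    refine hlt.not_ge fun v hv => ?_
    have : (⟨v, hv⟩ : W) ∈ U' := by rw [htop]; trivial
    exact this
  have : LieModule.IsNilpotent L (W ⧸ U') := by
    rw [LieModule.isNilpotent_iff_forall' (R := k)]
    rintro ⟨_, x, rfl⟩
    obtain ⟨n, hn⟩ := hnil x
    refine ⟨n, ?_⟩
    ext v
    change (ψ x ^ n) (Submodule.Quotient.mk v) = 0
    obtain ⟨hv, e⟩ := hψpow x n v
    rw [e, Submodule.Quotient.mk_eq_zero]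
    change (φ x ^ n) v ∈ U
    rw [hn]
    exact zero_mem _
  have := LieModule.nontrivial_max_triv_of_isNilpotent k L (W ⧸ U')
  obtain ⟨⟨w, hw⟩, hw0⟩ := exists_ne (0 : LieModule.maxTrivSubmodule k L (W ⧸ U'))
  obtain ⟨v, rfl⟩ := Submodule.mkQ_surjective _ w
  refine ⟨v, v.2, fun hv => hw0 (Subtype.ext ((Submodule.Quotient.mk_eq_zero U').2 hv)),
    fun x => ?_⟩
  have := (LieModule.mem_maxTrivSubmodule k L (W ⧸ U') _).1 hw ⟨ψ x, x, rfl⟩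
  exact (Submodule.Quotient.mk_eq_zero U').1 this

namespace RestrictedLieSuperalgebra

variable {k : Type u} {p : ℕ} {g : Type v} [Field k] [AddCommGroup g] [Module k g]
  {G : RestrictedLieSuperalgebra k p g} {h : Submodule k g}

/-- A `ℤ/2`-graded subalgebra `n ⊕ o` of `g` that is normalized by `h` and whose even elements are
`p`-nilpotent. -/
structure NilSubalgebra (G : RestrictedLieSuperalgebra k p g) (h : Submodule k g) where
  n : Submodule k g
  o : Submodule k g
  n_le : n ≤ G.gr 0
  o_le : o ≤ G.gr 1
  br_nn : ∀ {x y : g}, x ∈ n → y ∈ n → G.br x y ∈ n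
  br_no : ∀ {x y : g}, x ∈ n → y ∈ o → G.br x y ∈ o
  br_oo : ∀ {x y : g}, x ∈ o → y ∈ o → G.br x y ∈ n
  br_hn : ∀ {x y : g}, x ∈ h → y ∈ n → G.br x y ∈ n
  br_ho : ∀ {x y : g}, x ∈ h → y ∈ o → G.br x y ∈ o
  pNilpotent : G.IsPNilpotent n

theorem ι_pow_iterate (x : G.gr 0) (r : ℕ) :
    G.ι (x : g) ^ p ^ r = G.ι ((G.pmap^[r] x : G.gr 0) : g) := by
  induction r with
  | zero => simp
  | succ r ih => rw [pow_succ, pow_mul, ih, ι_pow, Function.iterate_succ_apply']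

theorem br_pow_iterate (x : G.gr 0) (r : ℕ) :
    G.br (x : g) ^ p ^ r = G.br ((G.pmap^[r] x : G.gr 0) : g) := by
  induction r with
  | zero => simp
  | succ r ih =>
    rw [pow_succ, pow_mul, ih, Function.iterate_succ_apply']
    exact LinearMap.ext fun y => (G.pmap_ad _ y).symm

namespace NilSubalgebra

variable (N : NilSubalgebra G h)

section Kernel

variable {M : Type*} [AddCommGroup M] [Module k M] [Module G.Env M] [IsScalarTower k G.Env M]

/-- The vectors of `P` that are killed by `n` and `o'`. -/
def kernel (P : Submodule k M) (o' : Submodule k g) : Submodule k M where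
  carrier := {m | m ∈ P ∧ (∀ x ∈ N.n, G.ι x • m = 0) ∧ ∀ x ∈ o', G.ι x • m = 0}
  zero_mem' := ⟨zero_mem _, fun x _ => smul_zero _, fun x _ => smul_zero _⟩
  add_mem' {a b} ha hb := ⟨add_mem ha.1 hb.1,
    fun x hx => by rw [smul_add, ha.2.1 x hx, hb.2.1 x hx, add_zero],
    fun x hx => by rw [smul_add, ha.2.2 x hx, hb.2.2 x hx, add_zero]⟩
  smul_mem' c m hm := ⟨Submodule.smul_mem _ c hm.1,
    fun x hx => by rw [smul_comm, hm.2.1 x hx, smul_zero],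
    fun x hx => by rw [smul_comm, hm.2.2 x hx, smul_zero]⟩

theorem kernel_bot_ne_bot [FiniteDimensional k M] [Fact p.Prime] {P : Submodule k M} (hP : P ≠ ⊥)
    (hn : ∀ x ∈ N.n, ∀ m ∈ P, G.ι x • m ∈ P) : N.kernel P ⊥ ≠ ⊥ := by
  let φ : N.n →ₗ[k] Module.End k M := (Algebra.lsmul k k M).toLinearMap ∘ₗ G.ι ∘ₗ N.n.subtype
  have hφ : ∀ (x : N.n), φ x = Algebra.lsmul k k M (G.ι (x : g)) := fun x => rfl
  obtain ⟨v, hv, hv0, hker⟩ := exists_mem_notMem_of_isNilpotent φ (U := ⊥) (W := P)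
    (fun x y => ⟨⟨_, N.br_nn x.2 y.2⟩, by
      have := G.ι_br (N.n_le x.2) (N.n_le y.2)
      rw [superSign_zero_left, one_smul] at this
      rw [hφ, hφ, hφ, ← map_mul (Algebra.lsmul k k M), ← map_mul (Algebra.lsmul k k M), this,
        map_add, add_sub_cancel_left]⟩)
    (fun x => by
      obtain ⟨r, hr⟩ := N.pNilpotent ⟨x, N.n_le x.2⟩ x.2
      refine ⟨p ^ r, ?_⟩
      have := ι_pow_iterate (G := G) ⟨x, N.n_le x.2⟩ r
      rw [hr] at this
      rw [hφ, ← map_pow, this]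
      simp)
    (fun x v hv => by rw [(Submodule.mem_bot k).1 hv, map_zero]; exact zero_mem _)
    (fun x v hv => hn x x.2 v hv) (bot_lt_iff_ne_bot.2 hP)
  refine (Submodule.ne_bot_iff _).2 ⟨v, ⟨hv, fun x hx => (Submodule.mem_bot k).1 (hker ⟨x, hx⟩),
    fun x hx => ?_⟩, fun h0 => hv0 ((Submodule.mem_bot k).2 h0)⟩
  rw [(Submodule.mem_bot k).1 hx, map_zero, zero_smul]

theorem ι_smul_mem_kernel {P : Submodule k M} {o' : Submodule k g} (ho' : o' ≤ N.o) {x : g}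
    (hx : x ∈ N.o) (hbr : ∀ y ∈ N.n, G.br y x ∈ o') (hP : ∀ m ∈ P, G.ι x • m ∈ P) {m : M}
    (hm : m ∈ N.kernel P o') : G.ι x • m ∈ N.kernel P o' := by
  obtain ⟨hmP, hmn, hmo⟩ := hm
  refine ⟨hP m hmP, fun y hy => ?_, fun y hy => ?_⟩
  · rw [← mul_smul, G.ι_br (N.n_le hy) (N.o_le hx), superSign_zero_left, one_smul, add_smul,
      mul_smul, hmn y hy, smul_zero, zero_add, hmo _ (hbr y hy)]
  · rw [← mul_smul, G.ι_br (N.o_le (ho' hy)) (N.o_le hx), add_smul, smul_assoc, mul_smul, hmo y hy,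
      smul_zero, smul_zero, zero_add, hmn _ (N.br_oo (ho' hy) hx)]

theorem ι_smul_ι_smul {P : Submodule k M} {o' : Submodule k g} {x : g} (hx : x ∈ N.o) {m : M}
    (hm : m ∈ N.kernel P o') : G.ι x • G.ι x • m = 0 := by
  have h1 := G.ι_br (N.o_le hx) (N.o_le hx)
  have h2 : (2 : k) • (G.ι x * G.ι x) = G.ι (G.br x x) := by
    have : superSign 1 1 = -1 := by decide
    rw [this, neg_one_smul] at h1
    rw [two_smul]
    nth_rewrite 1 [h1]
    abel
  have h3 : (2 : k) • (G.ι x • G.ι x • m) = 0 := by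
    rw [← mul_smul, ← smul_assoc, h2, hm.2.1 _ (N.br_oo hx hx)]
  exact (smul_eq_zero.1 h3).resolve_left G.two_ne_zero

/-- A nonzero subspace of a module that is stable under `n` and `o` contains a nonzero vector killed
by both. For `n` this is Engel's theorem; the odd elements are added one by one. -/
theorem kernel_ne_bot [FiniteDimensional k g] [FiniteDimensional k M] [Fact p.Prime]
    {P : Submodule k M} (hP : P ≠ ⊥) (hn : ∀ x ∈ N.n, ∀ m ∈ P, G.ι x • m ∈ P)
    (ho : ∀ x ∈ N.o, ∀ m ∈ P, G.ι x • m ∈ P) : N.kernel P N.o ≠ ⊥ := by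
  let T : Set (Submodule k g) := {o' | o' ≤ N.o ∧ (∀ x ∈ N.n, ∀ y ∈ o', G.br x y ∈ o') ∧
    N.kernel P o' ≠ ⊥}
  have hT : T.Nonempty := ⟨⊥, bot_le, fun x _ y hy => by
    rw [(Submodule.mem_bot k).1 hy, map_zero]
    exact zero_mem _, N.kernel_bot_ne_bot hP hn⟩
  obtain ⟨o', ⟨hle, hst, hker⟩, hmax⟩ := set_has_maximal_iff_noetherian.2
    (inferInstance : IsNoetherian k g) T hT
  rcases hle.eq_or_lt with rfl | hlt
  · exact hker
  exfalso
  obtain ⟨x, hx, hxo', hbr⟩ := exists_mem_notMem_of_isNilpotent (G.br ∘ₗ N.n.subtype) (U := o')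
    (W := N.o) (fun x y => ⟨⟨_, N.br_nn x.2 y.2⟩, by
      ext z
      have := G.jacobi z (N.n_le x.2) (N.n_le y.2)
      rw [superSign_zero_left, one_smul] at this
      simp [this]⟩)
    (fun x => by
      obtain ⟨r, hr⟩ := N.pNilpotent ⟨x, N.n_le x.2⟩ x.2
      refine ⟨p ^ r, ?_⟩
      have := br_pow_iterate (G := G) ⟨x, N.n_le x.2⟩ r
      rw [hr] at this
      simpa using this)
    (fun x y hy => hst x x.2 y hy) (fun x y hy => N.br_no x.2 hy) hlt
  have hbr : ∀ y ∈ N.n, G.br y x ∈ o' := fun y hy => hbr ⟨y, hy⟩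
  have hlt' : o' < o' ⊔ Submodule.span k {x} := by
    refine lt_of_le_of_ne le_sup_left fun e => hxo' ?_
    rw [e]
    exact Submodule.mem_sup_right (Submodule.mem_span_singleton_self x)
  refine hmax (o' ⊔ Submodule.span k {x}) ⟨?_, ?_, ?_⟩ hlt'
  · exact sup_le hle ((Submodule.span_singleton_le_iff_mem _ _).2 hx)
  · intro y hy z hz
    obtain ⟨a, ha, b, hb, rfl⟩ := Submodule.mem_sup.1 hz
    obtain ⟨c, rfl⟩ := Submodule.mem_span_singleton.1 hb
    rw [map_add, map_smul]
    exact Submodule.mem_sup_left (add_mem (hst y hy a ha) (Submodule.smul_mem _ c (hbr y hy)))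
  · -- As `x` squares to zero on the kernel, it kills `w` or `x w`, for any `w` in the kernel.
    obtain ⟨w, hw, hw0⟩ := (Submodule.ne_bot_iff _).1 hker
    obtain ⟨w', hw', hw0', hxw⟩ : ∃ w' ∈ N.kernel P o', w' ≠ 0 ∧ G.ι x • w' = 0 := by
      by_cases hxw : G.ι x • w = 0
      · exact ⟨w, hw, hw0, hxw⟩
      · exact ⟨G.ι x • w, N.ι_smul_mem_kernel hle hx hbr (ho x hx) hw, hxw, N.ι_smul_ι_smul hx hw⟩
    refine (Submodule.ne_bot_iff _).2 ⟨w', ⟨hw'.1, hw'.2.1, fun z hz => ?_⟩, hw0'⟩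
    obtain ⟨a, ha, b, hb, rfl⟩ := Submodule.mem_sup.1 hz
    obtain ⟨c, rfl⟩ := Submodule.mem_span_singleton.1 hb
    rw [map_add, map_smul, add_smul, hw'.2.2 a ha, smul_assoc, hxw, smul_zero, add_zero]

end Kernel

/-- A nonzero graded subspace of a supermodule that is stable under `n`, `o` and `h` contains a
homogeneous weight vector that is killed by `n` and `o`. -/
theorem exists_singular [IsAlgClosed k] [FiniteDimensional k g] [Module.Finite k G.Env]
    [Fact p.Prime] [CharP k p] (hT : G.IsTorus h) {M : G.SuperMod} {P : Submodule k M.carrier}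
    (hP : P ≠ ⊥) (hgr : SuperMod.IsGraded P) (hn : ∀ x ∈ N.n, ∀ m ∈ P, G.ι x • m ∈ P)
    (ho : ∀ x ∈ N.o, ∀ m ∈ P, G.ι x • m ∈ P) (hh : ∀ x ∈ h, ∀ m ∈ P, G.ι x • m ∈ P) :
    ∃ v ∈ P, v ≠ 0 ∧ (∃ i, v ∈ M.gr i) ∧ (∀ x ∈ N.n, G.ι x • v = 0) ∧
      (∀ x ∈ N.o, G.ι x • v = 0) ∧
      ∃ μ : G.Weight h, v ∈ weightSpace (G.envTorus h M.carrier) μ.1 := by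
  have := M.finite_base
  obtain ⟨w, hw, hw0⟩ := (Submodule.ne_bot_iff _).1 (N.kernel_ne_bot hP hn ho)
  have hKgr : SuperMod.IsGraded (N.kernel P N.o) := by
    rintro i a b ha hb ⟨hab, habn, habo⟩
    refine ⟨hgr i a b ha hb hab, fun x hx => ?_, fun x hx => ?_⟩
    · have e := habn x hx
      rw [smul_add] at e
      have h1 := M.smul_mem (N.n_le hx) ha
      have h2 := M.smul_mem (N.n_le hx) hb
      rw [← add_assoc] at h2
      exact SuperMod.left_eq_of_add_eq h1 (zero_mem _) h2 (zero_mem _) (e.trans (add_zero 0).symm)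
    · have e := habo x hx
      rw [smul_add] at e
      have h1 := M.smul_mem (N.o_le hx) ha
      have h2 := M.smul_mem (N.o_le hx) hb
      rw [← add_assoc] at h2
      exact SuperMod.left_eq_of_add_eq h1 (zero_mem _) h2 (zero_mem _) (e.trans (add_zero 0).symm)
  obtain ⟨i, w', hw', hwi, hw0'⟩ : ∃ i, ∃ w' ∈ N.kernel P N.o, w' ∈ M.gr i ∧ w' ≠ 0 := by
    obtain ⟨a, ha, b, hb, rfl⟩ := SuperMod.exists_add 0 w
    by_cases ha0 : a = 0
    · exact ⟨_, b, hKgr.right ha hb hw, hb, fun hb0 => hw0 (by rw [ha0, hb0, add_zero])⟩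
    · exact ⟨0, a, hKgr _ _ _ ha hb hw, ha, ha0⟩
  have hK : N.kernel P N.o ⊓ M.gr i ≠ ⊥ := (Submodule.ne_bot_iff _).2 ⟨w', ⟨hw', hwi⟩, hw0'⟩
  obtain ⟨v, hv, hv0, hμ⟩ := (isTorusRep_env (M := M.carrier) hT).exists_weightVector hT
    (U := N.kernel P N.o ⊓ M.gr i) (fun x m hm => by
      rw [envTorus_apply]
      refine ⟨⟨hh x x.2 m hm.1.1, fun y hy => ?_, fun y hy => ?_⟩, ?_⟩
      · rw [← mul_smul, G.ι_br (N.n_le hy) (hT.le x.2), add_smul, smul_assoc, mul_smul,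
          hm.1.2.1 y hy, smul_zero, smul_zero, zero_add, G.br_anti (hT.le x.2) (N.n_le hy),
          map_neg, neg_smul, hm.1.2.1 _ (N.br_hn x.2 hy), neg_zero]
      · rw [← mul_smul, G.ι_br (N.o_le hy) (hT.le x.2), add_smul, smul_assoc, mul_smul,
          hm.1.2.2 y hy, smul_zero, smul_zero, zero_add, G.br_anti (hT.le x.2) (N.o_le hy),
          map_neg, neg_smul, hm.1.2.2 _ (N.br_ho x.2 hy), neg_zero]
      · have := M.smul_mem (hT.le x.2) hm.2
        rwa [zero_add] at this) hK
  exact ⟨v, hv.1.1, hv0, ⟨i, hv.2⟩, hv.1.2.1, hv.1.2.2, hμ⟩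

end NilSubalgebra

/-! ### Modules induced from a character of `n ⊕ o ⊕ h` -/

theorem envGr_isCompl (G : RestrictedLieSuperalgebra k p g) :
    IsCompl (G.envGr 0) (G.envGr 1) := by
  have h2 := G.two_ne_zero
  constructor
  · rw [Submodule.disjoint_def]
    intro a h0 h1
    have e := (G.mem_envGr.1 h0).symm.trans (G.mem_envGr.1 h1)
    simp only [ZMod.val_zero, pow_zero, one_smul, ZMod.val_one, pow_one, neg_smul] at e
    have : (2 : k) • a = 0 := by rw [two_smul]; nth_rewrite 1 [e]; simp
    exact (smul_eq_zero.1 this).resolve_left h2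
  · rw [codisjoint_iff, eq_top_iff]
    rintro a -
    refine Submodule.mem_sup.2 ⟨(2 : k)⁻¹ • (a + G.envParity a), Submodule.smul_mem _ _
      (G.mem_envGr.2 ?_), (2 : k)⁻¹ • (a - G.envParity a), Submodule.smul_mem _ _
      (G.mem_envGr.2 ?_), ?_⟩
    · simp [envParity_envParity, add_comm]
    · simp [envParity_envParity, ZMod.val_one]
    · rw [← smul_add, show a + G.envParity a + (a - G.envParity a) = (2 : k) • a by
        rw [two_smul]; abel, smul_smul, inv_mul_cancel₀ h2, one_smul]

/-- The regular supermodule. -/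
noncomputable abbrev regular (G : RestrictedLieSuperalgebra k p g) : G.SuperMod where
  carrier := G.Env
  gr := G.envGr
  isCompl := G.envGr_isCompl
  smul_mem hx ha := G.ι_mul_mem hx ha
  finite := inferInstance

theorem one_mem_envGr (G : RestrictedLieSuperalgebra k p g) : (1 : G.Env) ∈ G.envGr 0 := by
  simp [mem_envGr]

theorem ι_mem_envGr (G : RestrictedLieSuperalgebra k p g) {i : ZMod 2} {x : g}
    (hx : x ∈ G.gr i) : G.ι x ∈ G.envGr i := by
  rw [mem_envGr, envParity_ι, G.parity_of_mem hx, map_smul]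

/-- The grading of a supermodule is compatible with that of `u(g)`. -/
theorem SuperMod.env_smul_mem_gr (M : G.SuperMod) {i j : ZMod 2} {a : G.Env} {m : M.carrier}
    (ha : a ∈ G.envGr i) (hm : m ∈ M.gr j) : a • m ∈ M.gr (i + j) := by
  let A : ZMod 2 → Submodule k G.Env := fun i =>
    { carrier := {a | a ∈ G.envGr i ∧ a • m ∈ M.gr (i + j)}
      zero_mem' := ⟨zero_mem _, by rw [zero_smul]; exact zero_mem _⟩
      add_mem' := fun ha hb => ⟨add_mem ha.1 hb.1, by rw [add_smul]; exact add_mem ha.2 hb.2⟩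
      smul_mem' := fun c a ha => ⟨Submodule.smul_mem _ c ha.1, by
        rw [smul_assoc]; exact Submodule.smul_mem _ c ha.2⟩ }
  have hA : ∀ i l x b, x ∈ G.gr l → b ∈ A i → G.ι x • b ∈ A (l + i) := fun i l x b hx hb =>
    ⟨G.ι_mul_mem hx hb.1, by rw [smul_assoc, add_assoc]; exact M.smul_mem hx hb.2⟩
  have hle : ∀ l, A l ≤ A 0 ⊔ A 1 := fun l => by
    rcases eq_or_ne l 0 with rfl | hl
    · exact le_sup_left
    · obtain rfl : l = 0 + 1 := eq_add_one_of_ne hl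
      exact le_sup_right
  have htop : a ∈ A 0 ⊔ A 1 := by
    have := env_smul_mem (U := A 0 ⊔ A 1) (fun x b hb => ?_) a (m := 1)
      (Submodule.mem_sup_left ⟨G.one_mem_envGr, by rwa [one_smul, zero_add]⟩)
    · rwa [smul_eq_mul, mul_one] at this
    · refine SuperMod.smul_mem_of_homogeneous (M := G.regular) (fun l x hx b hb => ?_) x hb
      obtain ⟨b₀, hb₀, b₁, hb₁, rfl⟩ := Submodule.mem_sup.1 hb
      rw [smul_add]
      exact add_mem (hle _ (hA _ _ _ _ hx hb₀)) (hle _ (hA _ _ _ _ hx hb₁))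
  obtain ⟨b₀, hb₀, b₁, hb₁, rfl⟩ := Submodule.mem_sup.1 htop
  rcases eq_or_ne i 0 with rfl | hi
  · have h1 : b₁ ∈ G.envGr 0 := (Submodule.add_mem_iff_right _ hb₀.1).1 ha
    rw [SuperMod.eq_zero_of_mem (M := G.regular) (i := 0) h1 hb₁.1, add_zero]
    exact hb₀.2
  · obtain rfl : i = 0 + 1 := eq_add_one_of_ne hi
    have h1 : b₀ ∈ G.envGr 1 := (Submodule.add_mem_iff_left _ hb₁.1).1 ha
    have h0 : b₀ = 0 := SuperMod.eq_zero_of_mem (M := G.regular) (i := 0) hb₀.1 h1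
    have h2 : b₁ • m ∈ M.gr (0 + 1 + j) := hb₁.2
    rwa [← zero_add b₁, ← h0] at h2

namespace NilSubalgebra

variable (N : NilSubalgebra G h)

/-- The generators of the left ideal that annihilates a vector of weight `μ` killed by `n ⊕ o`. -/
def relations (μ : Module.Dual k h) : Set G.Env :=
  {a | (∃ x ∈ N.n, a = G.ι x) ∨ (∃ x ∈ N.o, a = G.ι x) ∨
    ∃ x : h, a = G.ι (x : g) - algebraMap k G.Env (μ x)}

/-- The left ideal generated by `n`, `o` and the `x - μ x` for `x ∈ h`. -/
noncomputable def ideal (μ : Module.Dual k h) : Submodule G.Env G.Env := Submodule.span G.Env (N.relations μ)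

theorem isGraded_ideal (hT : G.IsTorus h) (μ : Module.Dual k h) :
    SuperMod.IsGraded (M := G.regular) ((N.ideal μ).restrictScalars k) := by
  refine SuperMod.isGraded_env_span (M := G.regular) ?_
  rintro _ (⟨x, hx, rfl⟩ | ⟨x, hx, rfl⟩ | ⟨x, rfl⟩)
  · exact ⟨0, G.ι_mem_envGr (N.n_le hx)⟩
  · exact ⟨1, G.ι_mem_envGr (N.o_le hx)⟩
  · refine ⟨0, sub_mem (G.ι_mem_envGr (hT.le x.2)) ?_⟩
    rw [Algebra.algebraMap_eq_smul_one]
    exact Submodule.smul_mem _ _ G.one_mem_envGr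

/-- The supermodule generated by a vector of weight `μ` that is killed by `n` and `o`, subject to
no further relations. -/
noncomputable abbrev induced (hT : G.IsTorus h) (μ : Module.Dual k h) : G.SuperMod :=
  G.regular.quot (N.ideal μ) (N.isGraded_ideal hT μ)

variable {N}

/-- The universal property of the induced module. -/
theorem ideal_le_ker {M : Type*} [AddCommGroup M] [Module k M] [Module G.Env M]
    [IsScalarTower k G.Env M] {μ : Module.Dual k h} {v : M} (hn : ∀ x ∈ N.n, G.ι x • v = 0)
    (ho : ∀ x ∈ N.o, G.ι x • v = 0) (hv : v ∈ weightSpace (G.envTorus h M) μ) :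
    N.ideal μ ≤ LinearMap.ker (LinearMap.toSpanSingleton G.Env M v) := by
  refine Submodule.span_le.2 ?_
  rintro _ (⟨x, hx, rfl⟩ | ⟨x, hx, rfl⟩ | ⟨x, rfl⟩)
  · exact hn x hx
  · exact ho x hx
  · change (G.ι (x : g) - algebraMap k G.Env (μ x)) • v = 0
    rw [sub_smul, mem_weightSpace_env.1 hv x, algebraMap_smul, sub_self]

theorem exists_map_induced (hT : G.IsTorus h) {M : G.SuperMod} {μ : Module.Dual k h}
    {v : M.carrier} {i : ZMod 2} (hi : v ∈ M.gr i) (hn : ∀ x ∈ N.n, G.ι x • v = 0)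
    (ho : ∀ x ∈ N.o, G.ι x • v = 0) (hv : v ∈ weightSpace (G.envTorus h M.carrier) μ) :
    ∃ f : (N.induced hT μ).carrier →ₗ[G.Env] M.carrier, IsHomogeneousMap i f ∧
      ∀ a : G.Env, f (Submodule.Quotient.mk a) = a • v := by
  refine ⟨(N.ideal μ).liftQ _ (ideal_le_ker hn ho hv), ?_, fun a => rfl⟩
  rintro j _ ⟨a, ha, rfl⟩
  exact M.env_smul_mem_gr ha hi

end NilSubalgebra

end RestrictedLieSuperalgebra

namespace RestrictedLieSuperalgebra

variable {k : Type u} {p : ℕ} {g : Type v} [Field k] [AddCommGroup g] [Module k g]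
  {G : RestrictedLieSuperalgebra k p g} {h : Submodule k g}

/-! ### Filtrations by quotients of induced modules -/

theorem SuperMod.isGraded_map_mkQ {M : G.SuperMod} {U : Submodule G.Env M.carrier}
    (hU : SuperMod.IsGraded (U.restrictScalars k)) {P : Submodule k M.carrier}
    (hP : SuperMod.IsGraded P) :
    SuperMod.IsGraded (M := M.quot U hU) (P.map (U.mkQ.restrictScalars k)) := by
  refine SuperMod.isGraded_of_le (M := M.quot U hU) ?_
  rintro _ ⟨m, hm, rfl⟩
  obtain ⟨x, hx, y, hy, rfl⟩ := SuperMod.exists_add 0 m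
  exact ⟨_, ⟨x, hx, rfl⟩, _, ⟨y, hy, rfl⟩, ⟨x, hP _ x y hx hy hm, rfl⟩,
    ⟨y, hP.right hx hy hm, rfl⟩, (map_add _ _ _).symm⟩

theorem SuperMod.mkQ_mem_weightSpace {M : G.SuperMod} {U : Submodule G.Env M.carrier}
    {μ : Module.Dual k h} {m : M.carrier} (hm : m ∈ weightSpace (G.envTorus h M.carrier) μ) :
    U.mkQ m ∈ weightSpace (G.envTorus h (M.carrier ⧸ U)) μ := by
  rw [mem_weightSpace_env] at hm ⊢
  intro x
  rw [← map_smul, hm x]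
  rfl

namespace NilSubalgebra

variable (N : NilSubalgebra G h)

/-- Let `M` be generated by a graded subspace `P` that is stable under `n` and `o` and spanned by
finitely many weight vectors `w j` of weights `ν j`. Then `M` has a filtration whose factors are
quotients of the modules induced from the `ν j`. In particular the dimension of `M` is at most the
sum of those of the induced modules; in case of equality, the same holds for the classes.

The filtration is built from below: `P` contains a homogeneous weight vector `v` killed by `n ⊕ o`,
which can replace some `w j`, and `u(g) v` is a quotient of the module induced from `ν j`. -/
theorem finrank_le_and_cls_eq_fin [IsAlgClosed k] [FiniteDimensional k g] [Module.Finite k G.Env]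
    [Fact p.Prime] [CharP k p] (hT : G.IsTorus h) (n : ℕ) (M : G.SuperMod)
    (w : Fin n → M.carrier) (ν : Fin n → G.Weight h)
    (hw : ∀ j, w j ∈ weightSpace (G.envTorus h M.carrier) (ν j).1)
    (hgr : SuperMod.IsGraded (Submodule.span k (Set.range w)))
    (hn : ∀ x ∈ N.n, ∀ m ∈ Submodule.span k (Set.range w),
      G.ι x • m ∈ Submodule.span k (Set.range w))
    (ho : ∀ x ∈ N.o, ∀ m ∈ Submodule.span k (Set.range w),
      G.ι x • m ∈ Submodule.span k (Set.range w))
    (hgen : Submodule.span G.Env (Set.range w) = ⊤) :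
    Module.finrank k M.carrier ≤ ∑ j, Module.finrank k (N.induced hT (ν j).1).carrier ∧
      (Module.finrank k M.carrier = ∑ j, Module.finrank k (N.induced hT (ν j).1).carrier →
        M.cls = ∑ j, (N.induced hT (ν j).1).cls) := by
  induction n generalizing M with
  | zero =>
    have : Subsingleton M.carrier := by
      rw [Set.range_eq_empty, Submodule.span_empty] at hgen
      exact (Submodule.subsingleton_iff G.Env).1 (subsingleton_of_bot_eq_top hgen)
    exact ⟨by rw [SuperMod.finrank_eq_zero]; exact Nat.zero_le _,
      fun _ => by rw [SuperMod.cls_eq_zero, Fin.sum_univ_zero]⟩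
  | succ n ih =>
    rcases eq_or_ne (Submodule.span k (Set.range w)) ⊥ with hP | hP
    · have : Subsingleton M.carrier := by
        refine (Submodule.subsingleton_iff G.Env).1 (subsingleton_of_bot_eq_top ?_)
        rw [← hgen, eq_comm, Submodule.span_eq_bot]
        exact Submodule.span_eq_bot.1 hP
      refine ⟨by rw [SuperMod.finrank_eq_zero]; exact Nat.zero_le _, fun e => ?_⟩
      rw [SuperMod.finrank_eq_zero, eq_comm, Finset.sum_eq_zero_iff] at e
      rw [SuperMod.cls_eq_zero, Finset.sum_eq_zero]
      intro j hj
      have := SuperMod.subsingleton_of_finrank (e j hj)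
      exact SuperMod.cls_eq_zero
    have := M.finite_base
    have hh : ∀ x ∈ h, ∀ m ∈ Submodule.span k (Set.range w),
        G.ι x • m ∈ Submodule.span k (Set.range w) := by
      intro x hx m hm
      induction hm using Submodule.span_induction with
      | mem m hm =>
        obtain ⟨j, rfl⟩ := hm
        rw [mem_weightSpace_env.1 (hw j) ⟨x, hx⟩]
        exact Submodule.smul_mem _ _ (Submodule.subset_span ⟨j, rfl⟩)
      | zero => rw [smul_zero]; exact zero_mem _
      | add a b _ _ ha hb => rw [smul_add]; exact add_mem ha hb
      | smul c a _ ha => rw [smul_comm]; exact Submodule.smul_mem _ c ha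
    obtain ⟨v, hvP, hv0, ⟨i, hvi⟩, hvn, hvo, μ, hvμ⟩ := N.exists_singular hT hP hgr hn ho hh
    obtain ⟨j, rfl, hj⟩ := (isTorusRep_env (M := M.carrier) hT).exists_exchange hT hw hv0 hvμ hvP
    let U : Submodule G.Env M.carrier := Submodule.span G.Env {v}
    have hU : SuperMod.IsGraded (U.restrictScalars k) :=
      SuperMod.isGraded_env_span fun m hm => ⟨i, by rwa [Set.mem_singleton_iff.1 hm]⟩
    have hvU : v ∈ U := Submodule.mem_span_singleton_self v
    have hspan : Submodule.span k (Set.range fun i => U.mkQ (w (j.succAbove i))) =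
        (Submodule.span k (Set.range w)).map (U.mkQ.restrictScalars k) := by
      refine le_antisymm (Submodule.span_le.2 ?_) ?_
      · rintro _ ⟨i, rfl⟩
        exact ⟨_, Submodule.subset_span ⟨_, rfl⟩, rfl⟩
      · rw [Submodule.map_span, Submodule.span_le]
        have hi : ∀ i, U.mkQ (w (j.succAbove i)) ∈
            Submodule.span k (Set.range fun i => U.mkQ (w (j.succAbove i))) :=
          fun i => Submodule.subset_span ⟨i, rfl⟩
        rintro _ ⟨_, ⟨i, rfl⟩, rfl⟩
        rcases Fin.eq_self_or_eq_succAbove j i with rfl | ⟨i, rfl⟩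
        · have := Submodule.mem_map_of_mem (f := U.mkQ.restrictScalars k) hj
          rw [Submodule.map_span] at this
          refine Submodule.span_le.2 ?_ this
          rintro _ ⟨y, hy | ⟨i', hi', rfl⟩, rfl⟩
          · rw [hy]
            have : (U.mkQ.restrictScalars k) v = 0 := (Submodule.Quotient.mk_eq_zero U).2 hvU
            rw [this]
            exact zero_mem _
          · obtain ⟨l, rfl⟩ := Fin.exists_succAbove_eq (show i' ≠ i from hi')
            exact hi l
        · exact hi i
    have hst : ∀ x : g, (∀ m ∈ Submodule.span k (Set.range w),
        G.ι x • m ∈ Submodule.span k (Set.range w)) →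
        ∀ m ∈ Submodule.span k (Set.range fun i => U.mkQ (w (j.succAbove i))),
          G.ι x • m ∈ Submodule.span k (Set.range fun i => U.mkQ (w (j.succAbove i))) := by
      intro x hx m hm
      rw [hspan] at hm ⊢
      obtain ⟨m, hm, rfl⟩ := hm
      exact ⟨_, hx m hm, map_smul U.mkQ _ _⟩
    have hgen' : Submodule.span G.Env (Set.range fun i => U.mkQ (w (j.succAbove i))) = ⊤ := by
      rw [eq_top_iff, ← (LinearMap.range_eq_top.2 U.mkQ_surjective), LinearMap.range_eq_map, ← hgen,
        Submodule.map_span, Submodule.span_le]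
      rintro _ ⟨_, ⟨i, rfl⟩, rfl⟩
      refine Submodule.span_le_restrictScalars k G.Env _ ?_
      rw [hspan]
      exact ⟨_, Submodule.subset_span ⟨i, rfl⟩, rfl⟩
    obtain ⟨h1, h2⟩ := ih (M.quot U hU) (fun i => U.mkQ (w (j.succAbove i)))
      (fun i => ν (j.succAbove i)) (fun i => SuperMod.mkQ_mem_weightSpace (hw _))
      (by rw [hspan]; exact SuperMod.isGraded_map_mkQ hU hgr) (fun x hx => hst x (hn x hx))
      (fun x hx => hst x (ho x hx)) hgen'
    obtain ⟨f, hf, hfa⟩ := exists_map_induced (N := N) hT (M := M.sub U hU) (v := ⟨v, hvU⟩) (i := i)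
      (μ := (ν j).1) hvi (fun x hx => Subtype.ext (hvn x hx)) (fun x hx => Subtype.ext (hvo x hx))
      (mem_weightSpace_env.2 fun x => Subtype.ext (mem_weightSpace_env.1 hvμ x))
    have hfs : Function.Surjective f := by
      rintro ⟨m, hm⟩
      obtain ⟨a, rfl⟩ := Submodule.mem_span_singleton.1 hm
      exact ⟨Submodule.Quotient.mk a, by rw [hfa]; rfl⟩
    have hfin := (N.induced hT (ν j).1).finite_base
    have h3 : Module.finrank k U ≤ Module.finrank k (N.induced hT (ν j).1).carrier :=
      LinearMap.finrank_le_finrank_of_surjective (f := f.restrictScalars k) hfs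
    have hs := SuperMod.shortExact_sub_quot hU
    have h4 := hs.finrank_eq
    rw [Fin.sum_univ_succAbove _ j, Fin.sum_univ_succAbove _ j]
    refine ⟨by rw [h4]; exact add_le_add h3 h1, fun e => ?_⟩
    have h5 : Module.finrank k (M.sub U hU).carrier =
        Module.finrank k (N.induced hT (ν j).1).carrier := by
      have h3 : Module.finrank k (M.sub U hU).carrier ≤ _ := h3
      omega
    have hfin' := (M.sub U hU).finite_base
    have hfi : Function.Injective f := (LinearMap.injective_iff_surjective_of_finrank_eq_finrank
      (f := f.restrictScalars k) h5.symm).2 hfs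
    rw [hs.cls_eq, h2 (by omega), SuperMod.cls_eq_of_bijective hf ⟨hfi, hfs⟩]

theorem finrank_le_and_cls_eq [IsAlgClosed k] [FiniteDimensional k g] [Module.Finite k G.Env]
    [Fact p.Prime] [CharP k p] (hT : G.IsTorus h) {J : Type*} [Fintype J] (M : G.SuperMod)
    (w : J → M.carrier) (ν : J → G.Weight h)
    (hw : ∀ j, w j ∈ weightSpace (G.envTorus h M.carrier) (ν j).1)
    (hgr : SuperMod.IsGraded (Submodule.span k (Set.range w)))
    (hn : ∀ x ∈ N.n, ∀ m ∈ Submodule.span k (Set.range w),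
      G.ι x • m ∈ Submodule.span k (Set.range w))
    (ho : ∀ x ∈ N.o, ∀ m ∈ Submodule.span k (Set.range w),
      G.ι x • m ∈ Submodule.span k (Set.range w))
    (hgen : Submodule.span G.Env (Set.range w) = ⊤) :
    Module.finrank k M.carrier ≤ ∑ j, Module.finrank k (N.induced hT (ν j).1).carrier ∧
      (Module.finrank k M.carrier = ∑ j, Module.finrank k (N.induced hT (ν j).1).carrier →
        M.cls = ∑ j, (N.induced hT (ν j).1).cls) := by
  let e := (Fintype.equivFin J).symm
  have hr : Set.range (w ∘ e) = Set.range w := e.surjective.range_comp w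
  have := N.finrank_le_and_cls_eq_fin hT _ M (w ∘ e) (ν ∘ e) (fun j => hw _) (by rwa [hr])
    (by rwa [hr]) (by rwa [hr]) (by rwa [hr])
  rwa [← e.sum_comp, ← e.sum_comp]

end NilSubalgebra

/-! ### Baby Verma modules as induced modules -/

namespace Half

variable (B : Half G h)

/-- The subalgebra `n ⊕ o` of one half of a triangular decomposition. -/
def nilSubalgebra : NilSubalgebra G h where
  n := B.n
  o := B.o
  n_le := B.n_le
  o_le := B.o_le
  br_nn := B.br_nn
  br_no := B.br_no
  br_oo := B.br_oo
  br_hn := B.br_hn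
  br_ho := B.br_ho
  pNilpotent := B.pNilpotent

theorem mkQ_mul_envMap (wt : G.Weight h) (b : B.borel.toRestricted.Env) :
    (B.vermaRel wt).mkQ (B.borel.envMap b ⊗ₜ[k] (1 : k)) =
      B.char wt b • (B.vermaRel wt).mkQ ((1 : G.Env) ⊗ₜ[k] (1 : k)) := by
  have : B.borel.envMap b ⊗ₜ[k] (1 : k) - (1 : G.Env) ⊗ₜ[k] (B.char wt b * 1) ∈ B.vermaRel wt :=
    Submodule.subset_span ⟨1, b, 1, by rw [one_mul]⟩
  have e := (Submodule.Quotient.eq _).2 this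
  change (B.vermaRel wt).mkQ _ = (B.vermaRel wt).mkQ _ at e
  rw [e, mul_one]
  have : (1 : G.Env) ⊗ₜ[k] B.char wt b = B.char wt b • ((1 : G.Env) ⊗ₜ[k] (1 : k)) := by
    rw [← TensorProduct.tmul_smul, smul_eq_mul, mul_one]
  rw [this]
  rfl

/-- An element of `b` acts on the generator of the baby Verma module through `charFun`. -/
theorem ι_smul_generator (wt : G.Weight h) (x : B.borel.carrier) :
    G.ι (x : g) • (B.vermaRel wt).mkQ ((1 : G.Env) ⊗ₜ[k] (1 : k)) =
      B.charFun wt.1 x • (B.vermaRel wt).mkQ ((1 : G.Env) ⊗ₜ[k] (1 : k)) := by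
  rw [← B.char_ι, ← B.mkQ_mul_envMap, B.borel.envMap_ι, ← map_smul, TensorProduct.smul_tmul',
    smul_eq_mul, mul_one]

theorem envMap_sub_char_mem (wt : G.Weight h) (b : B.borel.toRestricted.Env) :
    B.borel.envMap b - algebraMap k G.Env (B.char wt b) ∈ B.nilSubalgebra.ideal wt.1 := by
  let U : Submodule k B.borel.toRestricted.Env :=
    ((B.nilSubalgebra.ideal wt.1).restrictScalars k).comap
      (B.borel.envMap.toLinearMap - Algebra.linearMap k G.Env ∘ₗ (B.char wt).toLinearMap)
  have hgen : ∀ x : B.borel.carrier, G.ι (x : g) - algebraMap k G.Env (B.charFun wt.1 x) ∈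
      B.nilSubalgebra.ideal wt.1 := by
    rintro ⟨x, hx⟩
    obtain ⟨x', hx', c, hc, rfl⟩ := Submodule.mem_sup.1 hx
    obtain ⟨a, ha, b, hb, rfl⟩ := Submodule.mem_sup.1 hx'
    have hx1 : a + b ∈ B.borel.carrier := Submodule.mem_sup_left hx'
    have hx2 : c ∈ B.borel.carrier := Submodule.mem_sup_right hc
    have e : (⟨a + b + c, hx⟩ : B.borel.carrier) = ⟨a + b, hx1⟩ + ⟨c, hx2⟩ := rfl
    rw [e, map_add, B.charFun_ideal _ _ (by rwa [sup_comm] at hx'), B.charFun_torus _ _ hc,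
      zero_add, Submodule.coe_add, map_add, add_sub_assoc, map_add]
    exact add_mem (add_mem (Submodule.subset_span (Or.inr (Or.inl ⟨a, ha, rfl⟩)))
      (Submodule.subset_span (Or.inl ⟨b, hb, rfl⟩)))
      (Submodule.subset_span (Or.inr (Or.inr ⟨⟨c, hc⟩, rfl⟩)))
  have : b • (1 : B.borel.toRestricted.Env) ∈ U := by
    refine env_smul_mem (fun x m hm => ?_) b ?_
    · change B.borel.envMap (B.borel.toRestricted.ι x * m) -
        algebraMap k G.Env (B.char wt (B.borel.toRestricted.ι x * m)) ∈
          B.nilSubalgebra.ideal wt.1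
      have hm : B.borel.envMap m - algebraMap k G.Env (B.char wt m) ∈
          B.nilSubalgebra.ideal wt.1 := hm
      rw [map_mul, map_mul, map_mul, B.char_ι, B.borel.envMap_ι]
      have h1 := Submodule.smul_mem _ (G.ι (x : g)) hm
      have h2 := Submodule.smul_mem _ (algebraMap k G.Env (B.char wt m)) (hgen x)
      have h3 := add_mem h1 h2
      rw [smul_eq_mul, smul_eq_mul, mul_sub, mul_sub,
        Algebra.commutes (B.char wt m) (G.ι (x : g)),
        Algebra.commutes (B.char wt m) (algebraMap k G.Env (B.charFun wt.1 x))] at h3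
      rwa [sub_add_sub_cancel] at h3
    · change B.borel.envMap 1 - algebraMap k G.Env (B.char wt 1) ∈ B.nilSubalgebra.ideal wt.1
      rw [map_one, map_one, map_one, sub_self]
      exact zero_mem _
  rw [smul_eq_mul, mul_one] at this
  exact this

/-- The baby Verma module is induced from a character of `n ⊕ o ⊕ h`. -/
theorem exists_bijective_verma (wt : G.Weight h) :
    ∃ f : (B.nilSubalgebra.induced B.isTorus wt.1).carrier →ₗ[G.Env] (B.verma wt).carrier,
      IsHomogeneousMap 0 f ∧ Function.Bijective f := by
  let v : (B.verma wt).carrier := (B.vermaRel wt).mkQ ((1 : G.Env) ⊗ₜ[k] (1 : k))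
  have hmem : ∀ {x : g}, x ∈ B.n ⊔ B.o → x ∈ B.borel.carrier := fun hx =>
    Submodule.mem_sup_left (by rwa [sup_comm])
  have hkill : ∀ {x : g}, x ∈ B.n ⊔ B.o → G.ι x • v = 0 := fun {x} hx => by
    have := B.ι_smul_generator wt ⟨x, hmem hx⟩
    rw [B.charFun_ideal _ _ hx, zero_smul] at this
    exact this
  obtain ⟨f, hf, hfa⟩ := NilSubalgebra.exists_map_induced (N := B.nilSubalgebra) B.isTorus
    (M := B.verma wt) (v := v) (i := 0) (μ := wt.1)
    (show (B.vermaRel wt).mkQ ((1 : G.Env) ⊗ₜ[k] (1 : k)) ∈ B.vermaGr wt 0 from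
      Submodule.subset_span ⟨1, G.one_mem_envGr, 1, rfl⟩)
    (fun x hx => hkill (Submodule.mem_sup_left hx)) (fun x hx => hkill (Submodule.mem_sup_right hx))
    (mem_weightSpace_env.2 fun x => by
      have := B.ι_smul_generator wt ⟨x, Submodule.mem_sup_right x.2⟩
      rw [B.charFun_torus _ _ x.2] at this
      exact this)
  have hfa' : ∀ a : G.Env, f (Submodule.Quotient.mk a) = (B.vermaRel wt).mkQ (a ⊗ₜ[k] (1 : k)) := by
    intro a
    rw [hfa]
    change a • (B.vermaRel wt).mkQ _ = _
    rw [← map_smul, TensorProduct.smul_tmul', smul_eq_mul, mul_one]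
  refine ⟨f, hf, ?_, ?_⟩
  · rw [← LinearMap.ker_eq_bot, LinearMap.ker_eq_bot']
    intro a ha
    obtain ⟨a, rfl⟩ := Submodule.mkQ_surjective _ a
    have ha : a ⊗ₜ[k] (1 : k) ∈ B.vermaRel wt :=
      (Submodule.Quotient.mk_eq_zero _).1 ((hfa' a).symm.trans ha)
    let r : (G.Env ⊗[k] k) →ₗ[G.Env] G.Env :=
      (TensorProduct.AlgebraTensorModule.rid k G.Env G.Env).toLinearMap
    have hle : B.vermaRel wt ≤ (B.nilSubalgebra.ideal wt.1).comap r := by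
      refine Submodule.span_le.2 ?_
      rintro _ ⟨a, b, c, rfl⟩
      change r _ ∈ B.nilSubalgebra.ideal wt.1
      have : r ((a * B.borel.envMap b) ⊗ₜ[k] c - a ⊗ₜ[k] (B.char wt b * c)) =
          (c • a) * (B.borel.envMap b - algebraMap k G.Env (B.char wt b)) := by
        rw [map_sub]
        change c • (a * B.borel.envMap b) - (B.char wt b * c) • a = _
        rw [mul_sub, smul_mul_assoc, ← Algebra.commutes, ← Algebra.smul_def, smul_smul]
      rw [this]
      exact Submodule.smul_mem _ _ (B.envMap_sub_char_mem wt b)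
    have h1 : r (a ⊗ₜ[k] (1 : k)) ∈ B.nilSubalgebra.ideal wt.1 := hle ha
    have h2 : r (a ⊗ₜ[k] (1 : k)) = a := one_smul k a
    rw [h2] at h1
    exact (Submodule.Quotient.mk_eq_zero _).2 h1
  · intro m
    obtain ⟨t, rfl⟩ := (B.vermaRel wt).mkQ_surjective m
    induction t with
    | zero => exact ⟨0, by rw [map_zero, map_zero]; rfl⟩
    | add x y hx hy =>
      obtain ⟨a, ha⟩ := hx
      obtain ⟨b, hb⟩ := hy
      exact ⟨a + b, by rw [map_add, map_add, ha, hb]; rfl⟩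
    | tmul a c =>
      refine ⟨Submodule.Quotient.mk (c • a), ?_⟩
      rw [hfa', TensorProduct.smul_tmul, smul_eq_mul, mul_one]

theorem cls_verma (wt : G.Weight h) :
    (B.verma wt).cls = (B.nilSubalgebra.induced B.isTorus wt.1).cls := by
  obtain ⟨f, hf, hb⟩ := B.exists_bijective_verma wt
  exact (SuperMod.cls_eq_of_bijective hf hb).symm

theorem finrank_verma (wt : G.Weight h) : Module.finrank k (B.verma wt).carrier =
    Module.finrank k (B.nilSubalgebra.induced B.isTorus wt.1).carrier := by
  obtain ⟨f, hf, hb⟩ := B.exists_bijective_verma wt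
  exact (LinearEquiv.finrank_eq (LinearEquiv.ofBijective (f.restrictScalars k) hb)).symm

end Half

end RestrictedLieSuperalgebra

namespace RestrictedLieSuperalgebra

variable {k : Type u} {p : ℕ} {g : Type v} [Field k] [AddCommGroup g] [Module k g]
  {G : RestrictedLieSuperalgebra k p g} {h : Submodule k g}

/-! ### Monomials in even and odd elements -/

theorem expWord_zero {ι : Type*} [Fintype ι] [LinearOrder ι] :
    expWord (fun _ : ι => 0) = [] :=
  (eq_expWord (w := []) List.Pairwise.nil).symm

theorem monomial_smul_mem_weightSpace {ι : Type*} (hT : G.IsTorus h) {M : Type*} [AddCommGroup M]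
    [Module k M] [Module G.Env M] [IsScalarTower k G.Env M] {x : ι → g} {deg : ι → ZMod 2}
    (hx : ∀ i, x i ∈ G.gr (deg i)) {ξ : ι → Module.Dual k h}
    (hξ : ∀ i, x i ∈ weightSpace (G.adTorus h) (ξ i)) {μ : Module.Dual k h} {m : M}
    (hm : m ∈ weightSpace (G.envTorus h M) μ) (w : List ι) :
    G.monomial x w • m ∈ weightSpace (G.envTorus h M) ((w.map ξ).sum + μ) := by
  induction w with
  | nil => simpa [monomial] using hm
  | cons i w ih =>
    rw [monomial_cons, mul_smul, List.map_cons, List.sum_cons, add_assoc]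
    exact ι_smul_mem_weightSpace hT (hx i) (hξ i) ih

theorem exists_monomial_mem_envGr {ι : Type*} {x : ι → g} {deg : ι → ZMod 2}
    (hx : ∀ i, x i ∈ G.gr (deg i)) (w : List ι) : ∃ j, G.monomial x w ∈ G.envGr j := by
  induction w with
  | nil => exact ⟨0, by simpa [monomial] using G.one_mem_envGr⟩
  | cons i w ih =>
    obtain ⟨j, hj⟩ := ih
    rw [monomial_cons]
    exact ⟨_, G.ι_mul_mem (hx i) hj⟩

section

variable {a b : ℕ}

/-- The family `x`, `y`, as a single family indexed by an ordered type. -/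
def sumFamily {α : Type*} (x : Fin a → α) (y : Fin b → α) (i : Fin a ⊕ₗ Fin b) : α :=
  Sum.elim x y (ofLex i)

/-- The product `x₁^{e₁} ⋯ x_a^{e_a} y₁^{e'₁} ⋯ y_b^{e'_b}` in `u(g)`. -/
noncomputable def evenOddMonomial (G : RestrictedLieSuperalgebra k p g) (x : Fin a → g)
    (y : Fin b → g) (e : (Fin a → Fin p) × (Fin b → Fin 2)) : G.Env :=
  G.monomial (sumFamily x y)
    (expWord (sumFamily (fun i => (e.1 i : ℕ)) fun j => (e.2 j : ℕ)))

theorem sumFamily_mem_gr {x : Fin a → g} {y : Fin b → g} (hx : ∀ i, x i ∈ G.gr 0)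
    (hy : ∀ j, y j ∈ G.gr 1) (i : Fin a ⊕ₗ Fin b) :
    sumFamily x y i ∈ G.gr (sumFamily (fun _ => 0) (fun _ => 1) i) := by
  obtain ⟨i | j, rfl⟩ := toLex.surjective i
  · exact hx i
  · exact hy j

theorem range_sumFamily {α : Type*} (x : Fin a → α) (y : Fin b → α) :
    Set.range (sumFamily x y) = Set.range x ∪ Set.range y := by
  rw [← Set.Sum.elim_range]
  exact ofLex.surjective.range_comp (Sum.elim x y)

theorem sum_sumFamily {A : Type*} [AddCommMonoid A] (x : Fin a → A) (y : Fin b → A) :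
    ∑ i, sumFamily x y i = ∑ i, x i + ∑ j, y j :=
  (Equiv.sum_comp ofLex (Sum.elim x y)).trans (Fintype.sum_sum_type _)

theorem exists_evenOddMonomial_mem_envGr {x : Fin a → g} {y : Fin b → g}
    (hx : ∀ i, x i ∈ G.gr 0) (hy : ∀ j, y j ∈ G.gr 1) (e : (Fin a → Fin p) × (Fin b → Fin 2)) :
    ∃ j, G.evenOddMonomial x y e ∈ G.envGr j :=
  exists_monomial_mem_envGr (sumFamily_mem_gr hx hy) _

theorem evenOddMonomial_zero [NeZero p] (x : Fin a → g) (y : Fin b → g) :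
    G.evenOddMonomial x y 0 = 1 := by
  have : (sumFamily (fun i => (((0 : (Fin a → Fin p) × (Fin b → Fin 2)).1 i : Fin p) : ℕ))
      fun j => (((0 : (Fin a → Fin p) × (Fin b → Fin 2)).2 j : Fin 2) : ℕ)) = fun _ => 0 := by
    funext i
    obtain ⟨i | j, rfl⟩ := toLex.surjective i <;> simp [sumFamily]
  rw [evenOddMonomial, this, expWord_zero]
  rfl

theorem mem_span_evenOddMonomial [NeZero p] {M : Type*} [AddCommGroup M] [Module k M]
    [Module G.Env M] (x : Fin a → g) (y : Fin b → g) (v : M) :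
    v ∈ Submodule.span k (Set.range fun e => G.evenOddMonomial x y e • v) :=
  Submodule.subset_span ⟨0, by
    change G.evenOddMonomial x y 0 • v = v
    rw [evenOddMonomial_zero, one_smul]⟩

variable {M : Type*} [AddCommGroup M] [Module k M] [Module G.Env M] [IsScalarTower k G.Env M]

theorem evenOddMonomial_smul_mem_weightSpace [Fact p.Prime] [CharP k p] (hT : G.IsTorus h)
    {x : Fin a → g} {y : Fin b → g} (hx : ∀ i, x i ∈ G.gr 0) (hy : ∀ j, y j ∈ G.gr 1)
    {ξ : Fin a → G.Weight h} {η : Fin b → G.Weight h}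
    (hξ : ∀ i, x i ∈ weightSpace (G.adTorus h) (ξ i).1)
    (hη : ∀ j, y j ∈ weightSpace (G.adTorus h) (η j).1) {μ : G.Weight h} {m : M}
    (hm : m ∈ weightSpace (G.envTorus h M) μ.1) (e : (Fin a → Fin p) × (Fin b → Fin 2)) :
    G.evenOddMonomial x y e • m ∈ weightSpace (G.envTorus h M)
      ((∑ i, (e.1 i : ℕ) • ξ i + ∑ j, (e.2 j : ℕ) • η j) + μ).1 := by
  have := monomial_smul_mem_weightSpace hT (sumFamily_mem_gr hx hy)
    (ξ := fun i => (sumFamily ξ η i).1) (fun i => by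
      obtain ⟨i | j, rfl⟩ := toLex.surjective i
      · exact hξ i
      · exact hη j) hm (expWord (sumFamily (fun i => (e.1 i : ℕ)) fun j => (e.2 j : ℕ)))
  rw [sum_map_expWord] at this
  rw [coe_weight_add, coe_weight_add, coe_weight_sum, coe_weight_sum, ← sum_sumFamily]
  convert this using 3
  · refine Finset.sum_congr rfl fun i _ => ?_
    obtain ⟨i | j, rfl⟩ := toLex.surjective i <;> rfl
  · rfl

/-- A set of elements of a finite-dimensional space has a finite subfamily with the same span. -/
theorem exists_fin_span_eq [FiniteDimensional k g] (T : Set g) :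
    ∃ (m : ℕ) (z : Fin m → g), (∀ i, z i ∈ T) ∧
      Submodule.span k (Set.range z) = Submodule.span k T := by
  obtain ⟨B, hBT, hspan, hli⟩ := exists_linearIndependent k T
  have := hli.setFinite.fintype
  refine ⟨Fintype.card B, fun i => (Fintype.equivFin B).symm i, fun i => hBT (Subtype.coe_prop _),
    ?_⟩
  rw [← hspan]
  congr 1
  rw [show (fun i => (((Fintype.equivFin B).symm i : B) : g)) =
    Subtype.val ∘ (Fintype.equivFin B).symm from rfl, Set.range_comp,
    Equiv.range_eq_univ, Set.image_univ, Subtype.range_coe]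

/-- If the homogeneous elements of `T` act on `v` by scalars and `S` is a restricted subalgebra
spanned by `x`, `y` and `T`, then `u(S) v` is spanned by the monomials in `x` and `y`. -/
theorem ι_smul_mem_span_evenOddMonomial [FiniteDimensional k g] [Fact p.Prime]
    {x : Fin a → g} {y : Fin b → g} (hx : ∀ i, x i ∈ G.gr 0) (hy : ∀ j, y j ∈ G.gr 1) {T : Set g}
    (hT : ∀ z ∈ T, ∃ i, z ∈ G.gr i) {S : Submodule k g}
    (hS : S = Submodule.span k (Set.range x ∪ Set.range y) ⊔ Submodule.span k T)
    (hbr : ∀ s ∈ S, ∀ t ∈ S, G.br s t ∈ S)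
    (hpow : ∀ s : G.gr 0, (s : g) ∈ S → (G.pmap s : g) ∈ S) {v : M}
    (hv : ∀ z ∈ T, ∃ c : k, G.ι z • v = c • v) {s : g} (hs : s ∈ S) {m : M}
    (hm : m ∈ Submodule.span k (Set.range fun e => G.evenOddMonomial x y e • v)) :
    G.ι s • m ∈ Submodule.span k (Set.range fun e => G.evenOddMonomial x y e • v) := by
  obtain ⟨l, z, hzT, hz⟩ := exists_fin_span_eq (k := k) T
  choose degz hdegz using fun i => hT _ (hzT i)
  let deg : Fin a ⊕ₗ Fin b → ZMod 2 := sumFamily (fun _ => 0) (fun _ => 1)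
  have key : Submodule.span k (Set.range fun e => G.evenOddMonomial x y e • v) =
      Submodule.span k (Set.range fun e : ∀ i, Fin (expBound p deg i) =>
        G.monomial (sumFamily x y) (expWord fun i => (e i : ℕ)) • v) := by
    have h0 : ∀ i, expBound p deg (toLex (Sum.inl i)) = p := fun i => rfl
    have h1 : ∀ j, expBound p deg (toLex (Sum.inr j)) = 2 := fun j => rfl
    congr 1
    ext m
    constructor
    · rintro ⟨e, rfl⟩
      refine ⟨fun i => ⟨sumFamily (fun i => (e.1 i : ℕ)) (fun j => (e.2 j : ℕ)) i, ?_⟩, rfl⟩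
      obtain ⟨i | j, rfl⟩ := toLex.surjective i
      · exact (e.1 i).2
      · exact (e.2 j).2
    · rintro ⟨e, rfl⟩
      refine ⟨⟨fun i => ⟨e (toLex (Sum.inl i)), (e (toLex (Sum.inl i))).2⟩,
        fun j => ⟨e (toLex (Sum.inr j)), (e (toLex (Sum.inr j))).2⟩⟩, ?_⟩
      change G.monomial _ (expWord _) • v = _
      congr 3
      funext i
      obtain ⟨i | j, rfl⟩ := toLex.surjective i <;> rfl
  rw [key] at hm ⊢
  refine ι_smul_mem_span_monomial (sumFamily_mem_gr hx hy) hdegz ?_ hbr hpow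
    (fun j => hv _ (hzT j)) hs hm
  rw [hS, range_sumFamily, Submodule.span_union (Set.range x ∪ Set.range y), hz]

/-- If in addition `S = g` and `v` generates `M`, then the dimension of `M` is at most `p^a 2^b`. -/
theorem finrank_le_of_span [FiniteDimensional k g] [Fact p.Prime]
    {x : Fin a → g} {y : Fin b → g} (hx : ∀ i, x i ∈ G.gr 0) (hy : ∀ j, y j ∈ G.gr 1) {T : Set g}
    (hT : ∀ z ∈ T, ∃ i, z ∈ G.gr i)
    (hS : Submodule.span k (Set.range x ∪ Set.range y) ⊔ Submodule.span k T = ⊤) {v : M}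
    (hv : ∀ z ∈ T, ∃ c : k, G.ι z • v = c • v) (hgen : ∀ m : M, ∃ r : G.Env, r • v = m) :
    Module.Finite k M ∧ Module.finrank k M ≤ p ^ a * 2 ^ b := by
  have : NeZero p := ⟨(Fact.out : p.Prime).ne_zero⟩
  have htop : Submodule.span k (Set.range fun e => G.evenOddMonomial x y e • v) = ⊤ := by
    rw [eq_top_iff]
    rintro m -
    obtain ⟨r, rfl⟩ := hgen m
    exact env_smul_mem (fun s m hm => ι_smul_mem_span_evenOddMonomial hx hy hT hS.symm
      (fun _ _ _ _ => trivial) (fun _ _ => trivial) hv trivial hm) r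
      (mem_span_evenOddMonomial x y v)
  refine ⟨⟨Submodule.fg_def.2 ⟨_, Set.finite_range _, htop⟩⟩, ?_⟩
  have h1 := finrank_range_le_card (R := k) fun e => G.evenOddMonomial x y e • v
  rw [Set.finrank, htop, finrank_top] at h1
  simpa using h1

end

/-! ### Dimensions -/

/-- A basis of a complement of `U` in `W`. -/
theorem exists_fin_sup_eq [FiniteDimensional k g] {U W : Submodule k g} (hUW : U ≤ W) :
    ∃ (a : ℕ) (x : Fin a → g), a + Module.finrank k U = Module.finrank k W ∧
      Submodule.span k (Set.range x) ⊔ U = W := by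
  obtain ⟨C, hC⟩ := Submodule.exists_isCompl (U.comap W.subtype)
  let b := Module.finBasis k C
  refine ⟨Module.finrank k C, fun i => ((b i : W) : g), ?_, ?_⟩
  · rw [← Submodule.finrank_add_eq_of_isCompl hC, add_comm,
      (Submodule.comapSubtypeEquivOfLe hUW).finrank_eq]
  · have h1 : Submodule.span k (Set.range fun i => ((b i : W) : g)) = C.map W.subtype := by
      have e : (fun i => ((b i : W) : g)) = (W.subtype ∘ₗ C.subtype) ∘ b := rfl
      rw [e, Set.range_comp, ← Submodule.map_span, b.span_eq, Submodule.map_top,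
        LinearMap.range_comp, Submodule.range_subtype]
    have h2 : (U.comap W.subtype).map W.subtype = U := by
      rw [Submodule.map_comap_subtype, inf_eq_right.2 hUW]
    rw [h1]
    nth_rewrite 1 [← h2]
    rw [← Submodule.map_sup, sup_comm, hC.sup_eq_top, Submodule.map_subtype_top]

theorem finite_env [FiniteDimensional k g] [Fact p.Prime] (G : RestrictedLieSuperalgebra k p g) :
    Module.Finite k G.Env := by
  obtain ⟨a, x, -, hx⟩ := exists_fin_sup_eq (bot_le (a := G.gr 0))
  obtain ⟨b, y, -, hy⟩ := exists_fin_sup_eq (bot_le (a := G.gr 1))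
  rw [sup_bot_eq] at hx hy
  refine (finrank_le_of_span (G := G) (x := x) (y := y) (T := ∅) (v := (1 : G.Env))
    (fun i => hx.le (Submodule.subset_span ⟨i, rfl⟩))
    (fun i => hy.le (Submodule.subset_span ⟨i, rfl⟩)) (fun z hz => hz.elim) ?_
    (fun z hz => hz.elim) fun m => ⟨m, mul_one m⟩).1
  rw [Submodule.span_union, hx, hy, G.isCompl.sup_eq_top, top_sup_eq]

/-- The lower bound from the Poincaré-Birkhoff-Witt theorem. -/
theorem le_finrank_env [FiniteDimensional k g] [Fact p.Prime] [CharP k p]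
    (G : RestrictedLieSuperalgebra k p g) :
    p ^ Module.finrank k (G.gr 0) * 2 ^ Module.finrank k (G.gr 1) ≤ Module.finrank k G.Env := by
  have hp : 2 < p := by
    refine lt_of_le_of_ne (Fact.out : p.Prime).two_le fun e => G.two_ne_zero ?_
    subst e
    exact_mod_cast CharP.cast_eq_zero k 2
  have := G.finite_env
  let B : G.HomogeneousBasis (Fin (Module.finrank k (G.gr 0)) ⊕ₗ Fin (Module.finrank k (G.gr 1))) :=
    { toBasis := (((Module.finBasis k (G.gr 0)).prod (Module.finBasis k (G.gr 1))).map
        (Submodule.prodEquivOfIsCompl _ _ G.isCompl)).reindex toLex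
      deg := sumFamily (fun _ => 0) (fun _ => 1)
      mem := fun i => by
        obtain ⟨i | j, rfl⟩ := toLex.surjective i
        · simp [sumFamily]
        · simp [sumFamily] }
  let F : (∀ i, Fin (expBound p B.deg i)) → {w // ¬ Rewriting.Reducible B.Rule w} := fun e =>
    ⟨expWord fun i => (e i : ℕ), B.not_reducible
      ⟨pairwise_expWord _, fun i => by rw [count_expWord]; exact (e i).2⟩⟩
  have hF : Function.Injective F := fun e e' hee => by
    have := expWord_injective (congrArg Subtype.val hee)
    exact funext fun i => Fin.ext (congrFun this i)
  have h1 := ((B.linearIndependent_monomial hp).comp F hF).fintype_card_le_finrank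
  rw [Fintype.card_pi] at h1
  refine le_of_eq_of_le ?_ h1
  rw [← Equiv.prod_comp toLex, Fintype.prod_sum_type]
  simp [expBound, B, sumFamily]

/-- The dimension of an induced module is at most that given by the Poincaré-Birkhoff-Witt theorem
for a complement of `n ⊕ o ⊕ h`. -/
theorem NilSubalgebra.finrank_induced_le [FiniteDimensional k g] [Fact p.Prime]
    (N : NilSubalgebra G h) (hT : G.IsTorus h) (μ : Module.Dual k h) {a b : ℕ}
    (ha : a + Module.finrank k (N.n ⊔ h : Submodule k g) = Module.finrank k (G.gr 0))
    (hb : b + Module.finrank k N.o = Module.finrank k (G.gr 1)) :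
    Module.finrank k (N.induced hT μ).carrier ≤ p ^ a * 2 ^ b := by
  obtain ⟨a', x, ha', hx⟩ := exists_fin_sup_eq (sup_le N.n_le hT.le)
  obtain ⟨b', y, hb', hy⟩ := exists_fin_sup_eq N.o_le
  obtain rfl : a' = a := by omega
  obtain rfl : b' = b := by omega
  have hmk : ∀ r : G.Env, r ∈ N.relations μ →
      r • (Submodule.Quotient.mk 1 : G.Env ⧸ N.ideal μ) = 0 := fun r hr => by
    rw [← Submodule.Quotient.mk_smul, smul_eq_mul, mul_one]
    exact (Submodule.Quotient.mk_eq_zero _).2 (Submodule.subset_span hr)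
  refine (finrank_le_of_span (x := x) (y := y) (T := N.n ∪ N.o ∪ h)
    (v := (Submodule.Quotient.mk 1 : G.Env ⧸ N.ideal μ))
    (fun i => hx.le (Submodule.mem_sup_left (Submodule.subset_span ⟨i, rfl⟩)))
    (fun i => hy.le (Submodule.mem_sup_left (Submodule.subset_span ⟨i, rfl⟩))) ?_ ?_ ?_ ?_).2
  · rintro z ((hz | hz) | hz)
    · exact ⟨0, N.n_le hz⟩
    · exact ⟨1, N.o_le hz⟩
    · exact ⟨0, hT.le hz⟩
  · rw [eq_top_iff, ← G.isCompl.sup_eq_top, ← hx, ← hy, Submodule.span_union, Submodule.span_union,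
      Submodule.span_union, Submodule.span_eq, Submodule.span_eq, Submodule.span_eq]
    refine sup_le (sup_le ?_ (sup_le ?_ ?_)) (sup_le ?_ ?_)
    · exact le_sup_of_le_left le_sup_left
    · exact le_sup_of_le_right (le_sup_of_le_left le_sup_left)
    · exact le_sup_of_le_right le_sup_right
    · exact le_sup_of_le_left le_sup_right
    · exact le_sup_of_le_right (le_sup_of_le_left le_sup_right)
  · rintro z ((hz | hz) | hz)
    · exact ⟨0, by rw [hmk _ (Or.inl ⟨z, hz, rfl⟩), zero_smul]⟩
    · exact ⟨0, by rw [hmk _ (Or.inr (Or.inl ⟨z, hz, rfl⟩)), zero_smul]⟩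
    · refine ⟨μ ⟨z, hz⟩, ?_⟩
      have := hmk _ (Or.inr (Or.inr ⟨⟨z, hz⟩, rfl⟩))
      rwa [sub_smul, algebraMap_smul, sub_eq_zero] at this
  · intro m
    obtain ⟨r, rfl⟩ := Submodule.mkQ_surjective _ m
    exact ⟨r, by rw [← Submodule.Quotient.mk_smul, smul_eq_mul, mul_one]; rfl⟩

/-- Let `M` be generated by homogeneous weight vectors `v c` on which the homogeneous elements of
`T` act by scalars, and let `S ⊇ n ⊕ o` be a restricted subalgebra spanned by `T` and weight
vectors `x`, `y`. Then `M` has a filtration by quotients of induced modules, one for each monomial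
in `x`, `y` and each `c`. -/
theorem NilSubalgebra.finrank_le_and_cls_eq_of_monomial [IsAlgClosed k] [FiniteDimensional k g]
    [Fact p.Prime] [CharP k p] (N : NilSubalgebra G h) (hT : G.IsTorus h) {a b : ℕ}
    {x : Fin a → g} {y : Fin b → g} (hx : ∀ i, x i ∈ G.gr 0) (hy : ∀ j, y j ∈ G.gr 1)
    {ξ : Fin a → G.Weight h} {η : Fin b → G.Weight h}
    (hξ : ∀ i, x i ∈ weightSpace (G.adTorus h) (ξ i).1)
    (hη : ∀ j, y j ∈ weightSpace (G.adTorus h) (η j).1) {T : Set g}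
    (hTgr : ∀ z ∈ T, ∃ i, z ∈ G.gr i) {S : Submodule k g}
    (hS : S = Submodule.span k (Set.range x ∪ Set.range y) ⊔ Submodule.span k T)
    (hbr : ∀ s ∈ S, ∀ t ∈ S, G.br s t ∈ S)
    (hpow : ∀ s : G.gr 0, (s : g) ∈ S → (G.pmap s : g) ∈ S) (hnS : N.n ≤ S) (hoS : N.o ≤ S)
    {C : Type*} [Fintype C] {M : G.SuperMod} {v : C → M.carrier} {μ : C → G.Weight h}
    (hvT : ∀ c, ∀ z ∈ T, ∃ r : k, G.ι z • v c = r • v c) (hvgr : ∀ c, ∃ i, v c ∈ M.gr i)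
    (hvμ : ∀ c, v c ∈ weightSpace (G.envTorus h M.carrier) (μ c).1)
    (hgen : Submodule.span G.Env (Set.range v) = ⊤) :
    Module.finrank k M.carrier ≤ ∑ e : (Fin a → Fin p) × (Fin b → Fin 2), ∑ c, Module.finrank k
        (N.induced hT ((∑ i, (e.1 i : ℕ) • ξ i + ∑ j, (e.2 j : ℕ) • η j) + μ c).1).carrier ∧
      (Module.finrank k M.carrier = ∑ e : (Fin a → Fin p) × (Fin b → Fin 2), ∑ c, Module.finrank k
        (N.induced hT ((∑ i, (e.1 i : ℕ) • ξ i + ∑ j, (e.2 j : ℕ) • η j) + μ c).1).carrier →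
        M.cls = ∑ e : (Fin a → Fin p) × (Fin b → Fin 2), ∑ c,
        (N.induced hT ((∑ i, (e.1 i : ℕ) • ξ i + ∑ j, (e.2 j : ℕ) • η j) + μ c).1).cls) := by
  have : NeZero p := ⟨(Fact.out : p.Prime).ne_zero⟩
  have := G.finite_env
  let w : ((Fin a → Fin p) × (Fin b → Fin 2)) × C → M.carrier :=
    fun q => G.evenOddMonomial x y q.1 • v q.2
  have hst : ∀ s ∈ S, ∀ m ∈ Submodule.span k (Set.range w),
      G.ι s • m ∈ Submodule.span k (Set.range w) := by
    intro s hs m hm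
    induction hm using Submodule.span_induction with
    | mem m hm =>
      obtain ⟨⟨e, c⟩, rfl⟩ := hm
      have h1 := ι_smul_mem_span_evenOddMonomial hx hy hTgr hS hbr hpow (hvT c) hs
        (Submodule.subset_span ⟨e, rfl⟩)
      refine Submodule.span_mono ?_ h1
      rintro _ ⟨e, rfl⟩
      exact ⟨(e, c), rfl⟩
    | zero => rw [smul_zero]; exact zero_mem _
    | add a b _ _ ha hb => rw [smul_add]; exact add_mem ha hb
    | smul r a _ ha => rw [smul_comm]; exact Submodule.smul_mem _ r ha
  have := N.finrank_le_and_cls_eq hT M w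
    (fun q => (∑ i, (q.1.1 i : ℕ) • ξ i + ∑ j, (q.1.2 j : ℕ) • η j) + μ q.2)
    (fun q => evenOddMonomial_smul_mem_weightSpace hT hx hy hξ hη (hvμ q.2) q.1)
    (SuperMod.isGraded_span fun m hm => by
      obtain ⟨q, rfl⟩ := hm
      obtain ⟨i, hi⟩ := exists_evenOddMonomial_mem_envGr hx hy q.1
      obtain ⟨j, hj⟩ := hvgr q.2
      exact ⟨i + j, M.env_smul_mem_gr hi hj⟩)
    (fun s hs => hst s (hnS hs)) (fun s hs => hst s (hoS hs)) (by
      rw [eq_top_iff, ← hgen, Submodule.span_le]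
      rintro _ ⟨c, rfl⟩
      refine Submodule.subset_span ⟨(0, c), ?_⟩
      change G.evenOddMonomial x y 0 • v c = v c
      rw [evenOddMonomial_zero, one_smul])
  simpa only [Fintype.sum_prod_type] using this

end RestrictedLieSuperalgebra

namespace RestrictedLieSuperalgebra

variable {k : Type u} {p : ℕ} {g : Type v} [Field k] [AddCommGroup g] [Module k g]
  {G : RestrictedLieSuperalgebra k p g} {h : Submodule k g}

/-! ### Triangular decompositions -/

theorem finrank_sup_of_disjoint [FiniteDimensional k g] {U W : Submodule k g}
    (hd : Disjoint U W) : Module.finrank k (U ⊔ W : Submodule k g) =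
      Module.finrank k U + Module.finrank k W := by
  rw [← Submodule.finrank_sup_add_finrank_inf_eq, hd.eq_bot, finrank_bot, add_zero]

namespace Half

variable (B : Half G h)

theorem inf_gr_zero : B.borel.carrier ⊓ G.gr 0 = B.n ⊔ h := by
  refine le_antisymm ?_ (le_inf ?_ (sup_le B.n_le B.isTorus.le))
  · rintro x ⟨hx, hx0⟩
    obtain ⟨y, hy, z, hz, rfl⟩ := B.even_mem hx hx0
    exact Submodule.add_mem_sup hy hz
  · exact sup_le (le_sup_of_le_left le_sup_right) le_sup_right

theorem inf_gr_one : B.borel.carrier ⊓ G.gr 1 = B.o :=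
  le_antisymm (fun _ hx => B.odd_mem hx.1 hx.2)
    (le_inf (le_sup_of_le_left le_sup_left) B.o_le)

theorem n_sup_eq {B B' : Half G h} (hb : B.borel.carrier = B'.borel.carrier) :
    B.n ⊔ h = B'.n ⊔ h := by
  rw [← inf_gr_zero, ← inf_gr_zero, hb]

theorem o_eq {B B' : Half G h} (hb : B.borel.carrier = B'.borel.carrier) : B.o = B'.o := by
  rw [← inf_gr_one, ← inf_gr_one, hb]

theorem finrank_n_eq [FiniteDimensional k g] {B B' : Half G h}
    (hb : B.borel.carrier = B'.borel.carrier) :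
    Module.finrank k B.n = Module.finrank k B'.n := by
  have h1 := finrank_sup_of_disjoint B.disjoint
  have h2 := finrank_sup_of_disjoint B'.disjoint
  rw [n_sup_eq hb] at h1
  omega

end Half

namespace TriangularDecomposition

variable {L : RestrictedSubalgebra G} (D : TriangularDecomposition G L h)

theorem disjoint_aux {i : Fin 5} {U : Submodule k g}
    (hU : U ≤ ⨆ j, ⨆ _ : j ≠ i, (![D.neg.o, D.neg.n, h, D.pos.n, D.pos.o] : Fin 5 → _) j) :
    Disjoint ((![D.neg.o, D.neg.n, h, D.pos.n, D.pos.o] : Fin 5 → Submodule k g) i) U :=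
  (D.indep i).mono_right hU

theorem finrank_even [FiniteDimensional k g] :
    Module.finrank k (D.neg.n ⊔ D.pos.n ⊔ h : Submodule k g) =
      Module.finrank k D.neg.n + Module.finrank k D.pos.n + Module.finrank k h := by
  rw [finrank_sup_of_disjoint, finrank_sup_of_disjoint]
  · exact D.disjoint_aux (i := 1) (le_iSup₂_of_le 3 (by decide) le_rfl)
  · exact (D.disjoint_aux (i := 2) (sup_le (le_iSup₂_of_le 1 (by decide) le_rfl)
      (le_iSup₂_of_le 3 (by decide) le_rfl))).symm

theorem finrank_odd [FiniteDimensional k g] :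
    Module.finrank k (D.neg.o ⊔ D.pos.o : Submodule k g) =
      Module.finrank k D.neg.o + Module.finrank k D.pos.o := by
  rw [finrank_sup_of_disjoint]
  exact D.disjoint_aux (i := 0) (le_iSup₂_of_le 4 (by decide) le_rfl)

theorem even_le : D.neg.n ⊔ D.pos.n ⊔ h ≤ G.gr 0 :=
  sup_le (sup_le D.neg.n_le D.pos.n_le) D.neg.isTorus.le

theorem odd_le : D.neg.o ⊔ D.pos.o ≤ G.gr 1 := sup_le D.neg.o_le D.pos.o_le

theorem carrier_eq : L.carrier = (D.neg.n ⊔ D.pos.n ⊔ h) ⊔ (D.neg.o ⊔ D.pos.o) := by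
  rw [← D.sup_eq]
  ac_rfl

theorem gr_zero_eq (D : TriangularDecomposition G (.whole G) h) :
    D.neg.n ⊔ D.pos.n ⊔ h = G.gr 0 := by
  refine le_antisymm D.even_le fun x hx => ?_
  have : x ∈ (RestrictedSubalgebra.whole G).carrier := Submodule.mem_top
  rw [D.carrier_eq] at this
  obtain ⟨y, hy, z, hz, rfl⟩ := Submodule.mem_sup.1 this
  have h0 : z ∈ G.gr 0 := (Submodule.add_mem_iff_right _ (D.even_le hy)).1 hx
  have : z = 0 := Submodule.disjoint_def.1 G.isCompl.disjoint z h0 (D.odd_le hz)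
  rwa [this, add_zero]

theorem gr_one_eq (D : TriangularDecomposition G (.whole G) h) :
    D.neg.o ⊔ D.pos.o = G.gr 1 := by
  refine le_antisymm D.odd_le fun x hx => ?_
  have : x ∈ (RestrictedSubalgebra.whole G).carrier := Submodule.mem_top
  rw [D.carrier_eq] at this
  obtain ⟨y, hy, z, hz, rfl⟩ := Submodule.mem_sup.1 this
  have h0 : y ∈ G.gr 1 := (Submodule.add_mem_iff_left _ (D.odd_le hz)).1 hx
  have : y = 0 := Submodule.disjoint_def.1 G.isCompl.disjoint y (D.even_le hy) h0
  rwa [this, zero_add]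

theorem nil_eq : D.nil = (D.neg.n ⊔ D.pos.n) ⊔ (D.neg.o ⊔ D.pos.o) := by
  rw [nil]
  ac_rfl

theorem nil_le : D.nil ≤ L.carrier := by
  rw [D.nil_eq, D.carrier_eq]
  exact sup_le_sup_right le_sup_left _

theorem mem_even_of_nil {x : g} (hx : x ∈ D.nil) (hx0 : x ∈ G.gr 0) :
    x ∈ D.neg.n ⊔ D.pos.n := by
  rw [D.nil_eq] at hx
  obtain ⟨y, hy, z, hz, rfl⟩ := Submodule.mem_sup.1 hx
  have h0 : z ∈ G.gr 0 :=
    (Submodule.add_mem_iff_right _ (D.even_le (Submodule.mem_sup_left hy))).1 hx0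
  have : z = 0 := Submodule.disjoint_def.1 G.isCompl.disjoint z h0 (D.odd_le hz)
  rwa [this, add_zero]

theorem mem_odd_of_nil {x : g} (hx : x ∈ D.nil) (hx1 : x ∈ G.gr 1) : x ∈ D.neg.o ⊔ D.pos.o := by
  rw [D.nil_eq] at hx
  obtain ⟨y, hy, z, hz, rfl⟩ := Submodule.mem_sup.1 hx
  have h0 : y ∈ G.gr 1 := (Submodule.add_mem_iff_left _ (D.odd_le hz)).1 hx1
  have : y = 0 := Submodule.disjoint_def.1 G.isCompl.disjoint y
    (D.even_le (Submodule.mem_sup_left hy)) h0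
  rwa [this, zero_add]

/-- The ideal `L_1^- ⊕ n^- ⊕ n^+ ⊕ L_1^+`, if it is `p`-nilpotent. -/
def nilSubalgebra (hD : D.HasNilIdeal) : NilSubalgebra G h :=
  have hn : D.neg.n ⊔ D.pos.n ≤ D.nil := by rw [D.nil_eq]; exact le_sup_left
  have ho : D.neg.o ⊔ D.pos.o ≤ D.nil := by rw [D.nil_eq]; exact le_sup_right
  have hn0 : D.neg.n ⊔ D.pos.n ≤ G.gr 0 := le_sup_left.trans D.even_le
  have hh : h ≤ L.carrier := by rw [D.carrier_eq]; exact le_sup_of_le_left le_sup_right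
  { n := D.neg.n ⊔ D.pos.n
    o := D.neg.o ⊔ D.pos.o
    n_le := hn0
    o_le := D.odd_le
    br_nn := fun hx hy => D.mem_even_of_nil (hD.br_mem (D.nil_le (hn hx)) (hn hy))
      (G.br_mem (hn0 hx) (hn0 hy))
    br_no := fun hx hy => D.mem_odd_of_nil (hD.br_mem (D.nil_le (hn hx)) (ho hy))
      (G.br_mem (hn0 hx) (D.odd_le hy))
    br_oo := fun hx hy => D.mem_even_of_nil (hD.br_mem (D.nil_le (ho hx)) (ho hy))
      (G.br_mem (D.odd_le hx) (D.odd_le hy))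
    br_hn := fun hx hy => D.mem_even_of_nil (hD.br_mem (hh hx) (hn hy))
      (G.br_mem (D.neg.isTorus.le hx) (hn0 hy))
    br_ho := fun hx hy => D.mem_odd_of_nil (hD.br_mem (hh hx) (ho hy))
      (G.br_mem (D.neg.isTorus.le hx) (D.odd_le hy))
    pNilpotent := fun x hx => hD.pNilpotent x (hn hx) }

end TriangularDecomposition

/-! ### The classes of the baby Verma modules -/

section Weights

variable [Fact p.Prime] [CharP k p] [Fintype (G.Weight h)]

theorem sum_sum_weight_add {a b : ℕ} (ξ : Fin a → G.Weight h) (η : Fin b → G.Weight h) {A : Type*}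
    [AddCommMonoid A] (f : G.Weight h → A) :
    ∑ e : (Fin a → Fin p) × (Fin b → Fin 2), ∑ c : G.Weight h,
      f ((∑ i, (e.1 i : ℕ) • ξ i + ∑ j, (e.2 j : ℕ) • η j) + c) =
      (p ^ a * 2 ^ b) • ∑ μ, f μ := by
  have (e : (Fin a → Fin p) × (Fin b → Fin 2)) : ∑ c : G.Weight h,
      f ((∑ i, (e.1 i : ℕ) • ξ i + ∑ j, (e.2 j : ℕ) • η j) + c) = ∑ μ, f μ :=
    Equiv.sum_comp (Equiv.addLeft _) f
  rw [Finset.sum_congr rfl fun e _ => this e, Finset.sum_const, Finset.card_univ]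
  simp

theorem sum_weight_add {d a b : ℕ} {ζ : Fin d → G.Weight h}
    (hζ : Function.Bijective fun e : Fin d → Fin p => ∑ i, (e i : ℕ) • ζ i)
    (ξ : Fin a → G.Weight h) (η : Fin b → G.Weight h) {A : Type*} [AddCommMonoid A]
    (f : G.Weight h → A) (c : G.Weight h) :
    ∑ e : (Fin (d + a) → Fin p) × (Fin b → Fin 2),
      f ((∑ i, (e.1 i : ℕ) • Fin.append ζ ξ i + ∑ j, (e.2 j : ℕ) • η j) + c) =
      (p ^ a * 2 ^ b) • ∑ μ, f μ := by
  rw [← Equiv.sum_comp ((Fin.appendEquiv d a).prodCongr (Equiv.refl (Fin b → Fin 2))),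
    ← Equiv.sum_comp (Equiv.prodAssoc _ _ _).symm, Fintype.sum_prod_type_right]
  have (q : (Fin a → Fin p) × (Fin b → Fin 2)) :
      ∑ e : Fin d → Fin p, f ((∑ i, ((Fin.append e q.1 i : Fin p) : ℕ) • Fin.append ζ ξ i +
        ∑ j, (q.2 j : ℕ) • η j) + c) = ∑ μ, f μ := by
    rw [← Equiv.sum_comp
      (Equiv.addRight (∑ i, (q.1 i : ℕ) • ξ i + ∑ j, (q.2 j : ℕ) • η j + c)) f,
      ← hζ.sum_comp]
    refine Finset.sum_congr rfl fun e _ => ?_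
    simp [Fin.sum_univ_add, add_assoc]
  refine (Finset.sum_congr rfl fun q _ => this q).trans ?_
  rw [Finset.sum_const, Finset.card_univ]
  simp

end Weights

variable [IsAlgClosed k] [FiniteDimensional k g] [Fact p.Prime] [CharP k p]

/-- The regular module has a filtration by quotients of the modules induced from the Borel
subalgebra, in which each restricted weight occurs `p^{dim n} 2^{dim o}` times: the components of
`1` of the various weights generate it. -/
theorem Half.finrank_env_le_and_cls_eq [Fintype (G.Weight h)] (B : Half G h) :
    Module.finrank k G.Env ≤ (p ^ Module.finrank k B.n * 2 ^ Module.finrank k B.o) *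
        ∑ μ : G.Weight h, Module.finrank k (B.verma μ).carrier ∧
      (Module.finrank k G.Env = (p ^ Module.finrank k B.n * 2 ^ Module.finrank k B.o) *
        ∑ μ : G.Weight h, Module.finrank k (B.verma μ).carrier →
        G.regular.cls = (p ^ Module.finrank k B.n * 2 ^ Module.finrank k B.o) •
          ∑ μ : G.Weight h, (B.verma μ).cls) := by
  have hT := B.isTorus
  have hfin := G.finite_env
  obtain ⟨a, x, ξ, ha, hξ, hx⟩ := (isTorusRep_ad (G := G) hT).exists_basis hT
    (U := B.n) (fun x y hy => B.br_hn x.2 hy) (v := Fin.elim0) (μ := Fin.elim0)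
    linearIndependent_empty_type (fun i => i.elim0) (fun i => i.elim0)
  obtain ⟨b, y, η, hb, hη, hy⟩ := (isTorusRep_ad (G := G) hT).exists_basis hT
    (U := B.o) (fun x y hy => B.br_ho x.2 hy) (v := Fin.elim0) (μ := Fin.elim0)
    linearIndependent_empty_type (fun i => i.elim0) (fun i => i.elim0)
  rw [zero_add] at ha hb
  subst ha hb
  rw [Set.range_eq_empty, Set.empty_union] at hx hy
  obtain ⟨e, he, hsum⟩ := (isTorusRep_env (G := G) (M := G.Env) hT).exists_sum_weight hT
    (U := G.envGr 0) (fun x m hm => by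
      have := G.ι_mul_mem (hT.le x.2) hm
      rwa [zero_add] at this) G.one_mem_envGr
  have hxn : ∀ i, x i ∈ B.n := fun i => hx.le (Submodule.subset_span ⟨i, rfl⟩)
  have hyo : ∀ i, y i ∈ B.o := fun i => hy.le (Submodule.subset_span ⟨i, rfl⟩)
  have key := B.nilSubalgebra.finrank_le_and_cls_eq_of_monomial hT (fun i => B.n_le (hxn i))
    (fun i => B.o_le (hyo i)) hξ hη (T := h) (fun z hz => ⟨0, hT.le hz⟩)
    (S := B.borel.carrier) (by
      rw [Submodule.span_union, hx, hy, Submodule.span_eq, sup_comm B.n]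
      rfl)
    (fun s hs t ht => B.borel.br_mem hs ht) B.borel.pmap_mem
    (le_sup_of_le_left le_sup_right) (le_sup_of_le_left le_sup_left) (M := G.regular) (v := e)
    (μ := id) (fun c z hz => ⟨c.1 ⟨z, hz⟩, mem_weightSpace_env.1 (he c).2 ⟨z, hz⟩⟩)
    (fun c => ⟨0, (he c).1⟩) (fun c => (he c).2) (by
      refine (Ideal.eq_top_iff_one _).2 ?_
      rw [← hsum]
      exact Submodule.sum_mem _ fun c _ => Submodule.subset_span ⟨c, rfl⟩)
  simp only [B.finrank_verma, B.cls_verma]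
  have h1 := sum_sum_weight_add ξ η fun μ =>
    Module.finrank k (B.nilSubalgebra.induced hT μ.1).carrier
  have h2 := sum_sum_weight_add ξ η fun μ => (B.nilSubalgebra.induced hT μ.1).cls
  simp only [id] at key
  rw [h1, h2, smul_eq_mul] at key
  exact key

/-- The baby Verma module for `b^-` has a filtration by quotients of the modules induced from the
`p`-nilpotent ideal of `L`. The weights of the monomials in `n_L^+` are equidistributed, so that
each restricted weight occurs equally often, whatever the highest weight. -/
theorem TriangularDecomposition.finrank_verma_le_and_cls_eq [Fintype (G.Weight h)]
    {L : RestrictedSubalgebra G} (E : TriangularDecomposition G L h) (hE : E.HasNilIdeal)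
    (hEpos : G.HasIndependentWeights h E.pos.n) (B : Half G h)
    (hb : E.neg.borel.carrier = B.borel.carrier) (lam : G.Weight h) {a : ℕ}
    (ha : Module.finrank k h + a = Module.finrank k E.pos.n) :
    Module.finrank k (B.verma lam).carrier ≤ (p ^ a * 2 ^ Module.finrank k E.pos.o) *
        ∑ μ : G.Weight h, Module.finrank k ((E.nilSubalgebra hE).induced B.isTorus μ.1).carrier ∧
      (Module.finrank k (B.verma lam).carrier = (p ^ a * 2 ^ Module.finrank k E.pos.o) *
        ∑ μ : G.Weight h, Module.finrank k ((E.nilSubalgebra hE).induced B.isTorus μ.1).carrier →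
        (B.verma lam).cls = (p ^ a * 2 ^ Module.finrank k E.pos.o) •
          ∑ μ : G.Weight h, ((E.nilSubalgebra hE).induced B.isTorus μ.1).cls) := by
  have hT := B.isTorus
  obtain ⟨z, wt, hz, hzli, hwt, hwtli, hzwt⟩ := hEpos
  obtain ⟨a', x, ξ, ha', hξ, hx⟩ := (isTorusRep_ad (G := G) hT).exists_basis hT
    (U := E.pos.n) (fun x y hy => E.pos.br_hn x.2 hy) (μ := fun i => ⟨wt i, hwt i⟩) hzli hz
    (fun i => mem_weightSpace.2 (hzwt i))
  obtain rfl : a' = a := by omega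
  obtain ⟨b, y, η, hb', hη, hy⟩ := (isTorusRep_ad (G := G) hT).exists_basis hT
    (U := E.pos.o) (fun x y hy => E.pos.br_ho x.2 hy) (v := Fin.elim0) (μ := Fin.elim0)
    linearIndependent_empty_type (fun i => i.elim0) (fun i => i.elim0)
  rw [zero_add] at hb'
  subst hb'
  rw [Set.range_eq_empty, Set.empty_union] at hy
  have hx' : Submodule.span k (Set.range (Fin.append z x)) = E.pos.n := by
    rw [← hx]
    congr 1
    ext m
    constructor
    · rintro ⟨i, rfl⟩
      refine Fin.addCases (fun i => ?_) (fun i => ?_) i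
      · exact Or.inl ⟨i, by simp⟩
      · exact Or.inr ⟨i, by simp⟩
    · rintro (⟨i, rfl⟩ | ⟨i, rfl⟩)
      · exact ⟨Fin.castAdd _ i, by simp⟩
      · exact ⟨Fin.natAdd _ i, by simp⟩
  have hxn : ∀ i, Fin.append z x i ∈ E.pos.n := fun i =>
    hx'.le (Submodule.subset_span ⟨i, rfl⟩)
  have hyo : ∀ i, y i ∈ E.pos.o := fun i => hy.le (Submodule.subset_span ⟨i, rfl⟩)
  let v : (B.nilSubalgebra.induced hT lam.1).carrier := Submodule.Quotient.mk 1
  have hmk : ∀ r : G.Env, r ∈ B.nilSubalgebra.relations lam.1 → r • v = 0 := fun r hr => by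
    change r • (Submodule.Quotient.mk 1 : G.Env ⧸ B.nilSubalgebra.ideal lam.1) = 0
    rw [← Submodule.Quotient.mk_smul, smul_eq_mul, mul_one]
    exact (Submodule.Quotient.mk_eq_zero _).2 (Submodule.subset_span hr)
  have hvh : v ∈ weightSpace (G.envTorus h _) lam.1 := mem_weightSpace_env.2 fun x => by
    have := hmk _ (Or.inr (Or.inr ⟨x, rfl⟩))
    rwa [sub_smul, algebraMap_smul, sub_eq_zero] at this
  have hvn : ∀ x ∈ B.n ⊔ h, ∃ r : k, G.ι x • v = r • v := by
    intro x hx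
    obtain ⟨y, hy, z, hz, rfl⟩ := Submodule.mem_sup.1 hx
    refine ⟨lam.1 ⟨z, hz⟩, ?_⟩
    rw [map_add, add_smul, hmk _ (Or.inl ⟨y, hy, rfl⟩), zero_add]
    exact mem_weightSpace_env.1 hvh ⟨z, hz⟩
  have key := (E.nilSubalgebra hE).finrank_le_and_cls_eq_of_monomial hT
    (fun i => E.pos.n_le (hxn i)) (fun i => E.pos.o_le (hyo i))
    (ξ := Fin.append (fun i => ⟨wt i, hwt i⟩) ξ) (η := η) (fun i => by
      refine Fin.addCases (fun i => ?_) (fun i => ?_) i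
      · rw [Fin.append_left, Fin.append_left]
        exact mem_weightSpace.2 (hzwt i)
      · rw [Fin.append_right, Fin.append_right]
        exact hξ i) hη (T := E.neg.n ∪ E.neg.o ∪ h) (by
      rintro z ((hz | hz) | hz)
      · exact ⟨0, E.neg.n_le hz⟩
      · exact ⟨1, E.neg.o_le hz⟩
      · exact ⟨0, hT.le hz⟩)
    (S := L.carrier) (by
      rw [Submodule.span_union, hx', hy, Submodule.span_union, Submodule.span_union,
        Submodule.span_eq, Submodule.span_eq, Submodule.span_eq, E.carrier_eq]
      ac_rfl)
    (fun s hs t ht => L.br_mem hs ht) L.pmap_mem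
    (by rw [E.carrier_eq]; exact le_sup_of_le_left le_sup_left)
    (by rw [E.carrier_eq]; exact le_sup_right)
    (M := B.nilSubalgebra.induced hT lam.1) (C := Unit) (v := fun _ => v) (μ := fun _ => lam)
    (by
      rintro - z ((hz | hz) | hz)
      · refine hvn z ?_
        rw [← Half.n_sup_eq hb]
        exact Submodule.mem_sup_left hz
      · rw [SetLike.mem_coe, Half.o_eq hb] at hz
        exact ⟨0, by rw [hmk _ (Or.inr (Or.inl ⟨z, hz, rfl⟩)), zero_smul]⟩
      · exact hvn z (Submodule.mem_sup_right hz))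
    (fun _ => ⟨0, 1, G.one_mem_envGr, rfl⟩) (fun _ => hvh) (by
      rw [eq_top_iff]
      rintro m -
      obtain ⟨r, rfl⟩ := Submodule.mkQ_surjective _ m
      have : (B.nilSubalgebra.ideal lam.1).mkQ r = r • v := by
        change _ = r • (Submodule.Quotient.mk 1 : G.Env ⧸ B.nilSubalgebra.ideal lam.1)
        rw [← Submodule.Quotient.mk_smul, smul_eq_mul, mul_one]
        rfl
      rw [this]
      exact Submodule.smul_mem _ _ (Submodule.subset_span ⟨(), rfl⟩))
  have hbij := bijective_sum_weight (μ := fun i => ⟨wt i, hwt i⟩) hT hwtli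
  have h1 := sum_weight_add hbij ξ η (fun μ =>
    Module.finrank k ((E.nilSubalgebra hE).induced hT μ.1).carrier) lam
  have h2 := sum_weight_add hbij ξ η (fun μ => ((E.nilSubalgebra hE).induced hT μ.1).cls) lam
  simp only [Fintype.sum_unique] at key
  rw [h1, h2, smul_eq_mul] at key
  rw [B.finrank_verma, B.cls_verma]
  exact key

theorem eq_of_mul_le_mul_sum {J : Type*} [Fintype J] {f : J → ℕ} {A c : ℕ} (hA : 0 < A)
    (hf : ∀ j, f j ≤ c) (hle : A * (Fintype.card J * c) ≤ A * ∑ j, f j) : ∀ j, f j = c := by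
  have h1 : ∑ j, f j = ∑ _j : J, c := by
    refine le_antisymm (Finset.sum_le_sum fun j _ => hf j) ?_
    rw [Finset.sum_const, Finset.card_univ, smul_eq_mul]
    exact Nat.le_of_mul_le_mul_left hle hA
  exact fun j => (Finset.sum_eq_sum_iff_of_le fun j _ => hf j).1 h1 j (Finset.mem_univ j)

/-- The dimension of the baby Verma modules, and the class of the regular module. Let `b` be one
half of a triangular decomposition of `g`, and let `m`, `l` be the dimensions of the even and odd
part of the other half. -/
theorem Half.finrank_verma_and_cls_regular [Fintype (G.Weight h)] (B : Half G h) {m l : ℕ}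
    (hcard : Fintype.card (G.Weight h) = p ^ Module.finrank k h)
    (hm : m + (Module.finrank k B.n + Module.finrank k h) = Module.finrank k (G.gr 0))
    (hl : l + Module.finrank k B.o = Module.finrank k (G.gr 1)) :
    (∀ μ : G.Weight h, Module.finrank k (B.verma μ).carrier = p ^ m * 2 ^ l) ∧
      G.regular.cls = (p ^ Module.finrank k B.n * 2 ^ Module.finrank k B.o) •
          ∑ μ : G.Weight h, (B.verma μ).cls := by
  have hp := (Fact.out : p.Prime).pos
  obtain ⟨h1, h2⟩ := B.finrank_env_le_and_cls_eq
  have hle : ∀ μ : G.Weight h, Module.finrank k (B.verma μ).carrier ≤ p ^ m * 2 ^ l := fun μ => by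
    rw [B.finrank_verma]
    refine B.nilSubalgebra.finrank_induced_le B.isTorus μ.1 ?_ hl
    change m + Module.finrank k (B.n ⊔ h : Submodule k g) = _
    rw [finrank_sup_of_disjoint B.disjoint, hm]
  have hdim : p ^ Module.finrank k (G.gr 0) * 2 ^ Module.finrank k (G.gr 1) =
      (p ^ Module.finrank k B.n * 2 ^ Module.finrank k B.o) *
        (Fintype.card (G.Weight h) * (p ^ m * 2 ^ l)) := by
    rw [hcard, ← hm, ← hl]
    ring
  have hlow := G.le_finrank_env
  rw [hdim] at hlow
  have heq := eq_of_mul_le_mul_sum (by positivity) hle (hlow.trans h1)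
  refine ⟨heq, h2 (le_antisymm h1 ?_)⟩
  rw [Finset.sum_congr rfl fun μ _ => heq μ, Finset.sum_const, Finset.card_univ, smul_eq_mul]
  exact hlow

end RestrictedLieSuperalgebra

theorem proposition2p2 {k : Type u} [Field k] [IsAlgClosed k] {p : ℕ} [Fact p.Prime] [CharP k p]
    {g : Type v} [AddCommGroup g] [Module k g] [FiniteDimensional k g]
    (G : RestrictedLieSuperalgebra k p g) (h : Submodule k g)
    (D : G.TriangularDecomposition (.whole G) h) (hD : D.IsLong)
    (L : G.RestrictedSubalgebra) (E : G.TriangularDecomposition L h)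
    (hE : E.HasNilIdeal) (hEpos : G.HasIndependentWeights h E.pos.n)
    (hb : E.neg.borel.carrier = D.neg.borel.carrier)
    (hDneg : G.HasIndependentWeights h D.neg.n)
    (wt : G.Weight h) (s : ℤ) (t : ℕ)
    (hs : s = Module.finrank k D.pos.n - Module.finrank k D.neg.n - Module.finrank k h)
    (ht : t = Module.finrank k D.pos.o - Module.finrank k D.neg.o) :
    (0 ≤ s → (D.neg.verma wt).cls =
      ∑ᶠ μ : G.Weight h, (p ^ s.toNat * 2 ^ t) • (D.pos.verma μ).cls) ∧
    (s < 0 → p ^ (-s).toNat • (D.neg.verma wt).cls =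
      ∑ᶠ μ : G.Weight h, 2 ^ t • (D.pos.verma μ).cls) := by
  have hp := (Fact.out : p.Prime).pos
  have hT := D.neg.isTorus
  have := hT.finite_weight
  have := Fintype.ofFinite (G.Weight h)
  have hfin := G.finite_env
  rw [finsum_eq_sum_of_fintype, finsum_eq_sum_of_fintype, ← Finset.smul_sum, ← Finset.smul_sum]
  -- Dimensions of the pieces of the decompositions.
  have d0 := D.finrank_even
  have d1 := D.finrank_odd
  have e0 := E.finrank_even
  have e1 := E.finrank_odd
  have hen := RestrictedLieSuperalgebra.Half.finrank_n_eq hb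
  have heo : Module.finrank k E.neg.o = Module.finrank k D.neg.o := by rw [RestrictedLieSuperalgebra.Half.o_eq hb]
  have he0 := Submodule.finrank_mono E.even_le
  have he1 := Submodule.finrank_mono E.odd_le
  rw [D.gr_zero_eq] at d0
  rw [D.gr_one_eq] at d1
  have hlong := hD.2
  obtain ⟨z, ζ, hz, hzli, hζ, hζli, -⟩ := id hEpos
  have hcard : Fintype.card (G.Weight h) = p ^ Module.finrank k h := by
    rw [← Fintype.card_of_bijective (RestrictedLieSuperalgebra.bijective_sum_weight (μ := fun i => ⟨ζ i, hζ i⟩) hT hζli)]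
    simp
  obtain ⟨a, ha⟩ : ∃ a, Module.finrank k h + a = Module.finrank k E.pos.n := by
    have h1 := (LinearIndependent.of_comp E.pos.n.subtype
      (v := fun i => (⟨z i, hz i⟩ : E.pos.n)) hzli).fintype_card_le_finrank
    rw [Fintype.card_fin] at h1
    exact ⟨_, Nat.add_sub_cancel' h1⟩
  obtain ⟨hdim, hreg⟩ := D.neg.finrank_verma_and_cls_regular (m := Module.finrank k D.pos.n)
    (l := Module.finrank k D.pos.o) hcard (by omega) (by omega)
  obtain ⟨-, hreg'⟩ := D.pos.finrank_verma_and_cls_regular (m := Module.finrank k D.neg.n)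
    (l := Module.finrank k D.neg.o) hcard (by omega) (by omega)
  -- The class of the module induced from `b^-` does not depend on the weight.
  have hX : ∀ μ : G.Weight h, (D.neg.verma μ).cls = (p ^ a * 2 ^ Module.finrank k E.pos.o) •
      ∑ ν : G.Weight h, ((E.nilSubalgebra hE).induced hT ν.1).cls := fun μ => by
    obtain ⟨h1, h2⟩ := E.finrank_verma_le_and_cls_eq hE hEpos D.neg hb μ ha
    refine h2 (le_antisymm h1 ?_)
    have hW : ∀ ν : G.Weight h, Module.finrank k ((E.nilSubalgebra hE).induced hT ν.1).carrier ≤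
        p ^ (Module.finrank k D.pos.n - Module.finrank k E.pos.n) *
          2 ^ (Module.finrank k D.pos.o - Module.finrank k E.pos.o) := fun ν =>
      (E.nilSubalgebra hE).finrank_induced_le hT ν.1
        (show _ + Module.finrank k (E.neg.n ⊔ E.pos.n ⊔ h : Submodule k g) = _ by omega)
        (show _ + Module.finrank k (E.neg.o ⊔ E.pos.o : Submodule k g) = _ by omega)
    rw [hdim]
    refine (Nat.mul_le_mul_left _ (Finset.sum_le_sum fun ν _ => hW ν)).trans_eq ?_
    rw [Finset.sum_const, Finset.card_univ, hcard, smul_eq_mul]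
    have q1 : Module.finrank k D.pos.n = a + Module.finrank k h +
        (Module.finrank k D.pos.n - Module.finrank k E.pos.n) := by omega
    have q2 : Module.finrank k D.pos.o = Module.finrank k E.pos.o +
        (Module.finrank k D.pos.o - Module.finrank k E.pos.o) := by omega
    conv_rhs => rw [q1, q2]
    ring
  have hsum : ∑ μ : G.Weight h, (D.neg.verma μ).cls =
      p ^ Module.finrank k h • (D.neg.verma wt).cls := by
    rw [Finset.sum_congr rfl fun μ _ => (hX μ).trans (hX wt).symm, Finset.sum_const,
      Finset.card_univ, hcard]
  rw [hreg', hsum, smul_smul] at hreg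
  have ht' : Module.finrank k D.pos.o = Module.finrank k D.neg.o + t := by omega
  refine ⟨fun h0 => ?_, fun h0 => ?_⟩
  · have hs' : Module.finrank k D.pos.n =
        Module.finrank k D.neg.n + Module.finrank k h + s.toNat := by omega
    refine RestrictedLieSuperalgebra.SuperMod.nsmul_left_cancel (n := p ^ (Module.finrank k D.neg.n + Module.finrank k h) *
      2 ^ Module.finrank k D.neg.o) (by positivity) ?_
    rw [smul_smul]
    convert hreg.symm using 2
    · ring
    · rw [hs', ht']
      ring
  · have hs' : Module.finrank k D.neg.n + Module.finrank k h =
        Module.finrank k D.pos.n + (-s).toNat := by omega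
    refine RestrictedLieSuperalgebra.SuperMod.nsmul_left_cancel (n := p ^ Module.finrank k D.pos.n *
      2 ^ Module.finrank k D.neg.o) (by positivity) ?_
    rw [smul_smul, smul_smul]
    convert hreg.symm using 2
    · rw [mul_right_comm, ← pow_add, ← hs']
      ring
    · rw [ht']
      ring
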